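/- Let $D\subseteq\mathbb R^3$ be open (a coordinate domain) and let $\gamma=\gamma_{ij}(x)\,dx^i dx^j$ be a smooth Riemannian metric on $D$, with Levi-Civita connection $\nabla$ and Ricci tensor $R=R(\gamma)$. Indices are raised and lowered with $\gamma$; products and traces of 2-tensors are taken with $\gamma$. Put $$s=\operatorname{tr}R^2,\qquad t=\operatorname{tr}R^3,\qquad P=6R^2-s\,\gamma ,\qquad \Omega=-\frac{s}{18\,t}.$$ A static vacuum B-metric with spatial metric $\gamma$ and potential $U$ is a space-time metric $g=-e^{2U(x)}\,dT^2+\gamma_{ij}(x)\,dx^i dx^j$ that is Ricci-flat, has Weyl tensor everywhere of Petrov type D, and whose (non-zero) double Weyl eigenvalue has its gradient on the space-like principal 2-plane. (In an orthonormal frame $u_0,u_1,u_2,u_3$ with $u_0$ time-like, adapted to the type D Weyl tensor, the matrix $E+iB$ formed by its electric and magnetic parts is $\operatorname{diag}(-2\rho,\rho,\rho)$, where $\rho\neq0$ is the double eigenvalue. The time-like and space-like principal planes are $\langle u_0,u_1\rangle$ and $\langle u_2,u_3\rangle$, and the gradient condition is $d\rho(u_0)=d\rho(u_1)=0$.) **Theorem.**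 The metric $\gamma$ is locally the spatial metric of a static vacuum B-metric (that is, every point of $D$ has an open neighbourhood $N\subseteq D$ and a smooth function $U$ on $N$ such that $-e^{2U}dT^2+\gamma$ is a static vacuum B-metric on $\mathbb R\times N$) if and only if, everywhere on $D$, $t\neq0$ (so that $\Omega$ is defined) and $$\operatorname{tr}R=0,\qquad 6t^2=s^3,\qquad P(ds)=0,$$ $$R=\Omega^{-1/3}\,\nabla d\,\Omega^{1/3}-2\,\bigl[\Omega+(d\Omega)^2\bigr]\,P ,$$ where $\Omega^{1/3}$ is the real cube root and $(d\Omega)^2=\gamma^{ij}\,\partial_i\Omega\,\partial_j\Omega$. -/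

import Mathlib

open scoped ContDiff

namespace StaticVacuum

noncomputable section

/-! Pseudo-Riemannian geometry on open subsets of `ℝⁿ`, in coordinates.  A metric is its matrix of
components `g x i j`; all index sums are written out. -/

/-- A metric (or any other covariant 2-tensor field) in coordinates: its matrix of components. -/
abbrev TensorField (n : ℕ) := (Fin n → ℝ) → Matrix (Fin n) (Fin n) ℝ

/-- The partial derivative `∂ᵢ f`. -/
def pd {n : ℕ} (i : Fin n) (f : (Fin n → ℝ) → ℝ) (x : Fin n → ℝ) : ℝ :=
  fderiv ℝ f x (Pi.single i 1)

/-- `g` is a smooth Riemannian metric on the set `D`. -/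
def IsRiemannianMetricOn {n : ℕ} (g : TensorField n) (D : Set (Fin n → ℝ)) : Prop :=
  (∀ i j, ContDiffOn ℝ ∞ (fun x => g x i j) D) ∧ ∀ x ∈ D, (g x).PosDef

/-- Christoffel symbols `Γᵏᵢⱼ = ½ gᵏˡ (∂ᵢ gⱼₗ + ∂ⱼ gᵢₗ - ∂ₗ gᵢⱼ)` of the Levi-Civita connection. -/
def christoffel {n : ℕ} (g : TensorField n) (k i j : Fin n) (x : Fin n → ℝ) : ℝ :=
  (1 / 2) * ∑ l, (g x)⁻¹ k l *
    (pd i (fun y => g y j l) x + pd j (fun y => g y i l) x - pd l (fun y => g y i j) x)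

/-- Curvature `Rᵃ_{bcd} = ∂_c Γᵃ_{db} - ∂_d Γᵃ_{cb} + Γᵃ_{ce} Γᵉ_{db} - Γᵃ_{de} Γᵉ_{cb}`. -/
def curvature {n : ℕ} (g : TensorField n) (a b c d : Fin n) (x : Fin n → ℝ) : ℝ :=
  pd c (christoffel g a d b) x - pd d (christoffel g a c b) x
    + ∑ e, (christoffel g a c e x * christoffel g e d b x
      - christoffel g a d e x * christoffel g e c b x)

/-- The Riemann tensor with all indices down, `R_{abcd} = g_{ae} Rᵉ_{bcd}`. -/
def riemann {n : ℕ} (g : TensorField n) (a b c d : Fin n) (x : Fin n → ℝ) : ℝ :=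
  ∑ e, g x a e * curvature g e b c d x

/-- The Ricci tensor `R_{bd} = Rᵃ_{bad}`. -/
def ricci {n : ℕ} (g : TensorField n) : TensorField n :=
  fun x => Matrix.of fun b d => ∑ a, curvature g a b a d x

/-- The second covariant derivative `(∇df)ᵢⱼ = ∂ᵢ∂ⱼ f - Γᵏᵢⱼ ∂ₖ f`. -/
def hessian {n : ℕ} (g : TensorField n) (f : (Fin n → ℝ) → ℝ) : TensorField n :=
  fun x => Matrix.of fun i j => pd i (pd j f) x - ∑ k, christoffel g k i j x * pd k f x

/-- The metric trace `gⁱʲ Tᵢⱼ`. -/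
def metricTrace {n : ℕ} (g T : TensorField n) (x : Fin n → ℝ) : ℝ :=
  ((g x)⁻¹ * T x).trace

/-- The product of covariant 2-tensors, `(S T)ᵢⱼ = Sᵢₖ gᵏˡ Tₗⱼ`. -/
def tensorMul {n : ℕ} (g S T : TensorField n) : TensorField n :=
  fun x => S x * (g x)⁻¹ * T x

/-- The squared norm `(df)² = gⁱʲ ∂ᵢf ∂ⱼf`. -/
def gradSq {n : ℕ} (g : TensorField n) (f : (Fin n → ℝ) → ℝ) (x : Fin n → ℝ) : ℝ :=
  ∑ i, ∑ j, (g x)⁻¹ i j * pd i f x * pd j f x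

/-- The contraction `T(df)ᵢ = Tᵢⱼ gʲᵏ ∂ₖf`. -/
def contractGrad {n : ℕ} (g T : TensorField n) (f : (Fin n → ℝ) → ℝ) (x : Fin n → ℝ) :
    Fin n → ℝ :=
  fun i => ∑ j, ∑ k, T x i j * (g x)⁻¹ j k * pd k f x

/-! Four-dimensional space-times. -/

/-- The Weyl tensor of a four-dimensional metric, `W_{abcd} =
R_{abcd} - ½ (g_{ac} R_{bd} - g_{ad} R_{bc} + g_{bd} R_{ac} - g_{bc} R_{ad})
+ (S/6) (g_{ac} g_{bd} - g_{ad} g_{bc})`, with `S` the scalar curvature. -/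
def weyl (g : TensorField 4) (a b c d : Fin 4) (x : Fin 4 → ℝ) : ℝ :=
  riemann g a b c d x
    - (1 / 2) * (g x a c * ricci g x b d - g x a d * ricci g x b c
      + g x b d * ricci g x a c - g x b c * ricci g x a d)
    + metricTrace g (ricci g) x / 6 * (g x a c * g x b d - g x a d * g x b c)

/-- The value `W(p, q, v, w)` of the Weyl tensor on four vectors at `x`. -/
def weylEval (g : TensorField 4) (x p q v w : Fin 4 → ℝ) : ℝ :=
  ∑ a, ∑ b, ∑ c, ∑ d, weyl g a b c d x * p a * q b * v c * w d

/-- The rows `u 0, u 1, u 2, u 3` are an orthonormal frame at `x`, with `u 0` time-like. -/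
def IsOrthonormalFrame (g : TensorField 4) (x : Fin 4 → ℝ) (u : Matrix (Fin 4) (Fin 4) ℝ) : Prop :=
  u * g x * u.transpose = Matrix.diagonal ![-1, 1, 1, 1]

/-- The complex trace-free symmetric matrix `E + iB` that represents the Weyl tensor in an
orthonormal frame: the electric part is `E_{jk} = W(u₀, uⱼ, u₀, uₖ)` and the magnetic part is
`B_{jk} = W(u₀, uⱼ, uₗ, uₘ)`, with `(k, l, m)` a cyclic permutation of `(1, 2, 3)`. -/
def weylMatrix (g : TensorField 4) (x : Fin 4 → ℝ) (u : Matrix (Fin 4) (Fin 4) ℝ) :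
    Matrix (Fin 3) (Fin 3) ℂ :=
  Matrix.of fun j k =>
    (weylEval g x (u 0) (u j.succ) (u 0) (u k.succ) : ℂ)
      + Complex.I * (weylEval g x (u 0) (u j.succ) (u (k + 1).succ) (u (k + 2).succ) : ℂ)

/-- The Weyl tensor at `x` is of Petrov type D with (non-zero, in general complex) double
eigenvalue `ρ`, and `u` is a canonical frame for it: the time-like principal plane is spanned by
`u 0, u 1` and the space-like principal plane by `u 2, u 3`. -/
def IsTypeDFrame (g : TensorField 4) (x : Fin 4 → ℝ) (ρ : ℂ) (u : Matrix (Fin 4) (Fin 4) ℝ) :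
    Prop :=
  IsOrthonormalFrame g x u ∧ ρ ≠ 0 ∧ weylMatrix g x u = Matrix.diagonal ![-2 * ρ, ρ, ρ]

/-- On the open set `S` the metric `g` is everywhere of Petrov type D, and the gradient of its
Weyl eigenvalue lies on the space-like principal plane, that is, the eigenvalue has zero derivative
along the time-like principal plane. -/
def IsTypeBOn (g : TensorField 4) (S : Set (Fin 4 → ℝ)) : Prop :=
  ∃ ρ : (Fin 4 → ℝ) → ℂ, ContDiffOn ℝ ∞ ρ S ∧
    ∀ x ∈ S, ∃ u : Matrix (Fin 4) (Fin 4) ℝ, IsTypeDFrame g x (ρ x) u ∧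
      fderiv ℝ ρ x (u 0) = 0 ∧ fderiv ℝ ρ x (u 1) = 0

/-- The static metric `- e^{2U} dT² + γᵢⱼ dxⁱ dxʲ` in the coordinates `(T, x¹, x², x³)`. -/
def staticMetric (γ : TensorField 3) (U : (Fin 3 → ℝ) → ℝ) : TensorField 4 :=
  fun y => Matrix.of <| Fin.cons
    (Fin.cons (-Real.exp (2 * U (Fin.tail y))) fun _ => 0)
    fun i => Fin.cons 0 fun j => γ (Fin.tail y) i j

/-- The space-time region `ℝ × N` over `N ⊆ ℝ³`. -/
def cylinder (N : Set (Fin 3 → ℝ)) : Set (Fin 4 → ℝ) :=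
  {y | Fin.tail y ∈ N}

/-- `γ` is, around each point of `D`, the spatial metric of a static vacuum B-metric: there is a
smooth potential `U` near the point for which `- e^{2U} dT² + γ` is a Ricci-flat B-metric. -/
def IsSpatialMetricOfBMetric (γ : TensorField 3) (D : Set (Fin 3 → ℝ)) : Prop :=
  ∀ x ∈ D, ∃ N : Set (Fin 3 → ℝ), IsOpen N ∧ x ∈ N ∧ N ⊆ D ∧
    ∃ U : (Fin 3 → ℝ) → ℝ, ContDiffOn ℝ ∞ U N ∧
      (∀ y ∈ cylinder N, ricci (staticMetric γ U) y = 0) ∧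
      IsTypeBOn (staticMetric γ U) (cylinder N)

/-! Concomitants of a three-dimensional metric. -/

/-- `R²`, the square of the Ricci tensor. -/
def ricciSq (γ : TensorField 3) : TensorField 3 :=
  tensorMul γ (ricci γ) (ricci γ)

/-- `s = tr R²`. -/
def sInv (γ : TensorField 3) : (Fin 3 → ℝ) → ℝ :=
  metricTrace γ (ricciSq γ)

/-- `t = tr R³`. -/
def tInv (γ : TensorField 3) : (Fin 3 → ℝ) → ℝ :=
  metricTrace γ (tensorMul γ (ricciSq γ) (ricci γ))

/-- `P = 6 R² - s γ`. -/
def PTensor (γ : TensorField 3) : TensorField 3 :=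
  fun x => (6 : ℝ) • ricciSq γ x - sInv γ x • γ x

/-- `Ω = - s / (18 t)`. -/
def Omega (γ : TensorField 3) (x : Fin 3 → ℝ) : ℝ :=
  -sInv γ x / (18 * tInv γ x)

/-- The real cube root, also of negative numbers. -/
def cbrt (y : ℝ) : ℝ :=
  (SignType.sign y : ℝ) * |y| ^ (1 / 3 : ℝ)

end

end StaticVacuum

namespace StaticVacuum

/-! Calculus of partial derivatives. -/

section Calculus

variable {n : ℕ} {f h : (Fin n → ℝ) → ℝ} {x : Fin n → ℝ} {D : Set (Fin n → ℝ)}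

/-! Write `T(u) = ∇du + du ⊗ du`. A static metric is Ricci-flat exactly when `T(U) = R` and `tr R =
0` (`static_ricci_eq_zero_iff`). Its Weyl tensor is then purely electric in a static frame, with
electric part `R` (`static_weylEval_frame`).

Algebra. On self-dual bivectors a change of Lorentz frame is a complex rotation. A real symmetric
matrix that such a rotation takes to `diag(-2ρ, ρ, ρ)` with `ρ ≠ 0` has `ρ` real and a real simple
axis (`real_of_complex_diagonal`). So type D means `R = ρ(γ - 3 n ⊗ n)` with `n` a unit covector.
The vector dual to `n` lies in the time-like principal plane, and the gradient condition becomes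
`⟨n, dρ⟩ = 0` (`ricci_of_isTypeDFrame`, `uniaxial_of_typeB`). Then `s = 6ρ²`, `t = -6ρ³`, `P = 18ρ²
n ⊗ n` and `Ω = 1/(18ρ)`. Conversely, `tr R = 0`, `6t² = s³` and `t ≠ 0` force this shape, by the
discriminant of the eigenvalues (`exists_frame_of_double_eigenvalue`), and `P(ds) = 0` is the
gradient condition. With `ℓ = log|Ω|/3` and `Q = (dℓ)²` one has `dρ = -3ρ dℓ`, and the last equation
of the criterion reads `T(ℓ) = R + (2ρ + Q) n ⊗ n` (`criterion_iff`).

Necessity. In dimension three with `tr R = 0` the curvature is a linear expression in `R`, so the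
Ricci identity for `T(U) = R` is an algebraic system in `dU`, `dℓ` and `∇n`. It gives `dU = dℓ + ν
n` and `∇n = -n ⊗ dℓ` (`integrability_of_vacuum`). Putting this back into `T(U) = R` and
differentiating `⟨n, dℓ⟩ = 0` yields the criterion (`hessian_of_vacuum`).

Sufficiency. The criterion gives `dQ = 2(ρ - Q) dℓ`, and the Ricci identity for `ℓ` gives `∇n = -n ⊗
dℓ` wherever `ρ ≠ Q`. Equality cannot hold on an open set, so the formula holds everywhere
(`covDeriv_eq`). Hence `e^{-ℓ} n` is closed, locally `dσ`, and `K = -(2ρ + Q) e^{2ℓ}` is locally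
constant. For `U = ℓ + F(σ)` the vacuum equation reduces to `F'' + F'² = K`, which is solved
explicitly (`exists_vacuum_potential`). -/

theorem _root_.ContDiffOn.diffAt (hf : ContDiffOn ℝ ∞ f D) (hD : IsOpen D) (hx : x ∈ D) :
    DifferentiableAt ℝ f x :=
  (hf.contDiffAt (hD.mem_nhds hx)).differentiableAt (by simp)

theorem pd_add (i : Fin n) (hf : DifferentiableAt ℝ f x) (hh : DifferentiableAt ℝ h x) :
    pd i (fun y => f y + h y) x = pd i f x + pd i h x := by
  simp [pd, fderiv_fun_add hf hh]

theorem pd_sub (i : Fin n) (hf : DifferentiableAt ℝ f x) (hh : DifferentiableAt ℝ h x) :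
    pd i (fun y => f y - h y) x = pd i f x - pd i h x := by
  simp [pd, fderiv_fun_sub hf hh]

theorem pd_mul (i : Fin n) (hf : DifferentiableAt ℝ f x) (hh : DifferentiableAt ℝ h x) :
    pd i (fun y => f y * h y) x = pd i f x * h x + f x * pd i h x := by
  simp [pd, fderiv_fun_mul hf hh]; ring

theorem pd_const (i : Fin n) (c : ℝ) : pd i (fun _ => c) x = 0 := by
  simp [pd]

theorem pd_const_mul (i : Fin n) (c : ℝ) (hf : DifferentiableAt ℝ f x) :
    pd i (fun y => c * f y) x = c * pd i f x := by
  rw [pd_mul i (differentiableAt_const c) hf, pd_const]; ring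

theorem pd_sum {ι : Type*} (s : Finset ι) (i : Fin n) {F : ι → (Fin n → ℝ) → ℝ}
    (hF : ∀ a ∈ s, DifferentiableAt ℝ (F a) x) :
    pd i (fun y => ∑ a ∈ s, F a y) x = ∑ a ∈ s, pd i (F a) x := by
  simp [pd, fderiv_fun_sum hF]

theorem pd_comp (i : Fin n) {φ : ℝ → ℝ} {φ' : ℝ} (hφ : HasDerivAt φ φ' (f x))
    (hf : DifferentiableAt ℝ f x) : pd i (fun y => φ (f y)) x = φ' * pd i f x := by
  have := (hφ.comp_hasFDerivAt x hf.hasFDerivAt).fderiv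
  simp only [pd, Function.comp_def] at this ⊢
  rw [this]; simp

theorem pd_congr (hD : IsOpen D) (hx : x ∈ D) (i : Fin n) (hfh : ∀ y ∈ D, f y = h y) :
    pd i f x = pd i h x := by
  have : f =ᶠ[nhds x] h := Filter.eventually_of_mem (hD.mem_nhds hx) hfh
  simp [pd, this.fderiv_eq]

theorem _root_.ContDiffOn.pd (hf : ContDiffOn ℝ ∞ f D) (hD : IsOpen D) (i : Fin n) :
    ContDiffOn ℝ ∞ (pd i f) D :=
  (hf.fderiv_of_isOpen hD (by simp)).clm_apply contDiffOn_const

theorem pd_comm (hf : ContDiffOn ℝ ∞ f D) (hD : IsOpen D) (hx : x ∈ D) (i j : Fin n) :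
    pd i (pd j f) x = pd j (pd i f) x := by
  have hs := (hf.contDiffAt (hD.mem_nhds hx)).isSymmSndFDerivAt (by
    simp only [minSmoothness_of_isRCLikeNormedField]; exact WithTop.coe_le_coe.2 le_top)
  have hd : DifferentiableAt ℝ (fderiv ℝ f) x :=
    ((hf.fderiv_of_isOpen hD (m := ∞) (by simp)).contDiffAt (hD.mem_nhds hx)).differentiableAt
      (by simp)
  have key : ∀ a b : Fin n, StaticVacuum.pd a (StaticVacuum.pd b f) x
      = fderiv ℝ (fderiv ℝ f) x (Pi.single a 1) (Pi.single b 1) := by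
    intro a b
    have := (hd.hasFDerivAt.clm_apply (hasFDerivAt_const (Pi.single b (1 : ℝ)) x)).fderiv
    change fderiv ℝ (fun y => fderiv ℝ f y (Pi.single b 1)) x (Pi.single a 1) = _
    rw [this]; simp
  rw [key, key, hs.eq]

theorem fderiv_eq_sum_pd (f : (Fin n → ℝ) → ℝ) (x v : Fin n → ℝ) :
    fderiv ℝ f x v = ∑ i, v i * pd i f x := by
  conv_lhs => rw [← Finset.univ_sum_single v, map_sum]
  refine Finset.sum_congr rfl fun i _ => ?_
  have : (Pi.single i (v i) : Fin n → ℝ) = v i • Pi.single i 1 := by simp [← Pi.single_smul]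
  rw [this, map_smul]; rfl

/-- The entrywise partial derivative of a matrix-valued function. -/
noncomputable def pdMat (i : Fin n) (M : TensorField n) : TensorField n :=
  fun x => Matrix.of fun j k => pd i (fun y => M y j k) x

/-- All entries are smooth on `D`. -/
def SmoothEntries (M : TensorField n) (D : Set (Fin n → ℝ)) : Prop :=
  ∀ i j, ContDiffOn ℝ ∞ (fun x => M x i j) D

variable {M N : TensorField n}

theorem SmoothEntries.mul (hM : SmoothEntries M D) (hN : SmoothEntries N D) :
    SmoothEntries (fun x => M x * N x) D := fun i j => by
  simp only [Matrix.mul_apply]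
  exact ContDiffOn.sum fun k _ => (hM i k).mul (hN k j)

theorem SmoothEntries.trace (hM : SmoothEntries M D) :
    ContDiffOn ℝ ∞ (fun x => (M x).trace) D :=
  ContDiffOn.sum fun i _ => hM i i

theorem SmoothEntries.det {m : ℕ} {M : (Fin n → ℝ) → Matrix (Fin m) (Fin m) ℝ}
    (hM : ∀ i j, ContDiffOn ℝ ∞ (fun x => M x i j) D) :
    ContDiffOn ℝ ∞ (fun x => (M x).det) D := by
  simp only [Matrix.det_apply]
  refine ContDiffOn.sum fun σ _ => ContDiffOn.const_smul _ ?_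
  exact contDiffOn_prod fun i _ => hM _ _

theorem SmoothEntries.inv (hM : SmoothEntries M D) (hd : ∀ x ∈ D, IsUnit (M x).det) :
    SmoothEntries (fun x => (M x)⁻¹) D := fun i j => by
  simp only [Matrix.inv_def, Ring.inverse_eq_inv', Matrix.smul_apply, smul_eq_mul,
    Matrix.adjugate_apply]
  refine ((SmoothEntries.det hM).inv fun x hx => (hd x hx).ne_zero).mul (SmoothEntries.det ?_)
  intro a b
  by_cases hb : a = j
  · subst hb; simpa using contDiffOn_const
  · simpa [Matrix.updateRow_ne hb] using hM a b

theorem pdMat_mul (hM : SmoothEntries M D) (hN : SmoothEntries N D) (hD : IsOpen D) (hx : x ∈ D)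
    (i : Fin n) : pdMat i (fun y => M y * N y) x = pdMat i M x * N x + M x * pdMat i N x := by
  ext j k
  simp only [pdMat, Matrix.of_apply, Matrix.mul_apply, Matrix.add_apply]
  rw [pd_sum (F := fun a y => M y j a * N y a k) _ _
    fun a _ => ((hM j a).diffAt hD hx).fun_mul ((hN a k).diffAt hD hx),
    ← Finset.sum_add_distrib]
  exact Finset.sum_congr rfl fun a _ =>
    pd_mul i ((hM j a).diffAt hD hx) ((hN a k).diffAt hD hx)

theorem pdMat_congr (hD : IsOpen D) (hx : x ∈ D) (i : Fin n) (h : ∀ y ∈ D, M y = N y) :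
    pdMat i M x = pdMat i N x := by
  ext j k
  exact pd_congr hD hx i fun y hy => by rw [h y hy]

theorem pdMat_add (hM : SmoothEntries M D) (hN : SmoothEntries N D) (hD : IsOpen D) (hx : x ∈ D)
    (i : Fin n) : pdMat i (fun y => M y + N y) x = pdMat i M x + pdMat i N x := by
  ext j k
  exact pd_add i ((hM j k).diffAt hD hx) ((hN j k).diffAt hD hx)

theorem pdMat_transpose (i : Fin n) :
    pdMat i (fun y => (M y).transpose) x = (pdMat i M x).transpose := rfl

theorem pdMat_comm (hM : SmoothEntries M D) (hD : IsOpen D) (hx : x ∈ D) (i j : Fin n) :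
    pdMat i (pdMat j M) x = pdMat j (pdMat i M) x := by
  ext a b
  exact pd_comm (hM a b) hD hx i j

end Calculus

/-! The Levi-Civita connection of a pseudo-Riemannian metric. -/

section LeviCivita

variable {n : ℕ} {g : TensorField n} {x : Fin n → ℝ} {D : Set (Fin n → ℝ)}

/-- `g` is a smooth pseudo-Riemannian metric on the open set `D`. -/
structure IsMetricOn (g : TensorField n) (D : Set (Fin n → ℝ)) : Prop where
  isOpen : IsOpen D
  smooth : SmoothEntries g D
  symm : ∀ x ∈ D, ∀ i j, g x i j = g x j i
  det : ∀ x ∈ D, IsUnit (g x).det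

theorem IsMetricOn.mono (hg : IsMetricOn g D) {N : Set (Fin n → ℝ)} (hN : IsOpen N)
    (h : N ⊆ D) : IsMetricOn g N :=
  ⟨hN, fun i j => (hg.smooth i j).mono h, fun x hx => hg.symm x (h hx),
    fun x hx => hg.det x (h hx)⟩

theorem IsRiemannianMetricOn.isMetricOn (hD : IsOpen D) (hg : IsRiemannianMetricOn g D) :
    IsMetricOn g D where
  isOpen := hD
  smooth := hg.1
  symm x hx i j := by simpa using ((hg.2 x hx).isHermitian.apply i j).symm
  det x hx := (Matrix.isUnit_iff_isUnit_det _).1 (hg.2 x hx).isUnit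

namespace IsMetricOn

variable (hg : IsMetricOn g D)
include hg

theorem transpose (hx : x ∈ D) : (g x).transpose = g x := by
  ext i j; exact hg.symm x hx j i

theorem inv_symm (hx : x ∈ D) (i j : Fin n) : (g x)⁻¹ i j = (g x)⁻¹ j i := by
  have : ((g x)⁻¹).transpose = (g x)⁻¹ := by
    rw [Matrix.transpose_nonsing_inv, hg.transpose hx]
  exact congrFun (congrFun this j) i

theorem smooth_inv : SmoothEntries (fun x => (g x)⁻¹) D := hg.smooth.inv hg.det

theorem smooth_christoffel (k i j : Fin n) : ContDiffOn ℝ ∞ (christoffel g k i j) D := by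
  unfold christoffel
  refine contDiffOn_const.mul (ContDiffOn.sum fun l _ => (hg.smooth_inv k l).mul ?_)
  exact (((hg.smooth j l).pd hg.isOpen i).add ((hg.smooth i l).pd hg.isOpen j)).sub
    ((hg.smooth i j).pd hg.isOpen l)

theorem smooth_curvature (a b c d : Fin n) : ContDiffOn ℝ ∞ (curvature g a b c d) D := by
  unfold curvature
  refine (((hg.smooth_christoffel _ _ _).pd hg.isOpen c).sub
    ((hg.smooth_christoffel _ _ _).pd hg.isOpen d)).add (ContDiffOn.sum fun e _ => ?_)
  exact ((hg.smooth_christoffel _ _ _).mul (hg.smooth_christoffel _ _ _)).sub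
    ((hg.smooth_christoffel _ _ _).mul (hg.smooth_christoffel _ _ _))

theorem smooth_ricci : SmoothEntries (ricci g) D := fun b d => by
  simp only [ricci, Matrix.of_apply]
  exact ContDiffOn.sum fun a _ => hg.smooth_curvature a b a d

theorem christoffel_symm (hx : x ∈ D) (k i j : Fin n) :
    christoffel g k i j x = christoffel g k j i x := by
  unfold christoffel
  congr 1
  refine Finset.sum_congr rfl fun l _ => ?_
  rw [pd_congr hg.isOpen hx l fun y hy => hg.symm y hy i j]; ring

end IsMetricOn

/-- The connection matrix `(Γˡᵢⱼ)ⱼₗ` in the direction `i`. -/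
noncomputable def conn (g : TensorField n) (i : Fin n) : TensorField n :=
  fun x => Matrix.of fun j l => christoffel g l i j x

/-- The curvature matrix `(Rᵃ_{bcd})_{ba}`. -/
noncomputable def curvMat (g : TensorField n) (c d : Fin n) : TensorField n :=
  fun x => Matrix.of fun b a => curvature g a b c d x

theorem curvMat_eq (c d : Fin n) : curvMat g c d x = pdMat c (conn g d) x - pdMat d (conn g c) x
    + conn g d x * conn g c x - conn g c x * conn g d x := by
  ext b a
  simp only [curvMat, curvature, pdMat, conn, Matrix.of_apply, Matrix.sub_apply, Matrix.add_apply,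
    Matrix.mul_apply, Finset.sum_sub_distrib]
  have h1 : ∀ c d : Fin n, ∑ e, christoffel g a c e x * christoffel g e d b x
      = ∑ e, christoffel g e d b x * christoffel g a c e x :=
    fun c d => Finset.sum_congr rfl fun e _ => mul_comm _ _
  rw [h1, h1]
  ring!

namespace IsMetricOn

variable (hg : IsMetricOn g D)
include hg

theorem smooth_conn (i : Fin n) : SmoothEntries (conn g i) D :=
  fun j l => hg.smooth_christoffel l i j

theorem conn_mul (hx : x ∈ D) (i j k : Fin n) : (conn g i x * g x) j k
    = (1 / 2) * (pd i (fun y => g y j k) x + pd j (fun y => g y i k) x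
      - pd k (fun y => g y i j) x) := by
  set B : Fin n → ℝ := fun l => pd i (fun y => g y j l) x + pd j (fun y => g y i l) x
      - pd l (fun y => g y i j) x with hB
  have h1 : ∀ l, conn g i x j l = (1 / 2) * Matrix.vecMul B (g x)⁻¹ l := by
    intro l
    simp only [conn, christoffel, Matrix.of_apply, Matrix.vecMul, dotProduct, hB]
    congr 1
    exact Finset.sum_congr rfl fun m _ => by rw [hg.inv_symm hx]; ring
  have h2 : (conn g i x * g x) j k = (1 / 2) * Matrix.vecMul (Matrix.vecMul B (g x)⁻¹) (g x) k := by
    simp only [Matrix.mul_apply, h1]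
    rw [Matrix.vecMul, dotProduct, Finset.mul_sum]
    exact Finset.sum_congr rfl fun m _ => by ring
  rw [h2, Matrix.vecMul_vecMul, Matrix.nonsing_inv_mul _ (hg.det x hx), Matrix.vecMul_one]

/-- This is `∇g = 0`: symmetrising the Christoffel symbols of the first kind leaves one derivative
of the metric. -/
theorem pdMat_metric (hx : x ∈ D) (i : Fin n) :
    pdMat i g x = conn g i x * g x + (conn g i x * g x).transpose := by
  ext j k
  rw [Matrix.add_apply, Matrix.transpose_apply, hg.conn_mul hx, hg.conn_mul hx,
    pd_congr hg.isOpen hx i fun y hy => hg.symm y hy k j]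
  simp only [pdMat, Matrix.of_apply]
  ring

theorem pdMat_metric' (hx : x ∈ D) (i : Fin n) :
    pdMat i g x = conn g i x * g x + g x * (conn g i x).transpose := by
  rw [hg.pdMat_metric hx, Matrix.transpose_mul, hg.transpose hx]

theorem pdMat_inv (hx : x ∈ D) (i : Fin n) : pdMat i (fun y => (g y)⁻¹) x
    = -((g x)⁻¹ * conn g i x + (conn g i x).transpose * (g x)⁻¹) := by
  have h1 : pdMat i (fun y => g y * (g y)⁻¹) x = 0 := by
    rw [pdMat_congr (N := fun _ => 1) hg.isOpen hx i
      fun y hy => Matrix.mul_nonsing_inv _ (hg.det y hy)]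
    ext j k; simp [pdMat, pd_const]
  rw [pdMat_mul hg.smooth hg.smooth_inv hg.isOpen hx, hg.pdMat_metric' hx] at h1
  have e1 := Matrix.nonsing_inv_mul _ (hg.det x hx)
  have e2 := Matrix.mul_nonsing_inv _ (hg.det x hx)
  calc pdMat i (fun y => (g y)⁻¹) x
      = ((g x)⁻¹ * g x) * pdMat i (fun y => (g y)⁻¹) x := by rw [e1, one_mul]
    _ = (g x)⁻¹ * (g x * pdMat i (fun y => (g y)⁻¹) x) := by rw [mul_assoc]
    _ = (g x)⁻¹ * (-((conn g i x * g x + g x * (conn g i x).transpose) * (g x)⁻¹)) := by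
        rw [eq_neg_of_add_eq_zero_right h1]
    _ = -((g x)⁻¹ * conn g i x * (g x * (g x)⁻¹)
          + ((g x)⁻¹ * g x) * (conn g i x).transpose * (g x)⁻¹) := by noncomm_ring
    _ = _ := by rw [e1, e2]; noncomm_ring

/-- Differentiate metric compatibility a second time and antisymmetrise in the two directions:
second derivatives of `g` commute, and what remains is the symmetric part of the lowered curvature.
-/
theorem curvMat_mul (hx : x ∈ D) (c d : Fin n) :
    curvMat g c d x * g x + (curvMat g c d x * g x).transpose = 0 := by
  have hpd : ∀ c d : Fin n, pdMat c (pdMat d g) x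
      = pdMat c (conn g d) x * g x
        + conn g d x * (conn g c x * g x + g x * (conn g c x).transpose)
        + ((conn g c x * g x + g x * (conn g c x).transpose) * (conn g d x).transpose
          + g x * (pdMat c (conn g d) x).transpose) := by
    intro c d
    have hT : SmoothEntries (fun y => (conn g d y).transpose) D := fun i j => hg.smooth_conn d j i
    rw [pdMat_congr hg.isOpen hx c fun y hy => hg.pdMat_metric' hy d,
      pdMat_add ((hg.smooth_conn d).mul hg.smooth) (hg.smooth.mul hT) hg.isOpen hx,
      pdMat_mul (hg.smooth_conn d) hg.smooth hg.isOpen hx, pdMat_mul hg.smooth hT hg.isOpen hx,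
      hg.pdMat_metric' hx, pdMat_transpose]
  have h := pdMat_comm hg.smooth hg.isOpen hx c d
  rw [hpd, hpd] at h
  rw [Matrix.transpose_mul, hg.transpose hx, curvMat_eq]
  simp only [Matrix.transpose_add, Matrix.transpose_sub, Matrix.transpose_mul]
  rw [← sub_eq_zero] at h
  rw [← h]
  noncomm_ring

theorem riemann_eq (hx : x ∈ D) (a b c d : Fin n) :
    riemann g a b c d x = (curvMat g c d x * g x) b a := by
  simp only [riemann, Matrix.mul_apply, curvMat, Matrix.of_apply]
  exact Finset.sum_congr rfl fun e _ => by rw [hg.symm x hx]; ring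

theorem riemann_antisymm_left (hx : x ∈ D) (a b c d : Fin n) :
    riemann g a b c d x = -riemann g b a c d x := by
  have := congrFun (congrFun (hg.curvMat_mul hx c d) b) a
  rw [Matrix.add_apply, Matrix.transpose_apply, ← hg.riemann_eq hx, ← hg.riemann_eq hx] at this
  simp only [Matrix.zero_apply] at this
  linarith

omit hg in
theorem _root_.StaticVacuum.curvature_antisymm (a b c d : Fin n) :
    curvature g a b c d x = -curvature g a b d c x := by
  simp only [curvature, Finset.sum_sub_distrib]; ring

omit hg in
theorem _root_.StaticVacuum.riemann_antisymm_right (a b c d : Fin n) :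
    riemann g a b c d x = -riemann g a b d c x := by
  simp only [riemann]
  rw [← Finset.sum_neg_distrib]
  exact Finset.sum_congr rfl fun e _ => by rw [curvature_antisymm]; ring

theorem curvature_cyclic (hx : x ∈ D) (a b c d : Fin n) :
    curvature g a b c d x + curvature g a c d b x + curvature g a d b c x = 0 := by
  have hs : ∀ i j k e, pd e (christoffel g k i j) x = pd e (christoffel g k j i) x :=
    fun i j k e => pd_congr hg.isOpen hx e fun y hy => hg.christoffel_symm hy k i j
  simp only [curvature, Finset.sum_sub_distrib]
  rw [hs d b, hs c b, hs d c]
  simp only [hg.christoffel_symm hx _ d b, hg.christoffel_symm hx _ c b,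
    hg.christoffel_symm hx _ d c]
  ring

theorem riemann_cyclic (hx : x ∈ D) (a b c d : Fin n) :
    riemann g a b c d x + riemann g a c d b x + riemann g a d b c x = 0 := by
  simp only [riemann, ← Finset.sum_add_distrib, ← mul_add, hg.curvature_cyclic hx, mul_zero,
    Finset.sum_const_zero]

/-- The classical argument: add the cyclic identity over the four choices of first index and cancel
by the two antisymmetries. -/
theorem riemann_pair_symm (hx : x ∈ D) (a b c d : Fin n) :
    riemann g a b c d x = riemann g c d a b x := by
  have A := hg.riemann_antisymm_left hx
  have B := fun a b c d => riemann_antisymm_right (g := g) (x := x) a b c d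
  have C := hg.riemann_cyclic hx
  linarith [C a b c d, C b c d a, C c d a b, C d a b c, A a b c d, A c d a b, A a c d b, A b d a c,
    A a d b c, A b c d a, A c a b d, A d b c a, B a b c d, B b c d a, B b d a c, B b a c d,
    B c d a b, B c a b d, B c b d a, B d a b c, B d b c a, B d c a b, B a c d b, B a d b c,
    A d a b c, A c b d a, A d c a b, A b a c d, B d c b a, B c a d b, B d b a c, B c d b a]

theorem curvature_eq (hx : x ∈ D) (a b c d : Fin n) :
    curvature g a b c d x = ∑ e, (g x)⁻¹ a e * riemann g e b c d x := by
  have h := fun e => hg.riemann_eq hx e b c d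
  simp only [h]
  have : ((curvMat g c d x * g x) * (g x)⁻¹) b a = curvature g a b c d x := by
    rw [mul_assoc, Matrix.mul_nonsing_inv _ (hg.det x hx), mul_one]; rfl
  rw [← this, Matrix.mul_apply]
  exact Finset.sum_congr rfl fun e _ => by rw [hg.inv_symm hx e a]; ring

theorem ricci_eq (hx : x ∈ D) (b d : Fin n) :
    ricci g x b d = ∑ a, ∑ e, (g x)⁻¹ a e * riemann g e b a d x := by
  simp only [ricci, Matrix.of_apply, hg.curvature_eq hx]

theorem ricci_symm (hx : x ∈ D) (b d : Fin n) : ricci g x b d = ricci g x d b := by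
  rw [hg.ricci_eq hx, hg.ricci_eq hx, Finset.sum_comm]
  refine Finset.sum_congr rfl fun a _ => Finset.sum_congr rfl fun e _ => ?_
  rw [hg.riemann_pair_symm hx, hg.inv_symm hx]

/-- The derivative of the inner product of two covector fields. -/
theorem pd_inner (hx : x ∈ D) (i : Fin n) {α β : Fin n → (Fin n → ℝ) → ℝ}
    (hα : ∀ j, DifferentiableAt ℝ (α j) x) (hβ : ∀ j, DifferentiableAt ℝ (β j) x) :
    pd i (fun y => ∑ j, ∑ k, (g y)⁻¹ j k * α j y * β k y) x
      = ∑ j, ∑ k, (g x)⁻¹ j k * ((pd i (α j) x - ∑ l, christoffel g l i j x * α l x) * β k x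
        + α j x * (pd i (β k) x - ∑ l, christoffel g l i k x * β l x)) := by
  have hG := fun j k => (hg.smooth_inv j k).diffAt hg.isOpen hx
  rw [pd_sum _ _ fun j _ => DifferentiableAt.fun_sum fun k _ =>
    ((hG j k).fun_mul (hα j)).fun_mul (hβ k)]
  have h1 : ∀ j k, pd i (fun y => (g y)⁻¹ j k * α j y * β k y) x
      = (g x)⁻¹ j k * (pd i (α j) x * β k x + α j x * pd i (β k) x)
        - (∑ l, (g x)⁻¹ j l * christoffel g k i l x * α j x * β k x
          + ∑ l, (g x)⁻¹ l k * christoffel g j i l x * α j x * β k x) := by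
    intro j k
    rw [pd_mul i ((hG j k).fun_mul (hα j)) (hβ k), pd_mul i (hG j k) (hα j)]
    have := congrFun (congrFun (hg.pdMat_inv hx i) j) k
    simp only [pdMat, Matrix.of_apply, Matrix.neg_apply, Matrix.add_apply, Matrix.mul_apply,
      conn, Matrix.transpose_apply] at this
    have e2 : ∑ l, (g x)⁻¹ l k * christoffel g j i l x
      = ∑ l, christoffel g j i l x * (g x)⁻¹ l k := Finset.sum_congr rfl fun _ _ => mul_comm _ _
    rw [this]
    simp only [← Finset.sum_mul, e2]
    ring
  have h2 : ∀ j, pd i (fun y => ∑ k, (g y)⁻¹ j k * α j y * β k y) x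
      = ∑ k, pd i (fun y => (g y)⁻¹ j k * α j y * β k y) x := fun j =>
    pd_sum _ _ fun k _ => ((hG j k).fun_mul (hα j)).fun_mul (hβ k)
  simp only [h2, h1, Finset.sum_sub_distrib, Finset.sum_add_distrib, mul_add, mul_sub, sub_mul,
    Finset.mul_sum, Finset.sum_mul]
  have e1 : ∑ j, ∑ k, ∑ l, (g x)⁻¹ j l * christoffel g k i l x * α j x * β k x
      = ∑ j, ∑ k, ∑ l, (g x)⁻¹ j k * (α j x * (christoffel g l i k x * β l x)) := by
    refine Finset.sum_congr rfl fun j _ => ?_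
    rw [Finset.sum_comm]
    exact Finset.sum_congr rfl fun k _ => Finset.sum_congr rfl fun l _ => by ring
  have e2 : ∑ j, ∑ k, ∑ l, (g x)⁻¹ l k * christoffel g j i l x * α j x * β k x
      = ∑ j, ∑ k, ∑ l, (g x)⁻¹ j k * (christoffel g l i j x * α l x * β k x) := by
    calc _ = ∑ j, ∑ l, ∑ k, (g x)⁻¹ l k * christoffel g j i l x * α j x * β k x :=
          Finset.sum_congr rfl fun j _ => Finset.sum_comm
      _ = ∑ l, ∑ j, ∑ k, (g x)⁻¹ l k * christoffel g j i l x * α j x * β k x := Finset.sum_comm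
      _ = _ := by
        refine Finset.sum_congr rfl fun l _ => ?_
        rw [Finset.sum_comm]
        exact Finset.sum_congr rfl fun k _ => Finset.sum_congr rfl fun j _ => by ring
  rw [e1, e2]
  ring

end IsMetricOn

/-- The covariant derivative `∇ᵢ αⱼ` of a covector field. -/
noncomputable def covDeriv (g : TensorField n) (α : Fin n → (Fin n → ℝ) → ℝ) (i j : Fin n)
    (x : Fin n → ℝ) : ℝ :=
  pd i (α j) x - ∑ k, christoffel g k i j x * α k x

/-- The exterior covariant derivative `∇ᵢ hⱼₖ - ∇ⱼ hᵢₖ` of a covariant 2-tensor field, for a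
torsion-free connection. -/
noncomputable def extCovDeriv (g h : TensorField n) (i j k : Fin n) (x : Fin n → ℝ) : ℝ :=
  pd i (fun y => h y j k) x - pd j (fun y => h y i k) x
    - ∑ l, (christoffel g l i k x * h x j l - christoffel g l j k x * h x i l)

/-- The tensor `∇du + du ⊗ du`. -/
noncomputable def riccatiTensor (g : TensorField n) (u : (Fin n → ℝ) → ℝ) : TensorField n :=
  fun x => Matrix.of fun i j => hessian g u x i j + pd i u x * pd j u x

namespace IsMetricOn

variable (hg : IsMetricOn g D)
include hg

theorem hessian_symm (hx : x ∈ D) {u : (Fin n → ℝ) → ℝ} (hu : ContDiffOn ℝ ∞ u D) (i j : Fin n) :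
    hessian g u x i j = hessian g u x j i := by
  simp only [hessian, Matrix.of_apply]
  rw [pd_comm hu hg.isOpen hx]
  simp only [hg.christoffel_symm hx _ i j]

theorem smooth_hessian {u : (Fin n → ℝ) → ℝ} (hu : ContDiffOn ℝ ∞ u D) :
    SmoothEntries (hessian g u) D := fun i j =>
  ((hu.pd hg.isOpen j).pd hg.isOpen i).sub
    (ContDiffOn.sum fun k _ => (hg.smooth_christoffel k i j).mul (hu.pd hg.isOpen k))

/-- The Ricci identity for the covector `du`: third partial derivatives cancel by symmetry, and the
derivatives and products of Christoffel symbols assemble into the curvature. -/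
theorem extCovDeriv_hessian (hx : x ∈ D) {u : (Fin n → ℝ) → ℝ} (hu : ContDiffOn ℝ ∞ u D)
    (i j k : Fin n) :
    extCovDeriv g (hessian g u) i j k x = -∑ l, curvature g l k i j x * pd l u x := by
  have hΓ := fun k i j => (hg.smooth_christoffel k i j).diffAt hg.isOpen hx
  have hd := fun j => (hu.pd hg.isOpen j).diffAt hg.isOpen hx
  have hdd := fun i j => ((hu.pd hg.isOpen j).pd hg.isOpen i).diffAt hg.isOpen hx
  have h1 : ∀ i j k, pd i (fun y => hessian g u y j k) x = pd i (pd j (pd k u)) x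
      - ∑ l, (pd i (christoffel g l j k) x * pd l u x
        + christoffel g l j k x * pd i (pd l u) x) := by
    intro i j k
    simp only [hessian, Matrix.of_apply]
    rw [pd_sub i (hdd j k) (DifferentiableAt.fun_sum fun l _ => (hΓ l j k).fun_mul (hd l)),
      pd_sum _ _ fun l _ => (hΓ l j k).fun_mul (hd l)]
    congr 1
    exact Finset.sum_congr rfl fun l _ => pd_mul i (hΓ l j k) (hd l)
  simp only [extCovDeriv]
  rw [h1, h1, pd_comm (hu.pd hg.isOpen k) hg.isOpen hx i j]
  simp only [curvature, hessian, Matrix.of_apply, Finset.sum_add_distrib, Finset.sum_sub_distrib,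
    mul_sub, add_mul, sub_mul, Finset.mul_sum, Finset.sum_mul]
  have e : ∀ i j, ∑ l, ∑ m, christoffel g l i k x * (christoffel g m j l x * pd m u x)
      = ∑ m, ∑ l, christoffel g m j l x * christoffel g l i k x * pd m u x := by
    intro i j
    rw [Finset.sum_comm]
    exact Finset.sum_congr rfl fun l _ => Finset.sum_congr rfl fun m _ => by ring
  rw [e, e]
  ring

/-- The Ricci identity for `∇du + du ⊗ du`. -/
theorem extCovDeriv_riccatiTensor (hx : x ∈ D) {u : (Fin n → ℝ) → ℝ} (hu : ContDiffOn ℝ ∞ u D)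
    (i j k : Fin n) :
    extCovDeriv g (riccatiTensor g u) i j k x + pd i u x * riccatiTensor g u x j k
      - pd j u x * riccatiTensor g u x i k = -∑ l, curvature g l k i j x * pd l u x := by
  rw [← hg.extCovDeriv_hessian hx hu]
  have hd := fun j => (hu.pd hg.isOpen j).diffAt hg.isOpen hx
  have hH := fun i j => (hg.smooth_hessian hu i j).diffAt hg.isOpen hx
  have h1 : ∀ i j k, pd i (fun y => riccatiTensor g u y j k) x = pd i (fun y => hessian g u y j k) x
      + (pd i (pd j u) x * pd k u x + pd j u x * pd i (pd k u) x) := by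
    intro i j k
    simp only [riccatiTensor, Matrix.of_apply]
    rw [pd_add i (hH j k) ((hd j).fun_mul (hd k)), pd_mul i (hd j) (hd k)]
  -- The term `du ⊗ du` contributes `∂ⱼu (∇du)ᵢₖ - ∂ᵢu (∇du)ⱼₖ`, which the two zeroth-order terms of
  -- the statement cancel.
  have h2 : ∀ i k, pd i (pd k u) x = hessian g u x i k + ∑ l, christoffel g l i k x * pd l u x :=
    fun i k => by simp [hessian]
  simp only [extCovDeriv]
  rw [h1, h1, pd_comm hu hg.isOpen hx j i, h2 i k, h2 j k]
  simp only [riccatiTensor, Matrix.of_apply, Finset.sum_add_distrib, Finset.sum_sub_distrib,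
    mul_add, Finset.mul_sum]
  have e : ∀ i j, ∑ l, christoffel g l i k x * (pd j u x * pd l u x)
      = ∑ l, pd j u x * (christoffel g l i k x * pd l u x) := fun i j =>
    Finset.sum_congr rfl fun l _ => by ring
  rw [e, e]
  ring

end IsMetricOn

end LeviCivita

/-! The curvature tensor of a three-dimensional metric is determined by its Ricci tensor. -/

theorem fin_three_eq_or (a b : Fin 3) : b = a ∨ (a = b + 1 + 1 ∧ b = a + 1) ∨
    (a = b + 1 ∧ b = a + 1 + 1) := by
  revert a b; decide

/-- Indices are taken modulo 3: an antisymmetric array in dimension three is determined by the entry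
complementary to each `i`. -/
theorem antisymm_ext_three {D : Fin 3 → Fin 3 → ℝ} (h : ∀ a b, D a b = -D b a)
    (h0 : ∀ i, D (i + 1) (i + 2) = 0) (a b : Fin 3) : D a b = 0 := by
  have key : ∀ i, D i (i + 1) = 0 := fun i => by
    have := h0 (i + 2)
    rwa [show i + 2 + 1 = i by clear this; decide +revert,
      show i + 2 + 2 = i + 1 by clear this; decide +revert] at this
  rcases fin_three_eq_or a b with rfl | ⟨-, rfl⟩ | ⟨rfl, -⟩
  · linarith [h b b]
  · exact key a
  · rw [h, key b, neg_zero]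

/-- In dimension three a curvature tensor is a symmetric form on the three-dimensional space of
bivectors, so it has six components, as many as its Ricci tensor. The cyclic identity is then
automatic and is not assumed. The scalar curvature term is absent because the trace is zero. -/
theorem curvature_tensor_eq_of_three {K : Fin 3 → Fin 3 → Fin 3 → Fin 3 → ℝ}
    {γ G R : Matrix (Fin 3) (Fin 3) ℝ} (hG : ∀ i j, G i j = G j i) (hγG : γ * G = 1)
    (h1 : ∀ a b c d, K a b c d = -K b a c d) (h2 : ∀ a b c d, K a b c d = -K a b d c)
    (h3 : ∀ a b c d, K a b c d = K c d a b) (hR : ∀ b d, R b d = ∑ a, ∑ e, G a e * K e b a d)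
    (hS : (G * R).trace = 0) (a b c d : Fin 3) :
    K a b c d = γ a c * R b d - γ a d * R b c + γ b d * R a c - γ b c * R a d := by
  have hd : G.det ≠ 0 := (Matrix.isUnit_det_of_left_inverse hγG).ne_zero
  have hγ : γ = G⁻¹ := (Matrix.inv_eq_left_inv hγG).symm
  have hγe : ∀ i j, γ i j = G.det⁻¹ * G.adjugate i j := fun i j => by
    rw [hγ, Matrix.inv_def, Ring.inverse_eq_inv', Matrix.smul_apply, smul_eq_mul]
  have z1 : ∀ i c d, K i i c d = 0 := fun i c d => by linarith [h1 i i c d]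
  have z2 : ∀ i c d, K c d i i = 0 := fun i c d => by linarith [h2 c d i i]
  have p1 := h1 1 0
  have p2 := h1 2 0
  have p3 := h1 2 1
  have q1 := fun a b => h2 a b 1 0
  have q2 := fun a b => h2 a b 2 0
  have q3 := fun a b => h2 a b 2 1
  have r1 := h3 0 2 0 1
  have r2 := h3 1 2 0 1
  have r3 := h3 1 2 0 2
  have g1 := hG 1 0
  have g2 := hG 2 0
  have g3 := hG 2 1
  simp only [Matrix.trace, Matrix.diag, Matrix.mul_apply, Fin.sum_univ_three, hR, z1, z2, p1, p2,
    p3, q1, q2, q3, r1, r2, r3, g1, g2, g3] at hS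
  set E : Fin 3 → Fin 3 → Fin 3 → Fin 3 → ℝ := fun a b c d => K a b c d -
    (γ a c * R b d - γ a d * R b c + γ b d * R a c - γ b c * R a d) with hE
  have main : ∀ i j : Fin 3, E (i + 1) (i + 2) (j + 1) (j + 2) = 0 := by
    intro i j
    have hdet := Matrix.det_fin_three G
    rw [g1, g2, g3] at hdet
    fin_cases i <;> fin_cases j <;>
    simp [hE, hγe, Matrix.adjugate_fin_three, hR, Fin.sum_univ_three, z1, z2, p1, p2, p3, q1, q2,
      q3, r1, r2, r3, g1, g2, g3] <;> field_simp <;> rw [hdet]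
    -- With `γ` expressed by the adjugate of `G`, each component of the difference is the scalar
    -- curvature times a multiple of an entry of `G`.
    · linear_combination (-G 0 0 / 2) * hS
    · linear_combination (-G 0 1 / 2) * hS
    · linear_combination (-G 0 2 / 2) * hS
    · linear_combination (-G 0 1 / 2) * hS
    · linear_combination (-G 1 1 / 2) * hS
    · linear_combination (-G 1 2 / 2) * hS
    · linear_combination (-G 0 2 / 2) * hS
    · linear_combination (-G 1 2 / 2) * hS
    · linear_combination (-G 2 2 / 2) * hS
  have hE0 : ∀ a b c d, E a b c d = 0 := by
    intro a b c d
    refine antisymm_ext_three (D := fun a b => E a b c d) (fun a b => ?_) (fun i => ?_) a b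
    · simp only [hE]; rw [h1]; ring
    · refine antisymm_ext_three (D := fun c d => E (i + 1) (i + 2) c d) (fun c d => ?_)
        (fun j => main i j) c d
      simp only [hE]; rw [h2]; ring
  have := hE0 a b c d
  simp only [hE] at this
  linarith

namespace IsMetricOn

variable {γ : TensorField 3} {D : Set (Fin 3 → ℝ)} {x : Fin 3 → ℝ} (hγ : IsMetricOn γ D)
include hγ

theorem riemann_eq_of_three (hx : x ∈ D) (htr : metricTrace γ (ricci γ) x = 0)
    (a b c d : Fin 3) : riemann γ a b c d x
      = γ x a c * ricci γ x b d - γ x a d * ricci γ x b c + γ x b d * ricci γ x a c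
        - γ x b c * ricci γ x a d :=
  curvature_tensor_eq_of_three (K := fun a b c d => riemann γ a b c d x) (hγ.inv_symm hx)
    (Matrix.mul_nonsing_inv _ (hγ.det x hx)) (hγ.riemann_antisymm_left hx)
    (fun a b c d => riemann_antisymm_right a b c d) (hγ.riemann_pair_symm hx)
    (hγ.ricci_eq hx) htr a b c d

/-- The Ricci identity for `∇du + du ⊗ du` on a three-dimensional metric without scalar
curvature. -/
theorem extCovDeriv_riccatiTensor_of_three (hx : x ∈ D) (htr : metricTrace γ (ricci γ) x = 0)
    {u : (Fin 3 → ℝ) → ℝ} (hu : ContDiffOn ℝ ∞ u D) {v : Fin 3 → ℝ}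
    (hv : ∀ a, v a = ∑ l, (γ x)⁻¹ a l * pd l u x) (i j k : Fin 3) :
    extCovDeriv γ (riccatiTensor γ u) i j k x + pd i u x * riccatiTensor γ u x j k
      - pd j u x * riccatiTensor γ u x i k
      + (pd i u x * ricci γ x j k - pd j u x * ricci γ x i k
        + γ x j k * ∑ a, ricci γ x i a * v a - γ x i k * ∑ a, ricci γ x j a * v a) = 0 := by
  rw [hγ.extCovDeriv_riccatiTensor hx hu]
  have e1 : ∑ l, curvature γ l k i j x * pd l u x = ∑ a, riemann γ a k i j x * v a := by
    simp only [hγ.curvature_eq hx, hv, Finset.sum_mul, Finset.mul_sum]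
    rw [Finset.sum_comm]
    exact Finset.sum_congr rfl fun e _ => Finset.sum_congr rfl fun l _ => by
      rw [hγ.inv_symm hx l e]; ring
  have e2 : ∀ i, ∑ a, γ x a i * v a = pd i u x := by
    intro i
    have := Matrix.mul_nonsing_inv _ (hγ.det x hx)
    calc ∑ a, γ x a i * v a = (γ x).mulVec ((γ x)⁻¹.mulVec fun l => pd l u x) i := by
          simp only [Matrix.mulVec, dotProduct, hv]
          exact Finset.sum_congr rfl fun a _ => by rw [hγ.symm x hx a i]
      _ = _ := by rw [Matrix.mulVec_mulVec, this, Matrix.one_mulVec]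
  rw [e1]
  simp only [hγ.riemann_eq_of_three hx htr, Finset.sum_sub_distrib, Finset.sum_add_distrib,
    sub_mul, add_mul]
  have e3 : ∀ i j, ∑ a, γ x a i * ricci γ x k j * v a = pd i u x * ricci γ x j k := by
    intro i j
    rw [← e2, Finset.sum_mul, hγ.ricci_symm hx k j]
    exact Finset.sum_congr rfl fun a _ => by ring
  have e4 : ∀ i j, ∑ a, γ x k i * ricci γ x a j * v a
      = γ x i k * ∑ a, ricci γ x j a * v a := by
    intro i j
    rw [Finset.mul_sum, hγ.symm x hx k i]
    exact Finset.sum_congr rfl fun a _ => by rw [hγ.ricci_symm hx a j]; ring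
  rw [e3, e3, e4, e4]
  ring

end IsMetricOn

/-! The curvature of a static metric. -/

section Static

variable {n : ℕ}

theorem contDiff_tail : ContDiff ℝ ∞ (fun y : Fin (n + 1) → ℝ => (Fin.tail y : Fin n → ℝ)) :=
  contDiff_pi.2 fun i => contDiff_apply ℝ ℝ i.succ

theorem fderiv_tail (f : (Fin n → ℝ) → ℝ) {y : Fin (n + 1) → ℝ}
    (hf : DifferentiableAt ℝ f (Fin.tail y)) (v : Fin (n + 1) → ℝ) :
    fderiv ℝ (fun z : Fin (n + 1) → ℝ => f (Fin.tail z)) y v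
      = fderiv ℝ f (Fin.tail y) (Fin.tail v) := by
  have h : HasFDerivAt (fun z : Fin (n + 1) → ℝ => (Fin.tail z : Fin n → ℝ))
      (ContinuousLinearMap.pi fun i : Fin n => ContinuousLinearMap.proj (R := ℝ)
        (φ := fun _ : Fin (n + 1) => ℝ) i.succ) y :=
    (ContinuousLinearMap.pi fun i : Fin n => ContinuousLinearMap.proj (R := ℝ)
        (φ := fun _ : Fin (n + 1) => ℝ) i.succ).hasFDerivAt
  have := (hf.hasFDerivAt.comp y h).fderiv
  simp only [Function.comp_def] at this
  rw [this]
  rfl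

theorem pd_tail_zero {f : (Fin n → ℝ) → ℝ} {y : Fin (n + 1) → ℝ}
    (hf : DifferentiableAt ℝ f (Fin.tail y)) :
    pd 0 (fun z : Fin (n + 1) → ℝ => f (Fin.tail z)) y = 0 := by
  rw [pd, fderiv_tail f hf]
  have : Fin.tail (Pi.single 0 1 : Fin (n + 1) → ℝ) = (0 : Fin n → ℝ) := by
    ext i; simp [Fin.tail]
  rw [this, map_zero]

theorem pd_tail_succ {f : (Fin n → ℝ) → ℝ} {y : Fin (n + 1) → ℝ}
    (hf : DifferentiableAt ℝ f (Fin.tail y)) (i : Fin n) :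
    pd i.succ (fun z : Fin (n + 1) → ℝ => f (Fin.tail z)) y = pd i f (Fin.tail y) := by
  rw [pd, fderiv_tail f hf, pd]
  congr 1
  ext j
  simp [Fin.tail, Pi.single_apply]

variable {γ : TensorField 3} {U : (Fin 3 → ℝ) → ℝ} {y : Fin 4 → ℝ} {N : Set (Fin 3 → ℝ)}

/-- The inverse of the static metric. -/
noncomputable def staticInv (γ : TensorField 3) (U : (Fin 3 → ℝ) → ℝ) (x : Fin 3 → ℝ) :
    Matrix (Fin 4) (Fin 4) ℝ :=
  Matrix.of <| Fin.cons (Fin.cons (-Real.exp (-(2 * U x))) fun _ => 0)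
    fun i => Fin.cons 0 fun j => (γ x)⁻¹ i j

@[simp] theorem staticMetric_zero_zero :
    staticMetric γ U y 0 0 = -Real.exp (2 * U (Fin.tail y)) := rfl
@[simp] theorem staticMetric_zero_succ (j : Fin 3) : staticMetric γ U y 0 j.succ = 0 := rfl
@[simp] theorem staticMetric_succ_zero (j : Fin 3) : staticMetric γ U y j.succ 0 = 0 := rfl
@[simp] theorem staticMetric_succ_succ (i j : Fin 3) :
    staticMetric γ U y i.succ j.succ = γ (Fin.tail y) i j := rfl
@[simp] theorem staticInv_zero_zero (x : Fin 3 → ℝ) :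
    staticInv γ U x 0 0 = -Real.exp (-(2 * U x)) := rfl
@[simp] theorem staticInv_zero_succ (x : Fin 3 → ℝ) (j : Fin 3) :
    staticInv γ U x 0 j.succ = 0 := rfl
@[simp] theorem staticInv_succ_zero (x : Fin 3 → ℝ) (j : Fin 3) :
    staticInv γ U x j.succ 0 = 0 := rfl
@[simp] theorem staticInv_succ_succ (x : Fin 3 → ℝ) (i j : Fin 3) :
    staticInv γ U x i.succ j.succ = (γ x)⁻¹ i j := rfl

theorem isOpen_cylinder (hN : IsOpen N) : IsOpen (cylinder N) :=
  hN.preimage contDiff_tail.continuous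

theorem staticMetric_mul_staticInv (hd : IsUnit (γ (Fin.tail y)).det) :
    staticMetric γ U y * staticInv γ U (Fin.tail y) = 1 := by
  have h1 := Matrix.mul_nonsing_inv _ hd
  ext a b
  refine Fin.cases ?_ (fun i => ?_) a <;> refine Fin.cases ?_ (fun j => ?_) b <;>
    simp only [Matrix.mul_apply, Fin.sum_univ_succ (n := 3), staticMetric_zero_zero,
      staticMetric_zero_succ, staticMetric_succ_zero, staticMetric_succ_succ, staticInv_zero_zero,
      staticInv_zero_succ, staticInv_succ_zero, staticInv_succ_succ, zero_mul, mul_zero,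
      Finset.sum_const_zero, add_zero, zero_add, neg_mul_neg]
  · rw [← Real.exp_add]; simp
  · rfl
  · rfl
  · have := congrFun (congrFun h1 i) j
    rw [Matrix.mul_apply] at this
    rw [this, Matrix.one_apply, Matrix.one_apply]
    simp [Fin.succ_inj]

theorem staticMetric_inv (hd : IsUnit (γ (Fin.tail y)).det) :
    (staticMetric γ U y)⁻¹ = staticInv γ U (Fin.tail y) :=
  Matrix.inv_eq_right_inv (staticMetric_mul_staticInv hd)

theorem contDiffOn_tail {f : (Fin 3 → ℝ) → ℝ} (hf : ContDiffOn ℝ ∞ f N) :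
    ContDiffOn ℝ ∞ (fun y : Fin 4 → ℝ => f (Fin.tail y)) (cylinder N) :=
  hf.comp contDiff_tail.contDiffOn fun _ hy => hy

theorem IsMetricOn.static (hγ : IsMetricOn γ N) (hU : ContDiffOn ℝ ∞ U N) :
    IsMetricOn (staticMetric γ U) (cylinder N) where
  isOpen := isOpen_cylinder hγ.isOpen
  smooth a b := by
    refine Fin.cases ?_ (fun i => ?_) a <;> refine Fin.cases ?_ (fun j => ?_) b
    · exact (Real.contDiff_exp.comp_contDiffOn
        (contDiffOn_const.mul (contDiffOn_tail hU) : ContDiffOn ℝ ∞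
          (fun y : Fin 4 → ℝ => 2 * U (Fin.tail y)) (cylinder N))).neg
    · exact contDiffOn_const
    · exact contDiffOn_const
    · exact contDiffOn_tail (hγ.smooth i j)
  symm y hy a b := by
    refine Fin.cases ?_ (fun i => ?_) a <;> refine Fin.cases ?_ (fun j => ?_) b
    · rfl
    · rfl
    · rfl
    · exact hγ.symm _ hy i j
  det y hy := Matrix.isUnit_det_of_right_inverse (staticMetric_mul_staticInv (hγ.det _ hy))

section Christoffel

variable (hγ : IsMetricOn γ N) (hU : ContDiffOn ℝ ∞ U N) (hy : y ∈ cylinder N)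
include hγ hU hy

theorem pd_staticMetric_zero (a b : Fin 4) : pd 0 (fun z => staticMetric γ U z a b) y = 0 := by
  have hU' := hU.diffAt hγ.isOpen hy
  refine Fin.cases ?_ (fun i => ?_) a <;> refine Fin.cases ?_ (fun j => ?_) b
  · exact pd_tail_zero (f := fun x => -Real.exp (2 * U x)) (by fun_prop)
  · exact pd_const 0 0
  · exact pd_const 0 0
  · exact pd_tail_zero (f := fun x => γ x i j) ((hγ.smooth i j).diffAt hγ.isOpen hy)

theorem pd_staticMetric_zero_zero (i : Fin 3) : pd i.succ (fun z => staticMetric γ U z 0 0) y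
    = -2 * Real.exp (2 * U (Fin.tail y)) * pd i U (Fin.tail y) := by
  have hU' := hU.diffAt hγ.isOpen hy
  have h : HasDerivAt (fun t : ℝ => -Real.exp (2 * t))
      (-2 * Real.exp (2 * U (Fin.tail y))) (U (Fin.tail y)) := by
    have := (((hasDerivAt_id (U (Fin.tail y))).const_mul 2).exp).neg
    convert! this using 1
    simp only [id, mul_one]; ring
  rw [← pd_comp i h hU']
  exact pd_tail_succ (f := fun x => -Real.exp (2 * U x)) (by fun_prop) i

omit hU in
theorem pd_staticMetric_succ_succ (i j k : Fin 3) :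
    pd i.succ (fun z => staticMetric γ U z j.succ k.succ) y
      = pd i (fun x => γ x j k) (Fin.tail y) :=
  pd_tail_succ (f := fun x => γ x j k) ((hγ.smooth j k).diffAt hγ.isOpen hy) i

omit hγ hU hy in
theorem pd_staticMetric_mixed (a : Fin 4) (j : Fin 3) :
    pd a (fun z => staticMetric γ U z 0 j.succ) y = 0 ∧
    pd a (fun z => staticMetric γ U z j.succ 0) y = 0 :=
  ⟨pd_const a 0, pd_const a 0⟩

theorem static_christoffel_zero_zero_zero : christoffel (staticMetric γ U) 0 0 0 y = 0 := by
  simp only [christoffel, pd_staticMetric_zero hγ hU hy, staticMetric_inv (hγ.det _ hy),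
    Fin.sum_univ_succ (n := 3), staticInv_zero_succ]
  simp

theorem static_christoffel_zero_zero_succ (i : Fin 3) :
    christoffel (staticMetric γ U) 0 0 i.succ y = pd i U (Fin.tail y) := by
  simp only [christoffel, pd_staticMetric_zero hγ hU hy, staticMetric_inv (hγ.det _ hy),
    Fin.sum_univ_succ (n := 3), staticInv_zero_succ, staticInv_zero_zero,
    pd_staticMetric_zero_zero hγ hU hy]
  have : Real.exp (-(2 * U (Fin.tail y))) * Real.exp (2 * U (Fin.tail y)) = 1 := by
    rw [← Real.exp_add]; simp
  simp only [zero_mul, Finset.sum_const_zero]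
  linear_combination pd i U (Fin.tail y) * this

theorem static_christoffel_zero_succ_zero (i : Fin 3) :
    christoffel (staticMetric γ U) 0 i.succ 0 y = pd i U (Fin.tail y) := by
  rw [(hγ.static hU).christoffel_symm hy, static_christoffel_zero_zero_succ hγ hU hy]

theorem static_christoffel_zero_succ_succ (i j : Fin 3) :
    christoffel (staticMetric γ U) 0 i.succ j.succ y = 0 := by
  simp only [christoffel, pd_staticMetric_zero hγ hU hy, staticMetric_inv (hγ.det _ hy),
    Fin.sum_univ_succ (n := 3), staticInv_zero_succ, (pd_staticMetric_mixed _ _).2]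
  simp

theorem static_christoffel_succ_zero_succ (i j : Fin 3) :
    christoffel (staticMetric γ U) i.succ 0 j.succ y = 0 := by
  simp only [christoffel, pd_staticMetric_zero hγ hU hy, staticMetric_inv (hγ.det _ hy),
    Fin.sum_univ_succ (n := 3), staticInv_succ_zero, (pd_staticMetric_mixed _ _).1]
  simp

theorem static_christoffel_succ_succ_zero (i j : Fin 3) :
    christoffel (staticMetric γ U) i.succ j.succ 0 y = 0 := by
  rw [(hγ.static hU).christoffel_symm hy, static_christoffel_succ_zero_succ hγ hU hy]

omit hU in
theorem static_christoffel_succ_succ_succ (k i j : Fin 3) :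
    christoffel (staticMetric γ U) k.succ i.succ j.succ y = christoffel γ k i j (Fin.tail y) := by
  simp only [christoffel, pd_staticMetric_succ_succ hγ hy, staticMetric_inv (hγ.det _ hy),
    Fin.sum_univ_succ (n := 3), staticInv_succ_zero, staticInv_succ_succ]
  simp

/-- Only `Γ⁰₀ᵢ = ∂ᵢU` and the spatial symbols enter; the product of two symbols of the first kind
produces `dU ⊗ dU`. The symbols `Γᵏ₀₀` are never needed, since the components that contain them
follow by the symmetries of the Riemann tensor. -/
theorem static_curvature_zero_succ_zero_succ (i j : Fin 3) :
    curvature (staticMetric γ U) 0 i.succ 0 j.succ y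
      = -riccatiTensor γ U (Fin.tail y) i j := by
  have ho := isOpen_cylinder hγ.isOpen
  have e1 : pd 0 (christoffel (staticMetric γ U) 0 j.succ i.succ) y = 0 := by
    rw [pd_congr (h := fun _ => 0) ho hy 0
      fun z hz => static_christoffel_zero_succ_succ hγ hU hz j i, pd_const]
  have e2 : pd j.succ (christoffel (staticMetric γ U) 0 0 i.succ) y
      = pd j (pd i U) (Fin.tail y) := by
    rw [pd_congr ho hy _ fun z hz => static_christoffel_zero_zero_succ hγ hU hz i]
    exact pd_tail_succ (f := pd i U) ((hU.pd hγ.isOpen i).diffAt hγ.isOpen hy) j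
  simp only [curvature, e1, e2, Fin.sum_univ_succ (n := 3),
    static_christoffel_zero_zero_zero hγ hU hy, static_christoffel_zero_zero_succ hγ hU hy,
    static_christoffel_zero_succ_zero hγ hU hy, static_christoffel_zero_succ_succ hγ hU hy,
    static_christoffel_succ_zero_succ hγ hU hy, static_christoffel_succ_succ_succ hγ hy,
    riccatiTensor, hessian, Matrix.of_apply]
  rw [pd_comm hU hγ.isOpen hy j i]
  simp only [hγ.christoffel_symm hy _ j i, mul_comm (pd _ U _) (christoffel _ _ _ _ _)]
  simp only [Finset.sum_sub_distrib, zero_mul, Finset.sum_const_zero]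
  ring

theorem static_curvature_zero_succ_succ_succ (i j k : Fin 3) :
    curvature (staticMetric γ U) 0 i.succ j.succ k.succ y = 0 := by
  have ho := isOpen_cylinder hγ.isOpen
  have e1 : ∀ i j k : Fin 3, pd k.succ (christoffel (staticMetric γ U) 0 j.succ i.succ) y = 0 := by
    intro i j k
    rw [pd_congr (h := fun _ => 0) ho hy _
      fun z hz => static_christoffel_zero_succ_succ hγ hU hz j i, pd_const]
  simp only [curvature, e1, Fin.sum_univ_succ (n := 3),
    static_christoffel_zero_succ_zero hγ hU hy, static_christoffel_zero_succ_succ hγ hU hy]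
  simp

theorem static_curvature_succ (i j k l : Fin 3) :
    curvature (staticMetric γ U) i.succ j.succ k.succ l.succ y
      = curvature γ i j k l (Fin.tail y) := by
  have ho := isOpen_cylinder hγ.isOpen
  have e1 : ∀ k i j l : Fin 3, pd l.succ (christoffel (staticMetric γ U) k.succ i.succ j.succ) y
      = pd l (christoffel γ k i j) (Fin.tail y) := by
    intro k i j l
    rw [pd_congr ho hy _ fun z hz => static_christoffel_succ_succ_succ hγ hz k i j]
    exact pd_tail_succ ((hγ.smooth_christoffel k i j).diffAt hγ.isOpen hy) l
  simp only [curvature, e1, Fin.sum_univ_succ (n := 3),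
    static_christoffel_succ_succ_zero hγ hU hy, static_christoffel_zero_succ_succ hγ hU hy,
    static_christoffel_succ_succ_succ hγ hy]
  simp

theorem static_riemann_zero_succ_zero_succ (i j : Fin 3) :
    riemann (staticMetric γ U) 0 i.succ 0 j.succ y
      = Real.exp (2 * U (Fin.tail y)) * riccatiTensor γ U (Fin.tail y) i j := by
  simp only [riemann, Fin.sum_univ_succ (n := 3), staticMetric_zero_zero, staticMetric_zero_succ,
    static_curvature_zero_succ_zero_succ hγ hU hy, zero_mul, Finset.sum_const_zero]
  ring

theorem static_riemann_zero_succ_succ_succ (i j k : Fin 3) :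
    riemann (staticMetric γ U) 0 i.succ j.succ k.succ y = 0 := by
  simp only [riemann, Fin.sum_univ_succ (n := 3), staticMetric_zero_succ,
    static_curvature_zero_succ_succ_succ hγ hU hy, zero_mul, mul_zero, Finset.sum_const_zero,
    add_zero]

theorem static_riemann_succ (i j k l : Fin 3) :
    riemann (staticMetric γ U) i.succ j.succ k.succ l.succ y
      = riemann γ i j k l (Fin.tail y) := by
  simp only [riemann, Fin.sum_univ_succ (n := 3), staticMetric_succ_zero, staticMetric_succ_succ,
    static_curvature_succ hγ hU hy, zero_mul, zero_add]

/-- The index symmetries reduce every component that involves `T` to the types `0i0j` and `0ijk`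
already computed. -/
theorem static_riemann_table :
    (∀ c d, riemann (staticMetric γ U) 0 0 c d y = 0) ∧
    (∀ c d, riemann (staticMetric γ U) c d 0 0 y = 0) ∧
    (∀ i j : Fin 3, riemann (staticMetric γ U) i.succ 0 0 j.succ y
      = -(Real.exp (2 * U (Fin.tail y)) * riccatiTensor γ U (Fin.tail y) i j)) ∧
    (∀ i j : Fin 3, riemann (staticMetric γ U) 0 i.succ j.succ 0 y
      = -(Real.exp (2 * U (Fin.tail y)) * riccatiTensor γ U (Fin.tail y) i j)) ∧
    (∀ i j : Fin 3, riemann (staticMetric γ U) i.succ 0 j.succ 0 y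
      = Real.exp (2 * U (Fin.tail y)) * riccatiTensor γ U (Fin.tail y) i j) ∧
    (∀ i j k : Fin 3, riemann (staticMetric γ U) i.succ 0 j.succ k.succ y = 0) ∧
    (∀ i j k : Fin 3, riemann (staticMetric γ U) i.succ j.succ 0 k.succ y = 0) ∧
    (∀ i j k : Fin 3, riemann (staticMetric γ U) i.succ j.succ k.succ 0 y = 0) := by
  have hg := hγ.static hU
  have A := hg.riemann_antisymm_left hy
  have B := fun a b c d => riemann_antisymm_right (g := staticMetric γ U) (x := y) a b c d
  have C := hg.riemann_pair_symm hy
  refine ⟨fun c d => by linarith [A 0 0 c d], fun c d => by linarith [B c d 0 0],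
    fun i j => ?_, fun i j => ?_, fun i j => ?_, fun i j k => ?_, fun i j k => ?_, fun i j k => ?_⟩
  · rw [A, static_riemann_zero_succ_zero_succ hγ hU hy]
  · rw [B, static_riemann_zero_succ_zero_succ hγ hU hy]
  · rw [A, B, static_riemann_zero_succ_zero_succ hγ hU hy, neg_neg]
  · rw [A, static_riemann_zero_succ_succ_succ hγ hU hy, neg_zero]
  · rw [C, static_riemann_zero_succ_succ_succ hγ hU hy]
  · rw [B, C, static_riemann_zero_succ_succ_succ hγ hU hy, neg_zero]

theorem static_ricci_zero_zero : ricci (staticMetric γ U) y 0 0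
    = Real.exp (2 * U (Fin.tail y)) * metricTrace γ (riccatiTensor γ U) (Fin.tail y) := by
  obtain ⟨t1, t2, t3, t4, t5, t6, t7, t8⟩ := static_riemann_table hγ hU hy
  rw [(hγ.static hU).ricci_eq hy]
  simp only [Fin.sum_univ_succ (n := 3), staticMetric_inv (hγ.det _ hy),
    staticInv_zero_succ, staticInv_succ_succ, t1, t5, zero_mul, mul_zero,
    zero_add, Finset.sum_const_zero, metricTrace, Matrix.trace, Matrix.diag, Matrix.mul_apply,
    Finset.mul_sum]
  refine Finset.sum_congr rfl fun i _ => Finset.sum_congr rfl fun j _ => ?_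
  ring

theorem static_ricci_zero_succ (j : Fin 3) : ricci (staticMetric γ U) y 0 j.succ = 0 := by
  obtain ⟨t1, t2, t3, t4, t5, t6, t7, t8⟩ := static_riemann_table hγ hU hy
  rw [(hγ.static hU).ricci_eq hy]
  simp only [Fin.sum_univ_succ (n := 3), staticMetric_inv (hγ.det _ hy),
    staticInv_zero_succ, staticInv_succ_succ, t1, t6, zero_mul, mul_zero,
    zero_add, Finset.sum_const_zero]

theorem static_ricci_succ_succ (i j : Fin 3) : ricci (staticMetric γ U) y i.succ j.succ
    = ricci γ (Fin.tail y) i j - riccatiTensor γ U (Fin.tail y) i j := by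
  rw [(hγ.static hU).ricci_eq hy, hγ.ricci_eq hy]
  simp only [Fin.sum_univ_succ (n := 3), staticMetric_inv (hγ.det _ hy), staticInv_zero_zero,
    staticInv_zero_succ, staticInv_succ_zero, staticInv_succ_succ, zero_mul,
    zero_add, add_zero, Finset.sum_const_zero, static_riemann_zero_succ_zero_succ hγ hU hy,
    static_riemann_succ hγ hU hy]
  have : Real.exp (-(2 * U (Fin.tail y))) * Real.exp (2 * U (Fin.tail y)) = 1 := by
    rw [← Real.exp_add]; simp
  linear_combination -riccatiTensor γ U (Fin.tail y) i j * this

/-- The spatial block gives the tensor equation; the time-time component is a multiple of the trace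
of its left side, so it becomes the vanishing of the scalar curvature. -/
theorem static_ricci_eq_zero_iff : ricci (staticMetric γ U) y = 0 ↔
    riccatiTensor γ U (Fin.tail y) = ricci γ (Fin.tail y) ∧
      metricTrace γ (ricci γ) (Fin.tail y) = 0 := by
  have hs := (hγ.static hU).ricci_symm hy
  constructor
  · intro h
    have e : riccatiTensor γ U (Fin.tail y) = ricci γ (Fin.tail y) := by
      ext i j
      have := static_ricci_succ_succ hγ hU hy i j
      rw [h, Matrix.zero_apply] at this
      linarith
    refine ⟨e, ?_⟩
    have := static_ricci_zero_zero hγ hU hy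
    rw [h, Matrix.zero_apply, metricTrace, e] at this
    exact (mul_eq_zero.1 this.symm).resolve_left (Real.exp_ne_zero _)
  · rintro ⟨h1, h2⟩
    ext a b
    refine Fin.cases ?_ (fun i => ?_) a <;> refine Fin.cases ?_ (fun j => ?_) b
    · rw [static_ricci_zero_zero hγ hU hy, metricTrace, h1]
      exact mul_eq_zero_of_right _ h2
    · exact static_ricci_zero_succ hγ hU hy j
    · rw [hs]; exact static_ricci_zero_succ hγ hU hy i
    · rw [static_ricci_succ_succ hγ hU hy, h1, sub_self]; rfl

/-- The Weyl tensor of a static vacuum metric. -/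
theorem static_weylEval (h : ricci (staticMetric γ U) y = 0) (p q v w : Fin 4 → ℝ) :
    weylEval (staticMetric γ U) y p q v w
      = Real.exp (2 * U (Fin.tail y)) * ∑ i, ∑ j, ricci γ (Fin.tail y) i j *
          (p 0 * q i.succ - q 0 * p i.succ) * (v 0 * w j.succ - w 0 * v j.succ)
        + ∑ i, ∑ j, ∑ k, ∑ l, riemann γ i j k l (Fin.tail y) *
          p i.succ * q j.succ * v k.succ * w l.succ := by
  have hw : ∀ a b c d, weyl (staticMetric γ U) a b c d y = riemann (staticMetric γ U) a b c d y := by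
    intro a b c d
    simp only [weyl, metricTrace, h]
    simp
  obtain ⟨t1, t2, t3, t4, t5, t6, t7, t8⟩ := static_riemann_table hγ hU hy
  have e := ((static_ricci_eq_zero_iff hγ hU hy).1 h).1
  simp only [weylEval, hw, Fin.sum_univ_succ (n := 3), t1, t2, t3, t4, t5, t6, t7, t8,
    static_riemann_zero_succ_zero_succ hγ hU hy, static_riemann_zero_succ_succ_succ hγ hU hy,
    static_riemann_succ hγ hU hy, e, zero_mul, Finset.sum_const_zero, zero_add, add_zero]
  simp only [Fin.sum_univ_three]
  ring

end Christoffel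

end Static

/-! Bivectors in an orthonormal frame, and the algebra of type D Weyl tensors. -/

section TypeD

/-- The electric part of the bivector `p ∧ q`. -/
def elec (p q : Fin 4 → ℝ) (i : Fin 3) : ℝ := p 0 * q i.succ - q 0 * p i.succ

/-- The magnetic part of the bivector `p ∧ q`. -/
def magn (p q : Fin 4 → ℝ) (i : Fin 3) : ℝ :=
  p (i + 1).succ * q (i + 2).succ - p (i + 2).succ * q (i + 1).succ

/-- The Weyl tensor in an orthonormal frame, for electric part `r` and no magnetic part. -/
def weylForm (r : Matrix (Fin 3) (Fin 3) ℝ) (p q v w : Fin 4 → ℝ) : ℝ :=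
  ∑ i, ∑ j, r i j * (elec p q i * elec v w j - magn p q i * magn v w j)

/-- The Minkowski metric. -/
noncomputable abbrev minkowski : Matrix (Fin 4) (Fin 4) ℝ := Matrix.diagonal ![-1, 1, 1, 1]

theorem elec_dot_sub_magn_dot (p q v w : Fin 4 → ℝ) :
    ∑ i, (elec p q i * elec v w i - magn p q i * magn v w i)
      = -((p ⬝ᵥ minkowski.mulVec v) * (q ⬝ᵥ minkowski.mulVec w)
        - (p ⬝ᵥ minkowski.mulVec w) * (q ⬝ᵥ minkowski.mulVec v)) := by
  simp [elec, magn, Fin.sum_univ_three, dotProduct, Fin.sum_univ_four, Matrix.mulVec_diagonal,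
    show (2 : Fin 3).succ = 3 from rfl]
  ring

theorem elec_dot_magn (p q v w : Fin 4 → ℝ) :
    ∑ i, (elec p q i * magn v w i + magn p q i * elec v w i)
      = (Matrix.of ![p, q, v, w]).det := by
  simp [elec, magn, Fin.sum_univ_three, Matrix.det_succ_row_zero, Fin.sum_univ_four,
    Fin.succAbove, show (2 : Fin 3).succ = 3 from rfl, show (2 : Fin 3).castSucc = 2 from rfl,
    Matrix.submatrix]
  ring

variable {L : Matrix (Fin 4) (Fin 4) ℝ} {r : Matrix (Fin 3) (Fin 3) ℝ}

theorem row_dot_row (hL : L * minkowski * L.transpose = minkowski) (a b : Fin 4) :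
    L a ⬝ᵥ minkowski.mulVec (L b) = minkowski a b := by
  conv_rhs => rw [← hL]
  rw [mul_assoc, Matrix.mul_apply]
  rfl

theorem det_mul_self_of_lorentz (hL : L * minkowski * L.transpose = minkowski) :
    L.det * L.det = 1 := by
  have h := congrArg Matrix.det hL
  have hm : minkowski.det = -1 := by
    rw [Matrix.det_diagonal, Fin.prod_univ_four]; simp
  rw [Matrix.det_mul, Matrix.det_mul, Matrix.det_transpose, hm] at h
  linarith

/-- The self-dual part of the bivector `p ∧ q`. -/
noncomputable def selfDual (p q : Fin 4 → ℝ) (i : Fin 3) : ℂ :=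
  (elec p q i : ℂ) + Complex.I * (magn p q i : ℂ)

/-- The bilinear dot product of `ℂ³` encodes both invariants of a pair of bivectors, their Minkowski
product and the volume of their wedge. Hence Lorentz frames become complex orthonormal triples. -/
theorem selfDual_dot (p q v w : Fin 4 → ℝ) :
    ∑ i, selfDual p q i * selfDual v w i
      = ((-((p ⬝ᵥ minkowski.mulVec v) * (q ⬝ᵥ minkowski.mulVec w)
        - (p ⬝ᵥ minkowski.mulVec w) * (q ⬝ᵥ minkowski.mulVec v)) : ℝ) : ℂ)
        + Complex.I * (((Matrix.of ![p, q, v, w]).det : ℝ) : ℂ) := by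
  rw [← elec_dot_sub_magn_dot, ← elec_dot_magn]
  push_cast
  rw [Finset.mul_sum, ← Finset.sum_add_distrib]
  refine Finset.sum_congr rfl fun i _ => ?_
  simp only [selfDual]
  linear_combination (magn p q i : ℂ) * magn v w i * Complex.I_mul_I

/-- The Weyl tensor is complex linear on self-dual bivectors, so `r` acts there as a complex
bilinear form with the same matrix. -/
theorem weylForm_eq_re (p q v w : Fin 4 → ℝ) :
    weylForm r p q v w = (∑ i, ∑ j, selfDual p q i * r i j * selfDual v w j).re := by
  simp only [weylForm, Complex.re_sum]
  refine Finset.sum_congr rfl fun i _ => Finset.sum_congr rfl fun j _ => ?_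
  simp [selfDual]
  ring

/-- The self-dual parts of `u₀ ∧ uⱼ`. -/
noncomputable def selfDualFrame (L : Matrix (Fin 4) (Fin 4) ℝ) : Matrix (Fin 3) (Fin 3) ℂ :=
  Matrix.of fun j => selfDual (L 0) (L j.succ)

theorem selfDualFrame_mul_transpose (hL : L * minkowski * L.transpose = minkowski) :
    selfDualFrame L * (selfDualFrame L).transpose = 1 := by
  ext j k
  have hd : (Matrix.of ![L 0, L j.succ, L 0, L k.succ]).det = 0 :=
    Matrix.det_zero_of_row_eq (i := 0) (j := 2) (by decide) rfl
  rw [Matrix.mul_apply]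
  change ∑ i, selfDual (L 0) (L j.succ) i * selfDual (L 0) (L k.succ) i = _
  rw [selfDual_dot, hd]
  simp only [row_dot_row hL]
  fin_cases j <;> fin_cases k <;> simp [minkowski, Matrix.diagonal]

/-- Hodge duality is multiplication by `i` on self-dual bivectors, and it exchanges `u₀ ∧ uⱼ` with
the opposite spatial bivector; the determinant records the orientation of the frame. The proof
compares the products of both sides with the complex orthonormal triple. -/
theorem selfDual_succ_succ (hL : L * minkowski * L.transpose = minkowski) (j i : Fin 3) :
    selfDual (L (j + 1).succ) (L (j + 2).succ) i
      = Complex.I * (L.det : ℂ) * selfDualFrame L j i := by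
  set Z := selfDualFrame L
  set Z' : Matrix (Fin 3) (Fin 3) ℂ :=
    Matrix.of fun j => selfDual (L (j + 1).succ) (L (j + 2).succ) with hZ'
  have h1 : Z' * Z.transpose = (Complex.I * (L.det : ℂ)) • (1 : Matrix (Fin 3) (Fin 3) ℂ) := by
    ext j k
    rw [Matrix.mul_apply]
    change ∑ i, selfDual (L (j + 1).succ) (L (j + 2).succ) i * selfDual (L 0) (L k.succ) i = _
    rw [selfDual_dot]
    simp only [row_dot_row hL]
    have h0 : ∀ a b : Fin 3, minkowski a.succ 0 * minkowski b.succ k.succ = 0 := by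
      intro a b; simp [minkowski]
    have hd : (Matrix.of ![L (j + 1).succ, L (j + 2).succ, L 0, L k.succ]).det
        = if j = k then L.det else 0 := by
      split_ifs with hjk
      · subst hjk
        fin_cases j <;> simp [Matrix.det_succ_row_zero, Fin.sum_univ_four, Fin.sum_univ_three,
          Fin.succAbove, Matrix.submatrix] <;> ring
      · rcases fin_three_eq_or j k with h | ⟨-, h⟩ | ⟨-, h⟩
        · exact absurd h.symm hjk
        · exact Matrix.det_zero_of_row_eq (i := 0) (j := 3) (by decide) (by rw [h]; rfl)
        · exact Matrix.det_zero_of_row_eq (i := 1) (j := 3) (by decide)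
            (by simp [h, add_assoc]; rfl)
    rw [h0, mul_comm (minkowski _ _) (minkowski _ _), h0, hd, Matrix.smul_apply, Matrix.one_apply]
    split_ifs <;> simp
  have h2 : Z.transpose * Z = 1 := mul_eq_one_comm.1 (selfDualFrame_mul_transpose hL)
  have h3 : Z' = (Complex.I * (L.det : ℂ)) • Z := by
    calc Z' = Z' * (Z.transpose * Z) := by rw [h2, mul_one]
      _ = _ := by rw [← mul_assoc, h1, Matrix.smul_mul, one_mul]
  exact congrFun (congrFun h3 j) i

/-- A real symmetric matrix that is complex orthogonally equivalent to `diag (-2ρ, ρ, ρ)`. -/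
theorem real_of_complex_diagonal {Y : Matrix (Fin 3) (Fin 3) ℂ} {ρ : ℂ} (hρ : ρ ≠ 0)
    (hY : Y * Y.transpose = 1)
    (h : Y * r.map (fun t : ℝ => (t : ℂ)) * Y.transpose = Matrix.diagonal ![-2 * ρ, ρ, ρ]) :
    ∃ ρ' : ℝ, ρ = ρ' ∧
      (∑ i, (Y 0 i).re * (Y 0 i).re = 1) ∧
      ∀ i j, r i j = ρ' * ((if i = j then 1 else 0) - 3 * ((Y 0 i).re * (Y 0 j).re)) := by
  have hY' : Y.transpose * Y = 1 := mul_eq_one_comm.1 hY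
  have hr : r.map (fun t : ℝ => (t : ℂ)) = Y.transpose * Matrix.diagonal ![-2 * ρ, ρ, ρ] * Y := by
    rw [← h]
    calc _ = (Y.transpose * Y) * r.map (fun t : ℝ => (t : ℂ)) * (Y.transpose * Y) := by
          rw [hY', one_mul, mul_one]
      _ = _ := by simp only [mul_assoc]
  have hy : ∑ i, Y 0 i * Y 0 i = 1 := by
    have := congrFun (congrFun hY 0) 0
    rwa [Matrix.mul_apply] at this
  have hij : ∀ i j, (r i j : ℂ) = ρ * ((if i = j then 1 else 0) - 3 * (Y 0 i * Y 0 j)) := by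
    intro i j
    have e1 := congrFun (congrFun hr i) j
    have e2 := congrFun (congrFun hY' i) j
    simp only [Matrix.map_apply, Matrix.mul_apply, Matrix.transpose_apply,
      Fin.sum_univ_three, Matrix.one_apply] at e1 e2
    rw [e1, ← e2]
    simp
    ring
  -- The traces of `r²` and `r³` are real, and minus their quotient is `ρ`; this makes the
  -- eigenvalue real.
  have tr2 : ((∑ i, ∑ j, r i j * r i j : ℝ) : ℂ) = 6 * ρ ^ 2 := by
    push_cast
    simp only [hij, Fin.sum_univ_three] at hy ⊢
    simp
    linear_combination (9 * ρ ^ 2 * (Y 0 0 * Y 0 0 + Y 0 1 * Y 0 1 + Y 0 2 * Y 0 2) + 3 * ρ ^ 2) * hy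
  have tr3 : ((∑ i, ∑ j, ∑ k, r i j * r j k * r k i : ℝ) : ℂ) = -6 * ρ ^ 3 := by
    push_cast
    simp only [hij, Fin.sum_univ_three] at hy ⊢
    simp
    linear_combination (-27 * ρ ^ 3 * ((Y 0 0 * Y 0 0 + Y 0 1 * Y 0 1 + Y 0 2 * Y 0 2) ^ 2) -
      9 * ρ ^ 3) * hy
  set s : ℝ := ∑ i, ∑ j, r i j * r i j
  set t : ℝ := ∑ i, ∑ j, ∑ k, r i j * r j k * r k i
  have hρ' : ρ = ((-t / s : ℝ) : ℂ) := by
    push_cast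
    rw [tr2, tr3]
    field_simp
  refine ⟨-t / s, hρ', ?_⟩
  set ρ' := -t / s
  have hρ0 : ρ' ≠ 0 := by
    intro h0; rw [h0] at hρ'; exact hρ (by simpa using hρ')
  -- Since `r` and `ρ` are real, the rank-one matrix `Y₀ ⊗ Y₀` has no imaginary part. The
  -- normalisation excludes a purely imaginary `Y₀`, so `Y₀` is real.
  have him : ∀ i j, (Y 0 i).re * (Y 0 j).im + (Y 0 i).im * (Y 0 j).re = 0 := by
    intro i j
    have := congrArg Complex.im (hij i j)
    rw [hρ'] at this
    have e : (((if i = j then 1 else 0 : ℂ)).im) = 0 := by split_ifs <;> simp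
    simp [e] at this
    rcases this with h | h
    · exact absurd h hρ0
    · exact h
  have hre := congrArg Complex.re hy
  simp [Fin.sum_univ_three] at hre
  have hsq : ∀ j, (Y 0 j).im = 0 := by
    intro j
    have h0 := him 0 j
    have h1 := him 1 j
    have h2 := him 2 j
    have k0 := him 0 0
    have k1 := him 1 1
    have k2 := him 2 2
    -- By `hre` the first factor is the squared length of the real part of `Y₀`.
    have : (1 + (Y 0 0).im ^ 2 + (Y 0 1).im ^ 2 + (Y 0 2).im ^ 2) * (Y 0 j).im = 0 := by
      linear_combination (Y 0 0).re * h0 + (Y 0 1).re * h1 + (Y 0 2).re * h2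
        - (Y 0 j).re / 2 * (k0 + k1 + k2) - (Y 0 j).im * hre
    exact (mul_eq_zero.1 this).resolve_left (by positivity)
  refine ⟨?_, fun i j => ?_⟩
  · simp only [hsq, Fin.sum_univ_three] at hre ⊢
    linarith
  · have := congrArg Complex.re (hij i j)
    rw [hρ'] at this
    have e : (((if i = j then 1 else 0 : ℂ)).re) = if i = j then 1 else 0 := by
      split_ifs <;> simp
    simpa [e, hsq] using this

/-- The change from the static frame to the canonical frame acts on self-dual bivectors by a complex
orthogonal `Z`, so the type D matrix is `Z r Zᵀ` up to conjugation, and `real_of_complex_diagonal`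
applies. The real axis found there is the electric part of `u₀ ∧ u₁`. -/
theorem weylForm_typeD (hL : L * minkowski * L.transpose = minkowski) {ρ : ℂ} (hρ : ρ ≠ 0)
    (h : (Matrix.of fun j k : Fin 3 => ((weylForm r (L 0) (L j.succ) (L 0) (L k.succ) : ℝ) : ℂ)
        + Complex.I * ((weylForm r (L 0) (L j.succ) (L (k + 1).succ) (L (k + 2).succ) : ℝ) : ℂ))
      = Matrix.diagonal ![-2 * ρ, ρ, ρ]) :
    ∃ ρ' : ℝ, ρ = ρ' ∧ (∑ i, elec (L 0) (L 1) i * elec (L 0) (L 1) i = 1) ∧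
      ∀ i j, r i j = ρ' * ((if i = j then 1 else 0)
        - 3 * (elec (L 0) (L 1) i * elec (L 0) (L 1) j)) := by
  set Z := selfDualFrame L with hZ
  have hZZ : Z * Z.transpose = 1 := selfDualFrame_mul_transpose hL
  set X := Z * r.map (fun t : ℝ => (t : ℂ)) * Z.transpose with hX
  have hXe : ∀ j k, X j k = ∑ i, ∑ l, Z j i * r i l * Z k l := by
    intro j k
    rw [hX, Matrix.mul_apply]
    simp only [Matrix.mul_apply, Matrix.transpose_apply, Matrix.map_apply, Finset.sum_mul]
    exact Finset.sum_comm
  have h1 : ∀ j k : Fin 3, weylForm r (L 0) (L j.succ) (L 0) (L k.succ) = (X j k).re :=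
    fun j k => by rw [hXe, weylForm_eq_re]; rfl
  have h2 : ∀ j k : Fin 3, weylForm r (L 0) (L j.succ) (L (k + 1).succ) (L (k + 2).succ)
      = -L.det * (X j k).im := by
    intro j k
    have : ∑ i, ∑ l, selfDual (L 0) (L j.succ) i * (r i l : ℂ)
        * selfDual (L (k + 1).succ) (L (k + 2).succ) l = Complex.I * (L.det : ℂ) * X j k := by
      rw [hXe]
      simp only [selfDual_succ_succ hL, Finset.mul_sum]
      refine Finset.sum_congr rfl fun i _ => Finset.sum_congr rfl fun l _ => ?_
      change Z j i * _ * _ = _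
      ring
    rw [weylForm_eq_re, this]
    simp
  have hre : ∀ i, (Z 0 i).re = elec (L 0) (L 1) i := fun i => by
    change (selfDual (L 0) (L 1) i).re = _
    simp [selfDual]
  have hd : L.det = 1 ∨ L.det = -1 := by
    have := det_mul_self_of_lorentz hL
    exact mul_self_eq_one_iff.1 this
  simp only [h1, h2] at h
  -- The given matrix is `re X - i det(L) im X`: the conjugate of `X` for a positively oriented
  -- frame and `X` itself otherwise. Conjugating `Z` keeps the real part of its first row.
  rcases hd with hd | hd
  · set Y := Z.map (starRingEnd ℂ) with hYd
    have hYY : Y * Y.transpose = 1 := by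
      have := congrArg (fun M => M.map (starRingEnd ℂ)) hZZ
      rw [Matrix.map_mul] at this
      simpa [hYd, Matrix.transpose_map] using this
    have hYr : Y * r.map (fun t : ℝ => (t : ℂ)) * Y.transpose = X.map (starRingEnd ℂ) := by
      rw [hX, Matrix.map_mul, Matrix.map_mul]
      congr 2
      ext i j; simp
    have hXD : X.map (starRingEnd ℂ) = Matrix.diagonal ![-2 * ρ, ρ, ρ] := by
      rw [← h]
      ext j k
      apply Complex.ext <;> simp [hd]
    obtain ⟨ρ', e1, e2, e3⟩ := real_of_complex_diagonal hρ hYY (hYr.trans hXD)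
    have : ∀ i, (Y 0 i).re = elec (L 0) (L 1) i := fun i => by simp [hYd, ← hre]
    simp only [this] at e2 e3
    exact ⟨ρ', e1, e2, e3⟩
  · have hXD : X = Matrix.diagonal ![-2 * ρ, ρ, ρ] := by
      rw [← h]
      ext j k
      apply Complex.ext <;> simp [hd]
    obtain ⟨ρ', e1, e2, e3⟩ := real_of_complex_diagonal hρ hZZ hXD
    simp only [hre] at e2 e3
    exact ⟨ρ', e1, e2, e3⟩

end TypeD

/-! ### Frames of a static space-time: the Weyl matrix against the spatial Ricci tensor. -/

section Frames

variable {γ : TensorField 3} {U : (Fin 3 → ℝ) → ℝ} {y : Fin 4 → ℝ} {N : Set (Fin 3 → ℝ)}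
  {e : Matrix (Fin 3) (Fin 3) ℝ}

/-- The frame of a static space-time that consists of `c ∂_T` and the rows of `e`. -/
def frameMat (c : ℝ) (e : Matrix (Fin 3) (Fin 3) ℝ) : Matrix (Fin 4) (Fin 4) ℝ :=
  Matrix.of <| Fin.cons (Fin.cons c fun _ => 0) fun i => Fin.cons 0 (e i)

theorem vecMul_frameMat_zero (c : ℝ) (p : Fin 4 → ℝ) :
    Matrix.vecMul p (frameMat c e) 0 = p 0 * c := by
  simp [Matrix.vecMul, dotProduct, Fin.sum_univ_succ (n := 3), frameMat]

theorem vecMul_frameMat_succ (c : ℝ) (p : Fin 4 → ℝ) (i : Fin 3) :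
    Matrix.vecMul p (frameMat c e) i.succ = Matrix.vecMul (Fin.tail p) e i := by
  simp [Matrix.vecMul, dotProduct, Fin.sum_univ_succ (n := 3), frameMat, Fin.tail]

theorem frameMat_orthonormal (he : e * γ (Fin.tail y) * e.transpose = 1) :
    IsOrthonormalFrame (staticMetric γ U) y (frameMat (Real.exp (-U (Fin.tail y))) e) := by
  have hx : Real.exp (-U (Fin.tail y)) * Real.exp (2 * U (Fin.tail y))
      * Real.exp (-U (Fin.tail y)) = 1 := by
    rw [← Real.exp_add, ← Real.exp_add, ← Real.exp_zero]
    congr 1; ring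
  have hm : ∀ i j : Fin 3, (![-1, 1, 1, 1] : Fin 4 → ℝ) i.succ = 1 := fun i j => by
    fin_cases i <;> rfl
  ext a b
  rw [Matrix.mul_apply]
  refine Fin.cases ?_ (fun i => ?_) a <;> refine Fin.cases ?_ (fun j => ?_) b
  · simp [Matrix.mul_apply, Fin.sum_univ_succ (n := 3), frameMat]
    linarith
  · rw [Matrix.diagonal_apply_ne _ (Fin.succ_ne_zero j).symm]
    simp [Matrix.mul_apply, Fin.sum_univ_succ (n := 3), frameMat]
  · simp [Matrix.mul_apply, Fin.sum_univ_succ (n := 3), frameMat]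
  · have h := congrFun (congrFun he i) j
    rw [Matrix.mul_apply] at h
    simp only [Matrix.mul_apply, Matrix.transpose_apply] at h
    simp only [Matrix.mul_apply, Fin.sum_univ_succ (n := 3), frameMat, Matrix.transpose_apply,
      Matrix.of_apply, Fin.cons_succ, Fin.cons_zero, staticMetric_succ_succ, mul_zero, zero_mul,
      zero_add]
    rw [h, Matrix.one_apply, Matrix.diagonal_apply, hm i j]
    simp [Fin.succ_inj]

theorem dotProduct_frame {M : Matrix (Fin 3) (Fin 3) ℝ} (a b : Fin 3 → ℝ) :
    Matrix.vecMul a e ⬝ᵥ M.mulVec (Matrix.vecMul b e)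
      = a ⬝ᵥ (e * M * e.transpose).mulVec b := by
  rw [← Matrix.mulVec_transpose e b, Matrix.mulVec_mulVec, ← Matrix.dotProduct_mulVec,
    Matrix.mulVec_mulVec, mul_assoc]

variable (hγ : IsMetricOn γ N) (hU : ContDiffOn ℝ ∞ U N) (hy : y ∈ cylinder N)
include hγ hy

theorem riemann_vectors_of_three (htr : metricTrace γ (ricci γ) (Fin.tail y) = 0)
    (a b c d : Fin 3 → ℝ) :
    ∑ i, ∑ j, ∑ k, ∑ l, riemann γ i j k l (Fin.tail y) * a i * b j * c k * d l
      = (a ⬝ᵥ (γ (Fin.tail y)).mulVec c) * (b ⬝ᵥ (ricci γ (Fin.tail y)).mulVec d)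
        - (a ⬝ᵥ (γ (Fin.tail y)).mulVec d) * (b ⬝ᵥ (ricci γ (Fin.tail y)).mulVec c)
        + (b ⬝ᵥ (γ (Fin.tail y)).mulVec d) * (a ⬝ᵥ (ricci γ (Fin.tail y)).mulVec c)
        - (b ⬝ᵥ (γ (Fin.tail y)).mulVec c) * (a ⬝ᵥ (ricci γ (Fin.tail y)).mulVec d) := by
  simp only [hγ.riemann_eq_of_three hy htr, dotProduct, Matrix.mulVec, Fin.sum_univ_three]
  ring

include hU in
/-- The Weyl tensor of a static vacuum metric in an orthonormal frame adapted to `∂_T`. -/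
theorem static_weylEval_frame (h : ricci (staticMetric γ U) y = 0)
    (he : e * γ (Fin.tail y) * e.transpose = 1) (p q v w : Fin 4 → ℝ) :
    weylEval (staticMetric γ U) y
      (Matrix.vecMul p (frameMat (Real.exp (-U (Fin.tail y))) e))
      (Matrix.vecMul q (frameMat (Real.exp (-U (Fin.tail y))) e))
      (Matrix.vecMul v (frameMat (Real.exp (-U (Fin.tail y))) e))
      (Matrix.vecMul w (frameMat (Real.exp (-U (Fin.tail y))) e))
      = weylForm (e * ricci γ (Fin.tail y) * e.transpose) p q v w := by
  have hx : Real.exp (2 * U (Fin.tail y)) * (Real.exp (-U (Fin.tail y))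
      * Real.exp (-U (Fin.tail y))) = 1 := by
    rw [← Real.exp_add, ← Real.exp_add, ← Real.exp_zero]
    congr 1; ring
  have htr := ((static_ricci_eq_zero_iff hγ hU hy).1 h).2
  set R := ricci γ (Fin.tail y) with hR
  set r := e * R * e.transpose with hr
  have htr' : r.trace = 0 := by
    have hee : e.transpose * e = (γ (Fin.tail y))⁻¹ := by
      refine (Matrix.inv_eq_left_inv ?_).symm
      have h1 : e * (γ (Fin.tail y) * e.transpose) = 1 := by rw [← mul_assoc, he]
      have h2 := mul_eq_one_comm.1 h1
      have h3 := congrArg Matrix.transpose h2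
      rw [Matrix.transpose_mul, Matrix.transpose_mul, Matrix.transpose_transpose,
        hγ.transpose hy, Matrix.transpose_one, ← mul_assoc] at h3
      exact h3
    rw [hr, Matrix.trace_mul_comm, ← mul_assoc, hee]
    exact htr
  rw [static_weylEval hγ hU hy h]
  simp only [vecMul_frameMat_zero, vecMul_frameMat_succ]
  rw [riemann_vectors_of_three hγ hy htr]
  simp only [dotProduct_frame, he, ← hR, ← hr, Matrix.one_mulVec]
  have e1 : ∀ p q : Fin 4 → ℝ, ∀ c : ℝ, ∀ i, p 0 * c * Matrix.vecMul (Fin.tail q) e i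
      - q 0 * c * Matrix.vecMul (Fin.tail p) e i = c * Matrix.vecMul (elec p q) e i := by
    intro p q c i
    simp only [Matrix.vecMul, dotProduct, elec, Fin.tail, Fin.sum_univ_three]
    ring
  have e2 : ∀ (M : Matrix (Fin 3) (Fin 3) ℝ) (a b : Fin 3 → ℝ) (c : ℝ),
      ∑ i, ∑ j, M i j * (c * a i) * (c * b j) = c * c * (a ⬝ᵥ M.mulVec b) := by
    intro M a b c
    simp only [dotProduct, Matrix.mulVec, Finset.mul_sum]
    exact Finset.sum_congr rfl fun i _ => Finset.sum_congr rfl fun j _ => by ring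
  simp only [e1, e2, dotProduct_frame, ← hr]
  rw [← mul_assoc, hx, one_mul]
  simp only [Matrix.trace, Matrix.diag, Fin.sum_univ_three] at htr'
  have hs : r.transpose = r := by
    have hRs : R.transpose = R := by ext i j; exact hγ.ricci_symm hy j i
    rw [hr, Matrix.transpose_mul, Matrix.transpose_mul, hRs, Matrix.transpose_transpose, mul_assoc]
  have hs' : ∀ i j, r i j = r j i := fun i j => congrFun (congrFun hs j) i
  have s1 := hs' 1 0
  have s2 := hs' 2 0
  have s3 := hs' 2 1
  simp [s1, s2, s3, dotProduct, Matrix.mulVec, weylForm, elec, magn, Fin.tail, Fin.sum_univ_three,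
    show (2 : Fin 3).succ = 3 from rfl]
  -- The spatial curvature acts on magnetic parts as `-r` only up to the trace of `r`, which
  -- multiplies the product of the two magnetic parts.
  linear_combination ((p 2 * q 3 - p 3 * q 2) * (v 2 * w 3 - v 3 * w 2)
    + (p 3 * q 1 - p 1 * q 3) * (v 3 * w 1 - v 1 * w 3)
    + (p 1 * q 2 - p 2 * q 1) * (v 1 * w 2 - v 2 * w 1)) * htr'

include hU in
-- In a static frame the Weyl matrix is the Ricci matrix, so a Ricci eigenframe with the simple
-- eigenvector first is canonical once the unit vector along `∂_T` is added.
theorem isTypeDFrame_frameMat (h : ricci (staticMetric γ U) y = 0)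
    (he : e * γ (Fin.tail y) * e.transpose = 1) {ρ : ℝ} (hρ : ρ ≠ 0)
    (hr : e * ricci γ (Fin.tail y) * e.transpose = Matrix.diagonal ![-2 * ρ, ρ, ρ]) :
    IsTypeDFrame (staticMetric γ U) y ρ (frameMat (Real.exp (-U (Fin.tail y))) e) := by
  refine ⟨frameMat_orthonormal he, by exact_mod_cast hρ, ?_⟩
  have hrow : ∀ a, frameMat (Real.exp (-U (Fin.tail y))) e a
      = Matrix.vecMul (Pi.single a 1) (frameMat (Real.exp (-U (Fin.tail y))) e) := fun a => by
    rw [Matrix.single_one_vecMul]; rfl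
  ext j k
  rw [weylMatrix, Matrix.of_apply, hrow 0, hrow j.succ, hrow k.succ, hrow (k + 1).succ,
    hrow (k + 2).succ, static_weylEval_frame hγ hU hy h he, static_weylEval_frame hγ hU hy h he, hr]
  fin_cases j <;> fin_cases k <;>
    simp [weylForm, elec, magn, Fin.sum_univ_three, show (2 : Fin 3).succ = 3 from rfl]

include hU in
-- A canonical frame need not contain the static direction, as it may be boosted in its time-like
-- plane. Only the position of the simple eigenvector in that plane is therefore asserted, and the
-- gradient condition needs no more.
theorem ricci_of_isTypeDFrame (h : ricci (staticMetric γ U) y = 0)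
    (he : e * γ (Fin.tail y) * e.transpose = 1) {ρ : ℂ} {u : Matrix (Fin 4) (Fin 4) ℝ}
    (hu : IsTypeDFrame (staticMetric γ U) y ρ u) :
    ∃ (ρ' : ℝ) (v : Fin 3 → ℝ), ρ = ρ' ∧ v ⬝ᵥ (γ (Fin.tail y)).mulVec v = 1 ∧
      (∀ i j, ricci γ (Fin.tail y) i j = ρ' * (γ (Fin.tail y) i j
        - 3 * ((γ (Fin.tail y)).mulVec v i * (γ (Fin.tail y)).mulVec v j))) ∧
      ∃ a b : ℝ, (Fin.cons 0 v : Fin 4 → ℝ) = a • u 0 + b • u 1 := by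
  obtain ⟨hu1, hu2, hu3⟩ := hu
  set M := frameMat (Real.exp (-U (Fin.tail y))) e with hM
  set R := ricci γ (Fin.tail y) with hR
  set g := γ (Fin.tail y) with hg
  have hMo : M * staticMetric γ U y * M.transpose = minkowski := frameMat_orthonormal he
  have hMu : IsUnit M.det := by
    have h1 := congrArg Matrix.det hMo
    rw [Matrix.det_mul, Matrix.det_mul] at h1
    refine isUnit_iff_ne_zero.2 fun h0 => ?_
    rw [h0, zero_mul, zero_mul, Matrix.det_diagonal, Fin.prod_univ_four] at h1
    simp at h1
  set L := u * M⁻¹ with hLd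
  have hLM : u = L * M := by rw [hLd, mul_assoc, Matrix.nonsing_inv_mul _ hMu, mul_one]
  have hL : L * minkowski * L.transpose = minkowski := by
    have hu' : u * staticMetric γ U y * u.transpose = minkowski := hu1
    rw [hLM, Matrix.transpose_mul] at hu'
    conv_lhs => rw [← hMo]
    rw [← hu']
    simp only [mul_assoc]
  have hrow : ∀ a, u a = Matrix.vecMul (L a) M := fun a => by rw [hLM]; rfl
  have hw : (Matrix.of fun j k : Fin 3 =>
      ((weylForm (e * R * e.transpose) (L 0) (L j.succ) (L 0) (L k.succ) : ℝ) : ℂ)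
      + Complex.I * ((weylForm (e * R * e.transpose) (L 0) (L j.succ) (L (k + 1).succ)
        (L (k + 2).succ) : ℝ) : ℂ)) = Matrix.diagonal ![-2 * ρ, ρ, ρ] := by
    rw [← hu3]
    ext j k
    simp only [weylMatrix, Matrix.of_apply, hrow]
    rw [static_weylEval_frame hγ hU hy h he, static_weylEval_frame hγ hU hy h he]
  obtain ⟨ρ', e1, e2, e3⟩ := weylForm_typeD hL hu2 hw
  set a := elec (L 0) (L 1) with ha
  have h1 : (g * e.transpose) * e = 1 := by
    refine mul_eq_one_comm.1 ?_
    rw [← mul_assoc, he]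
  have hgT : g.transpose = g := hγ.transpose hy
  have h2 : e.transpose * (e * g) = 1 := by
    have := congrArg Matrix.transpose h1
    rwa [Matrix.transpose_mul, Matrix.transpose_mul, Matrix.transpose_transpose, hgT,
      Matrix.transpose_one] at this
  have hv : g.mulVec (Matrix.vecMul a e) = (g * e.transpose).mulVec a := by
    rw [← Matrix.mulVec_transpose, Matrix.mulVec_mulVec]
  -- The combination `L₀₀ u₁ - L₁₀ u₀` has no component along `∂_T`, and its spatial components in
  -- the frame `e` are the electric part of `u₀ ∧ u₁`.
  refine ⟨ρ', Matrix.vecMul a e, e1, ?_, fun i j => ?_, -(L 1 0), L 0 0, ?_⟩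
  · rw [dotProduct_frame, he, Matrix.one_mulVec]
    exact e2
  · have hr : e * R * e.transpose
        = ρ' • ((1 : Matrix (Fin 3) (Fin 3) ℝ) - (3 : ℝ) • Matrix.vecMulVec a a) := by
      ext i j
      rw [e3 i j]
      simp [Matrix.one_apply, Matrix.vecMulVec_apply]
    have hRr : R = (g * e.transpose) * (e * R * e.transpose) * (e * g) := by
      calc R = ((g * e.transpose) * e) * R * (e.transpose * (e * g)) := by
            rw [h1, h2, one_mul, mul_one]
        _ = _ := by simp only [mul_assoc]
    rw [hv, hRr, hr]
    have e4 : (g * e.transpose) * (ρ' • ((1 : Matrix (Fin 3) (Fin 3) ℝ)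
        - (3 : ℝ) • Matrix.vecMulVec a a)) * (e * g) = ρ' • (g - (3 : ℝ) • Matrix.vecMulVec
          ((g * e.transpose).mulVec a) ((g * e.transpose).mulVec a)) := by
      have e5 : (g * e.transpose) * (e * g) = g := by
        rw [← mul_assoc, h1, one_mul]
      have e6 : Matrix.vecMul a (e * g) = (g * e.transpose).mulVec a := by
        rw [← Matrix.mulVec_transpose, Matrix.transpose_mul, hgT]
      rw [Matrix.mul_smul, Matrix.smul_mul, mul_sub, sub_mul, mul_one, e5, Matrix.mul_smul,
        Matrix.smul_mul, Matrix.mul_vecMulVec, Matrix.vecMulVec_mul, e6]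
    rw [e4]
    simp [Matrix.vecMulVec_apply]
  · funext b
    rw [hrow 0, hrow 1]
    refine Fin.cases ?_ (fun i => ?_) b
    · rw [Pi.add_apply, Pi.smul_apply, Pi.smul_apply, hM, vecMul_frameMat_zero,
        vecMul_frameMat_zero]
      simp
      ring
    · rw [Pi.add_apply, Pi.smul_apply, Pi.smul_apply, hM, vecMul_frameMat_succ,
        vecMul_frameMat_succ]
      simp only [Fin.cons_succ, Matrix.vecMul, dotProduct, ha, elec, Fin.tail, smul_eq_mul,
        Fin.sum_univ_three]
      ring

end Frames

/-! ### Orthonormal frames of a positive definite form, and simultaneous diagonalisation. -/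

open scoped MatrixOrder Matrix.Norms.L2Operator in
theorem exists_orthonormal {g : Matrix (Fin 3) (Fin 3) ℝ} (hg : g.PosDef) :
    ∃ f : Matrix (Fin 3) (Fin 3) ℝ, f * g * f.transpose = 1 := by
  obtain ⟨B, hB, rfl⟩ := CStarAlgebra.isStrictlyPositive_iff_eq_star_mul_self.mp
    hg.isStrictlyPositive
  have hBd : IsUnit B.det := (Matrix.isUnit_iff_isUnit_det _).1 hB
  rw [Matrix.star_eq_conjTranspose, Matrix.conjTranspose_eq_transpose_of_trivial]
  refine ⟨(B⁻¹).transpose, ?_⟩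
  have h1 : (B⁻¹).transpose * B.transpose = 1 := by
    rw [← Matrix.transpose_mul, Matrix.mul_nonsing_inv _ hBd, Matrix.transpose_one]
  rw [← mul_assoc, h1, one_mul, Matrix.transpose_transpose, Matrix.mul_nonsing_inv _ hBd]

theorem exists_orthonormal_diagonalizing {g R : Matrix (Fin 3) (Fin 3) ℝ} (hg : g.PosDef)
    (hR : R.transpose = R) : ∃ (e : Matrix (Fin 3) (Fin 3) ℝ) (d : Fin 3 → ℝ),
      e * g * e.transpose = 1 ∧ e * R * e.transpose = Matrix.diagonal d := by
  obtain ⟨f, hfg⟩ := exists_orthonormal hg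
  have hH : (f * R * f.transpose).IsHermitian := by
    rw [Matrix.IsHermitian, Matrix.conjTranspose_eq_transpose_of_trivial, Matrix.transpose_mul,
      Matrix.transpose_mul, hR, Matrix.transpose_transpose, mul_assoc]
  obtain ⟨V, d, hVV, hs⟩ : ∃ (V : Matrix (Fin 3) (Fin 3) ℝ) (d : Fin 3 → ℝ),
      V.transpose * V = 1 ∧ V.transpose * (f * R * f.transpose) * V = Matrix.diagonal d := by
    have hs := hH.conjStarAlgAut_star_eigenvectorUnitary
    rw [Unitary.conjStarAlgAut_star_apply] at hs
    have hV := Unitary.coe_star_mul_self hH.eigenvectorUnitary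
    rw [Matrix.star_eq_conjTranspose, Matrix.conjTranspose_eq_transpose_of_trivial] at hs hV
    exact ⟨_, _, hV, hs⟩
  refine ⟨V.transpose * f, d, ?_, ?_⟩ <;>
    rw [Matrix.transpose_mul, Matrix.transpose_transpose]
  · calc _ = V.transpose * (f * g * f.transpose) * V := by simp only [mul_assoc]
      _ = 1 := by rw [hfg, mul_one, hVV]
  · rw [← hs]
    simp only [mul_assoc]

/-! Ricci tensors with a double eigenvalue. -/

/-- `R = ρ (g - 3 n ⊗ n)` for a unit covector `n`. -/
structure IsUniaxial (g R : Matrix (Fin 3) (Fin 3) ℝ) (ρ : ℝ) (n : Fin 3 → ℝ) : Prop where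
  unit : ∑ i, ∑ j, g⁻¹ i j * n i * n j = 1
  eq : ∀ i j, R i j = ρ * (g i j - 3 * (n i * n j))

section Algebra

variable {g R : Matrix (Fin 3) (Fin 3) ℝ} {ρ : ℝ} {n : Fin 3 → ℝ}

theorem IsUniaxial.of_vector (hg : IsUnit g.det) (hs : g.transpose = g) {v : Fin 3 → ℝ}
    (hv : v ⬝ᵥ g.mulVec v = 1)
    (hR : ∀ i j, R i j = ρ * (g i j - 3 * (g.mulVec v i * g.mulVec v j))) :
    IsUniaxial g R ρ (g.mulVec v) ∧ g⁻¹.mulVec (g.mulVec v) = v := by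
  have h1 : g⁻¹.mulVec (g.mulVec v) = v := by
    rw [Matrix.mulVec_mulVec, Matrix.nonsing_inv_mul _ hg, Matrix.one_mulVec]
  refine ⟨⟨?_, hR⟩, h1⟩
  have hsym : ∀ i j, g⁻¹ i j = g⁻¹ j i := fun i j => by
    have : (g⁻¹).transpose = g⁻¹ := by rw [Matrix.transpose_nonsing_inv, hs]
    exact congrFun (congrFun this j) i
  have hk : ∀ j, ∑ i, g⁻¹ i j * g.mulVec v i = v j := fun j => by
    simp only [hsym _ j]
    exact congrFun h1 j
  rw [← hv, Finset.sum_comm]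
  simp only [← Finset.sum_mul, hk]
  rfl

namespace IsUniaxial

variable (h : IsUniaxial g R ρ n)
include h

theorem eq_matrix : R = ρ • (g - (3 : ℝ) • Matrix.vecMulVec n n) := by
  ext i j
  simp [h.eq, Matrix.vecMulVec_apply]

/-- The covector is a unit one, so `n ⊗ n` is idempotent for the product through `g⁻¹`. Hence all
powers of `R` are combinations of `g` and `n ⊗ n`. -/
theorem proj_mul_proj :
    Matrix.vecMulVec n n * g⁻¹ * Matrix.vecMulVec n n = Matrix.vecMulVec n n := by
  have : Matrix.vecMul n g⁻¹ ⬝ᵥ n = 1 := by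
    rw [← h.unit, Finset.sum_comm]
    simp only [Matrix.vecMul, dotProduct, Finset.sum_mul]
    exact Finset.sum_congr rfl fun i _ => Finset.sum_congr rfl fun j _ => by ring
  rw [Matrix.vecMulVec_mul, Matrix.vecMulVec_mul_vecMulVec, this, one_smul]

theorem trace_proj : (g⁻¹ * Matrix.vecMulVec n n).trace = 1 := by
  rw [← h.unit]
  simp only [Matrix.trace, Matrix.diag, Matrix.mul_apply, Matrix.vecMulVec_apply]
  exact Finset.sum_congr rfl fun i _ => Finset.sum_congr rfl fun j _ => by ring

theorem sq_eq (hg : IsUnit g.det) :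
    R * g⁻¹ * R = (ρ ^ 2) • (g + (3 : ℝ) • Matrix.vecMulVec n n) := by
  have e1 : g * g⁻¹ = 1 := Matrix.mul_nonsing_inv _ hg
  have e2 : g⁻¹ * g = 1 := Matrix.nonsing_inv_mul _ hg
  have e3 := h.proj_mul_proj
  rw [h.eq_matrix]
  set K := Matrix.vecMulVec n n
  simp only [Matrix.smul_mul, Matrix.mul_smul, sub_mul, mul_sub, e1, one_mul, mul_assoc, e2,
    mul_one]
  rw [← mul_assoc, e3]
  module

theorem cube_eq (hg : IsUnit g.det) :
    R * g⁻¹ * R * g⁻¹ * R = (ρ ^ 3) • (g - (9 : ℝ) • Matrix.vecMulVec n n) := by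
  have e1 : g * g⁻¹ = 1 := Matrix.mul_nonsing_inv _ hg
  have e2 : g⁻¹ * g = 1 := Matrix.nonsing_inv_mul _ hg
  have e3 := h.proj_mul_proj
  rw [h.sq_eq hg, h.eq_matrix]
  set K := Matrix.vecMulVec n n
  simp only [Matrix.smul_mul, Matrix.mul_smul, mul_sub, add_mul, e1, one_mul, mul_assoc,
    e2, mul_one]
  rw [← mul_assoc, e3]
  module

theorem trace_eq (hg : IsUnit g.det) : (g⁻¹ * R).trace = 0 := by
  rw [h.eq_matrix, Matrix.mul_smul, mul_sub, Matrix.mul_smul, Matrix.nonsing_inv_mul _ hg,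
    Matrix.trace_smul, Matrix.trace_sub, Matrix.trace_smul, h.trace_proj]
  simp

theorem trace_sq (hg : IsUnit g.det) : (g⁻¹ * (R * g⁻¹ * R)).trace = 6 * ρ ^ 2 := by
  rw [h.sq_eq hg, Matrix.mul_smul, mul_add, Matrix.mul_smul, Matrix.nonsing_inv_mul _ hg,
    Matrix.trace_smul, Matrix.trace_add, Matrix.trace_smul, h.trace_proj]
  simp
  ring

theorem trace_cube (hg : IsUnit g.det) :
    (g⁻¹ * (R * g⁻¹ * R * g⁻¹ * R)).trace = -6 * ρ ^ 3 := by
  rw [h.cube_eq hg, Matrix.mul_smul, mul_sub, Matrix.mul_smul, Matrix.nonsing_inv_mul _ hg,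
    Matrix.trace_smul, Matrix.trace_sub, Matrix.trace_smul, h.trace_proj]
  simp
  ring

end IsUniaxial

/-- For a trace-free form, `s³ - 6t²` is twice the discriminant of the eigenvalues, so two of them
coincide; `t ≠ 0` excludes that all vanish. -/
theorem exists_frame_of_double_eigenvalue (hg : g.PosDef) (hR : R.transpose = R)
    (h1 : (g⁻¹ * R).trace = 0)
    (h2 : 6 * (g⁻¹ * (R * g⁻¹ * R * g⁻¹ * R)).trace ^ 2 = (g⁻¹ * (R * g⁻¹ * R)).trace ^ 3)
    (h3 : (g⁻¹ * (R * g⁻¹ * R * g⁻¹ * R)).trace ≠ 0) :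
    ∃ (ρ : ℝ) (e : Matrix (Fin 3) (Fin 3) ℝ), ρ ≠ 0 ∧ e * g * e.transpose = 1 ∧
      e * R * e.transpose = Matrix.diagonal ![-2 * ρ, ρ, ρ] := by
  obtain ⟨e, d, he, hd⟩ := exists_orthonormal_diagonalizing hg hR
  have hgT : g.transpose = g := by
    have := hg.isHermitian
    rwa [Matrix.IsHermitian, Matrix.conjTranspose_eq_transpose_of_trivial] at this
  have hee : g⁻¹ = e.transpose * e := by
    refine Matrix.inv_eq_left_inv ?_
    have := mul_eq_one_comm.1 (by rw [← mul_assoc, he] : e * (g * e.transpose) = 1)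
    have h3 := congrArg Matrix.transpose this
    rwa [Matrix.transpose_mul, Matrix.transpose_mul, Matrix.transpose_transpose, hgT,
      Matrix.transpose_one, ← mul_assoc] at h3
  have t1 : (g⁻¹ * R).trace = d 0 + d 1 + d 2 := by
    rw [hee, mul_assoc, Matrix.trace_mul_comm, hd, Matrix.trace_diagonal, Fin.sum_univ_three]
  have t2 : (g⁻¹ * (R * g⁻¹ * R)).trace = d 0 ^ 2 + d 1 ^ 2 + d 2 ^ 2 := by
    rw [hee]
    calc _ = (e.transpose * (e * R * e.transpose * e * R)).trace := by simp only [mul_assoc]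
      _ = ((e * R * e.transpose) * (e * R * e.transpose)).trace := by
        rw [Matrix.trace_mul_comm]; simp only [mul_assoc]
      _ = _ := by
        rw [hd, Matrix.diagonal_mul_diagonal, Matrix.trace_diagonal, Fin.sum_univ_three]; ring
  have t3 : (g⁻¹ * (R * g⁻¹ * R * g⁻¹ * R)).trace = d 0 ^ 3 + d 1 ^ 3 + d 2 ^ 3 := by
    rw [hee]
    calc _ = (e.transpose * (e * R * e.transpose * e * R * e.transpose * e * R)).trace := by
          simp only [mul_assoc]
      _ = ((e * R * e.transpose) * (e * R * e.transpose) * (e * R * e.transpose)).trace := by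
        rw [Matrix.trace_mul_comm]; simp only [mul_assoc]
      _ = _ := by
        rw [hd, Matrix.diagonal_mul_diagonal, Matrix.diagonal_mul_diagonal, Matrix.trace_diagonal,
          Fin.sum_univ_three]; ring
  rw [t3, t2] at h2
  rw [t3] at h3
  rw [t1] at h1
  have hd2 : d 2 = -d 0 - d 1 := by linarith
  -- It is enough to name a permutation that brings the simple eigenvalue to the front, one for each
  -- pair that may coincide.
  have key : ∀ (σ : Equiv.Perm (Fin 3)) (ρ : ℝ), (∀ i, d (σ i) = ![-2 * ρ, ρ, ρ] i) →
      ∃ (ρ : ℝ) (e : Matrix (Fin 3) (Fin 3) ℝ), ρ ≠ 0 ∧ e * g * e.transpose = 1 ∧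
        e * R * e.transpose = Matrix.diagonal ![-2 * ρ, ρ, ρ] := by
    intro σ ρ hσ
    have hsub : ∀ M : Matrix (Fin 3) (Fin 3) ℝ, e.submatrix σ id * M * (e.submatrix σ id).transpose
        = (e * M * e.transpose).submatrix σ σ := fun M => by
      ext i j
      simp [Matrix.mul_apply]
    refine ⟨ρ, e.submatrix σ id, ?_, ?_, ?_⟩
    · rintro rfl
      have h0 : ∀ i, d i = 0 := fun i => by
        have := hσ (σ.symm i)
        rw [Equiv.apply_symm_apply] at this
        rw [this]
        generalize σ.symm i = k
        fin_cases k <;> simp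
      exact h3 (by simp [h0])
    · rw [hsub, he, Matrix.submatrix_one _ σ.injective]
    · rw [hsub, hd, Matrix.submatrix_diagonal _ _ σ.injective]
      congr 1
      funext i
      exact hσ i
  -- The discriminant, with `d 2` eliminated: the last two factors are `d 0 - d 2` and `d 1 - d 2`.
  have hprod : ((d 0 - d 1) * (2 * d 0 + d 1) * (d 0 + 2 * d 1)) ^ 2 = 0 := by
    rw [hd2] at h2
    linear_combination (-1 / 2) * h2
  rcases mul_eq_zero.1 (pow_eq_zero_iff two_ne_zero |>.1 hprod) with h | h
  · rcases mul_eq_zero.1 h with h | h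
    · refine key (Equiv.swap 0 2) (d 0) fun i => ?_
      fin_cases i
      · change d 2 = -2 * d 0
        linarith
      · change d 1 = d 0
        linarith
      · rfl
    · refine key (Equiv.swap 0 1) (d 0) fun i => ?_
      fin_cases i
      · change d 1 = -2 * d 0
        linarith
      · rfl
      · change d 2 = d 0
        linarith
  · refine key 1 (d 1) fun i => ?_
    fin_cases i
    · change d 0 = -2 * d 1
      linarith
    · rfl
    · change d 2 = d 1
      linarith

theorem uniaxial_of_frame (hs : g.transpose = g) {e : Matrix (Fin 3) (Fin 3) ℝ}
    (he : e * g * e.transpose = 1)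
    (hr : e * R * e.transpose = Matrix.diagonal ![-2 * ρ, ρ, ρ]) :
    e 0 ⬝ᵥ g.mulVec (e 0) = 1 ∧
      ∀ i j, R i j = ρ * (g i j - 3 * (g.mulVec (e 0) i * g.mulVec (e 0) j)) := by
  have h1 : (g * e.transpose) * e = 1 := mul_eq_one_comm.1 (by rw [← mul_assoc, he])
  have h2 : e.transpose * (e * g) = 1 := by
    have := congrArg Matrix.transpose h1
    rwa [Matrix.transpose_mul, Matrix.transpose_mul, Matrix.transpose_transpose, hs,
      Matrix.transpose_one] at this
  constructor
  · have := congrFun (congrFun he 0) 0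
    rw [mul_assoc, Matrix.mul_apply] at this
    simpa [dotProduct, Matrix.mulVec, Matrix.mul_apply] using this
  · intro i j
    have hRr : R = (g * e.transpose) * (e * R * e.transpose) * (e * g) := by
      calc R = ((g * e.transpose) * e) * R * (e.transpose * (e * g)) := by
            rw [h1, h2, one_mul, mul_one]
        _ = _ := by simp only [mul_assoc]
    have hg2 : g = (g * e.transpose) * (e * g) := by rw [← mul_assoc, h1, one_mul]
    have hsym : ∀ i j, g i j = g j i := fun i j => congrFun (congrFun hs j) i
    set A := g * e.transpose with hA
    have hAe : e * g = A.transpose := by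
      rw [hA, Matrix.transpose_mul, Matrix.transpose_transpose, hs]
    have hA0 : ∀ i, g.mulVec (e 0) i = A i 0 := fun i => rfl
    rw [hAe] at hg2 hRr
    have e1 := congrFun (congrFun hRr i) j
    have e2 := congrFun (congrFun hg2 i) j
    rw [hr] at e1
    simp [Matrix.mul_apply, Fin.sum_univ_three, Matrix.diagonal] at e1 e2
    rw [hA0, hA0, e1, e2]
    ring

end Algebra

/-! Metrics whose Ricci tensor has a double eigenvalue. -/

section Fields

variable {γ : TensorField 3} {D : Set (Fin 3 → ℝ)} {x : Fin 3 → ℝ}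

/-- The double eigenvalue `-t/s` of a trace-free Ricci tensor with `6t² = s³`. -/
noncomputable def doubleEig (γ : TensorField 3) (x : Fin 3 → ℝ) : ℝ := -tInv γ x / sInv γ x

theorem IsMetricOn.smooth_sInv (hγ : IsMetricOn γ D) : ContDiffOn ℝ ∞ (sInv γ) D :=
  (hγ.smooth_inv.mul ((hγ.smooth_ricci.mul hγ.smooth_inv).mul hγ.smooth_ricci)).trace

theorem IsMetricOn.smooth_tInv (hγ : IsMetricOn γ D) : ContDiffOn ℝ ∞ (tInv γ) D :=
  (hγ.smooth_inv.mul ((((hγ.smooth_ricci.mul hγ.smooth_inv).mul hγ.smooth_ricci).mul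
    hγ.smooth_inv).mul hγ.smooth_ricci)).trace

namespace IsUniaxial

variable {ρ : ℝ} {n : Fin 3 → ℝ} (h : IsUniaxial (γ x) (ricci γ x) ρ n) (hd : IsUnit (γ x).det)
include h hd

theorem metricTrace_eq : metricTrace γ (ricci γ) x = 0 := h.trace_eq hd

theorem sInv_eq : sInv γ x = 6 * ρ ^ 2 := h.trace_sq hd

theorem tInv_eq : tInv γ x = -6 * ρ ^ 3 := h.trace_cube hd

theorem doubleEig_eq (hρ : ρ ≠ 0) : doubleEig γ x = ρ := by
  rw [doubleEig, h.sInv_eq hd, h.tInv_eq hd]; field_simp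

theorem omega_eq (hρ : ρ ≠ 0) : Omega γ x = (18 * ρ)⁻¹ := by
  rw [Omega, h.sInv_eq hd, h.tInv_eq hd]; field_simp

theorem PTensor_eq (i j : Fin 3) : PTensor γ x i j = 18 * ρ ^ 2 * (n i * n j) := by
  have : ricciSq γ x = (ρ ^ 2) • (γ x + (3 : ℝ) • Matrix.vecMulVec n n) := h.sq_eq hd
  rw [PTensor, Matrix.sub_apply, h.sInv_eq hd, this]
  simp [Matrix.vecMulVec_apply]
  ring

end IsUniaxial

/-- The Ricci tensor of `γ` has a non-zero double eigenvalue `ρ` on `D`, and `n` is a smooth unit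
covector field along the simple eigendirection, in which `ρ` is constant. -/
structure IsUniaxialOn (γ : TensorField 3) (D : Set (Fin 3 → ℝ)) (ρ : (Fin 3 → ℝ) → ℝ)
    (n : Fin 3 → (Fin 3 → ℝ) → ℝ) : Prop where
  smooth_eig : ContDiffOn ℝ ∞ ρ D
  ne_zero : ∀ x ∈ D, ρ x ≠ 0
  smooth_dir : ∀ i, ContDiffOn ℝ ∞ (n i) D
  uniaxial : ∀ x ∈ D, IsUniaxial (γ x) (ricci γ x) (ρ x) fun i => n i x
  grad : ∀ x ∈ D, ∑ j, ∑ k, (γ x)⁻¹ j k * n j x * pd k ρ x = 0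

/-- The simple eigendirection can locally be chosen smooth. -/
theorem exists_isUniaxialOn (hγ : IsMetricOn γ D)
    (h : ∀ x ∈ D, ∃ (ρ : ℝ) (n : Fin 3 → ℝ), ρ ≠ 0 ∧ IsUniaxial (γ x) (ricci γ x) ρ n ∧
      ∑ j, ∑ k, (γ x)⁻¹ j k * n j * pd k (doubleEig γ) x = 0) {x₀ : Fin 3 → ℝ} (hx₀ : x₀ ∈ D) :
    ∃ (N : Set (Fin 3 → ℝ)) (n : Fin 3 → (Fin 3 → ℝ) → ℝ), IsOpen N ∧ x₀ ∈ N ∧ N ⊆ D ∧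
      IsUniaxialOn γ N (doubleEig γ) n := by
  have hu : ∀ x ∈ D, ∃ n : Fin 3 → ℝ, doubleEig γ x ≠ 0 ∧
      IsUniaxial (γ x) (ricci γ x) (doubleEig γ x) n ∧
      ∑ j, ∑ k, (γ x)⁻¹ j k * n j * pd k (doubleEig γ) x = 0 := by
    intro x hx
    obtain ⟨ρ, n, h1, h2, h3⟩ := h x hx
    have := h2.doubleEig_eq (hγ.det x hx) h1
    exact ⟨n, by rwa [this], by rwa [this], h3⟩
  have hs0 : ∀ x ∈ D, sInv γ x ≠ 0 := by
    intro x hx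
    obtain ⟨ρ, n, h1, h2, -⟩ := h x hx
    rw [h2.sInv_eq (hγ.det x hx)]
    positivity
  have hρ : ContDiffOn ℝ ∞ (doubleEig γ) D := hγ.smooth_tInv.neg.div hγ.smooth_sInv hs0
  choose! m hm0 hm hmg using hu
  obtain ⟨i₀, hi₀⟩ : ∃ i, m x₀ i ≠ 0 := by
    by_contra! hc
    have := (hm x₀ hx₀).unit
    simp [hc] at this
  -- The pointwise choice `m` has an arbitrary sign, but `T = m ⊗ m` is smooth, being algebraic in
  -- `γ`, `R` and `ρ`. A column of `T` divided by the root of its non-zero diagonal entry is a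
  -- smooth unit covector equal to `±m`.
  set T : Fin 3 → Fin 3 → (Fin 3 → ℝ) → ℝ :=
    fun i j x => (γ x i j - ricci γ x i j / doubleEig γ x) / 3 with hTd
  have hTs : ∀ i j, ContDiffOn ℝ ∞ (T i j) D := fun i j =>
    ((hγ.smooth i j).sub ((hγ.smooth_ricci i j).div hρ hm0)).div_const 3
  have hTe : ∀ x ∈ D, ∀ i j, T i j x = m x i * m x j := by
    intro x hx i j
    have := hm0 x hx
    simp only [hTd, (hm x hx).eq]
    field_simp
    ring
  have hpos : ∀ x ∈ D ∩ {x | T i₀ i₀ x ≠ 0}, 0 < T i₀ i₀ x := by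
    rintro x ⟨hx, hx'⟩
    refine lt_of_le_of_ne ?_ (Ne.symm hx')
    rw [hTe x hx]
    exact mul_self_nonneg _
  have hN : IsOpen (D ∩ {x | T i₀ i₀ x ≠ 0}) :=
    (hTs i₀ i₀).continuousOn.isOpen_inter_preimage hγ.isOpen isOpen_ne
  refine ⟨D ∩ {x | T i₀ i₀ x ≠ 0}, fun i x => T i i₀ x / Real.sqrt (T i₀ i₀ x), hN, ⟨hx₀, ?_⟩,
    Set.inter_subset_left, hρ.mono Set.inter_subset_left, fun x hx => hm0 x hx.1, fun i => ?_,
    fun x hx => ?_, fun x hx => ?_⟩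
  · change T i₀ i₀ x₀ ≠ 0
    rw [hTe x₀ hx₀]
    exact mul_self_ne_zero.2 hi₀
  · exact ((hTs i i₀).mono Set.inter_subset_left).div
      (((hTs i₀ i₀).mono Set.inter_subset_left).sqrt fun x hx => (hpos x hx).ne')
      fun x hx => (Real.sqrt_pos.2 (hpos x hx)).ne'
  all_goals
    obtain ⟨c, hc, hn⟩ : ∃ c : ℝ, c * c = 1 ∧
        ∀ i, T i i₀ x / Real.sqrt (T i₀ i₀ x) = c * m x i := by
      have h0 : 0 < |m x i₀| := by
        have := hpos x hx
        rw [hTe x hx.1] at this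
        exact abs_pos.2 (mul_self_pos.1 this)
      refine ⟨m x i₀ / |m x i₀|, ?_, fun i => ?_⟩
      · field_simp
        rw [sq_abs]
      · rw [hTe x hx.1, hTe x hx.1, Real.sqrt_mul_self_eq_abs]
        ring
    simp only [hn]
  · refine ⟨?_, fun i j => ?_⟩
    · rw [← (hm x hx.1).unit]
      refine Finset.sum_congr rfl fun i _ => Finset.sum_congr rfl fun j _ => ?_
      linear_combination ((γ x)⁻¹ i j * m x i * m x j) * hc
    · rw [(hm x hx.1).eq]
      linear_combination (3 * doubleEig γ x * m x i * m x j) * hc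
  · have := congrArg (c * ·) (hmg x hx.1)
    simp only [Finset.mul_sum, mul_zero] at this
    rw [← this]
    exact Finset.sum_congr rfl fun i _ => Finset.sum_congr rfl fun j _ => by ring

end Fields

/-! ### Exterior covariant derivative of a tensor with a double eigenvalue. -/

section Codazzi

variable {m : ℕ} {γ : TensorField m} {D : Set (Fin m → ℝ)} {x : Fin m → ℝ}

/-- The exterior covariant derivative of `f γ - μ n ⊗ n`. -/
theorem IsMetricOn.extCovDeriv_smul_sub (hγ : IsMetricOn γ D) (hx : x ∈ D)
    {f μ : (Fin m → ℝ) → ℝ} {n : Fin m → (Fin m → ℝ) → ℝ} (hf : ContDiffOn ℝ ∞ f D)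
    (hμ : ContDiffOn ℝ ∞ μ D) (hn : ∀ i, ContDiffOn ℝ ∞ (n i) D) {h : TensorField m}
    (hh : ∀ y ∈ D, ∀ i j, h y i j = f y * γ y i j - μ y * (n i y * n j y)) (i j k : Fin m) :
    extCovDeriv γ h i j k x = pd i f x * γ x j k - pd j f x * γ x i k
      - (pd i μ x * n j x - pd j μ x * n i x) * n k x
      - μ x * ((covDeriv γ n i j x - covDeriv γ n j i x) * n k x
        + n j x * covDeriv γ n i k x - n i x * covDeriv γ n j k x) := by
  have dγ := fun i j => (hγ.smooth i j).diffAt hγ.isOpen hx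
  have df := hf.diffAt hγ.isOpen hx
  have dμ := hμ.diffAt hγ.isOpen hx
  have dn := fun i => (hn i).diffAt hγ.isOpen hx
  have hp : ∀ i j k, pd i (fun y => h y j k) x
      = pd i f x * γ x j k + f x * pd i (fun y => γ y j k) x
        - (pd i μ x * (n j x * n k x)
          + μ x * (pd i (n j) x * n k x + n j x * pd i (n k) x)) := by
    intro i j k
    rw [pd_congr hγ.isOpen hx i fun y hy => hh y hy j k,
      pd_sub i (df.fun_mul (dγ j k)) (dμ.fun_mul ((dn j).fun_mul (dn k))),
      pd_mul i df (dγ j k), pd_mul i dμ ((dn j).fun_mul (dn k)), pd_mul i (dn j) (dn k)]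
  -- Metric compatibility: the derivatives of `γ` will cancel against the connection terms, leaving
  -- only `df`, `dμ` and `∇n`.
  have hc : ∀ i j k, pd i (fun y => γ y j k) x
      = ∑ l, christoffel γ l i j x * γ x l k + ∑ l, christoffel γ l i k x * γ x j l := by
    intro i j k
    have := congrFun (congrFun (hγ.pdMat_metric' hx i) j) k
    simp only [pdMat, Matrix.of_apply, Matrix.add_apply, Matrix.mul_apply, conn,
      Matrix.transpose_apply] at this
    rw [this]
    congr 1
    exact Finset.sum_congr rfl fun l _ => mul_comm _ _
  have hΓ : ∀ i j k, ∑ l, christoffel γ l i k x * h x j l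
      = f x * ∑ l, christoffel γ l i k x * γ x j l
        - μ x * n j x * ∑ l, christoffel γ l i k x * n l x := by
    intro i j k
    simp only [hh x hx, Finset.mul_sum, ← Finset.sum_sub_distrib]
    exact Finset.sum_congr rfl fun l _ => by ring
  simp only [extCovDeriv, covDeriv, hp, hc, Finset.sum_sub_distrib, hΓ]
  simp only [hγ.christoffel_symm hx _ j i]
  ring

end Codazzi

/-! ### Pointwise algebra of the integrability conditions. -/

section Algebra

variable {γ G a : Matrix (Fin 3) (Fin 3) ℝ} {n N u w : Fin 3 → ℝ} {ρ μ ν : ℝ}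

/-- Integrability conditions of the vacuum equations when the Ricci tensor has a double
eigenvalue. -/
theorem integrability_of_vacuum (hγs : ∀ i j, γ i j = γ j i) (hγG : γ * G = 1) (hN : ∀ j, ∑ k, γ j k * N k = n j)
    (hG : ∀ j, ∑ k, G k j * n k = N j)
    (hNn : ∑ k, n k * N k = 1) (ha : ∀ i, ∑ k, a i k * N k = 0) (hw : ∑ k, w k * N k = 0)
    (hu : ∑ k, u k * N k = ν)
    (E : ∀ i j k, -3 * w i * γ j k + 3 * w j * γ i k + 9 * (w i * n j - w j * n i) * n k
      - 3 * ((a i j - a j i) * n k + n j * a i k - n i * a j k)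
      + 2 * (u i * (γ j k - 3 * (n j * n k)) - u j * (γ i k - 3 * (n i * n k)))
      + γ j k * (u i - 3 * ν * n i) - γ i k * (u j - 3 * ν * n j) = 0) :
    (∀ i, u i = w i + ν * n i) ∧ ∀ i j, a i j = -(n i * w j) := by
  simp only [Fin.sum_univ_three] at hN hG hNn ha hw hu
  set b : Fin 3 → ℝ := fun i => N 0 * a 0 i + N 1 * a 1 i + N 2 * a 2 i with hb
  have F1 : ∀ i j, a i j - a j i = 2 * (w i * n j - w j * n i) - (u i * n j - u j * n i) := by
    intro i j
    linear_combination (-1 / 3) * (N 0 * E i j 0 + N 1 * E i j 1 + N 2 * E i j 2)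
      + ((-3 * w i + 3 * u i - 3 * ν * n i) / 3) * hN j
      + ((3 * w j - 3 * u j + 3 * ν * n j) / 3) * hN i
      + (3 * (w i * n j - w j * n i) - (a i j - a j i) - 2 * (u i * n j - u j * n i)) * hNn
      - n j * ha i + n i * ha j
  have F2 : ∀ i, b i = u i - 2 * w i - ν * n i := by
    intro i
    have h0 := F1 i 0
    have h1 := F1 i 1
    have h2 := F1 i 2
    simp only [hb]
    linear_combination -(N 0 * h0 + N 1 * h1 + N 2 * h2) + ha i + (u i - 2 * w i) * hNn
      + 2 * n i * hw - n i * hu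
  have F3 : ∀ i k, a i k = n i * b k := by
    intro i k
    have hk := hN k
    simp only [hγs k] at hk
    linear_combination (-1 / 3) * (N 0 * E i 0 k + N 1 * E i 1 k + N 2 * E i 2 k) + n k * F2 i
      + ((-3 * w i + 3 * u i - 3 * ν * n i) / 3) * hk + (γ i k - 3 * n i * n k) * hw
      + ((9 * w i * n k - 3 * a i k - 6 * u i * n k + 3 * ν * γ i k) / 3) * hNn
      - n k * ha i + ((-3 * γ i k + 6 * n i * n k) / 3) * hu
  set q : Fin 3 → ℝ := fun i => u i - w i - ν * n i with hqd
  have T : ∀ i j k, q i * γ j k - q j * γ i k - n k * (q i * n j - q j * n i) = 0 := by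
    intro i j k
    have := E i j k
    simp only [F3, F2] at this
    simp only [hqd]
    linear_combination this / 3
  have hqN : q 0 * N 0 + q 1 * N 1 + q 2 * N 2 = 0 := by
    simp only [hqd]
    linear_combination hu - hw - ν * hNn
  have hδ : ∀ i j, γ i 0 * G 0 j + γ i 1 * G 1 j + γ i 2 * G 2 j
      = (1 : Matrix (Fin 3) (Fin 3) ℝ) i j := fun i j => by
    rw [← hγG, Matrix.mul_apply, Fin.sum_univ_three]
  -- Raise `k` in `T` and set it equal to `j`. The sum over `j` gives `(3 - 1 - 1) q i`, because `q`
  -- annihilates `N`, so dimension three forces `q = 0`.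
  have S : ∀ i j, q i * (1 : Matrix (Fin 3) (Fin 3) ℝ) j j
      - q j * (1 : Matrix (Fin 3) (Fin 3) ℝ) i j - N j * (q i * n j - q j * n i) = 0 := by
    intro i j
    linear_combination G 0 j * T i j 0 + G 1 j * T i j 1 + G 2 j * T i j 2 - q i * hδ j j
      + q j * hδ i j + (q i * n j - q j * n i) * hG j
  have hq : ∀ i, q i = 0 := by
    intro i
    have h : 2 * q i - (q i - 0) = 0 := by
      have hs : q 0 * (1 : Matrix (Fin 3) (Fin 3) ℝ) i 0 + q 1 * (1 : Matrix (Fin 3) (Fin 3) ℝ) i 1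
          + q 2 * (1 : Matrix (Fin 3) (Fin 3) ℝ) i 2 = q i := by
        have := congrFun (Matrix.one_mulVec q) i
        simp only [Matrix.mulVec, dotProduct, Fin.sum_univ_three] at this
        linarith
      have h0 := S i 0
      have h1 := S i 1
      have h2 := S i 2
      simp only [Matrix.one_apply_eq] at h0 h1 h2
      linear_combination h0 + h1 + h2 + hs + q i * hNn - n i * hqN
    linarith
  refine ⟨fun i => by have := hq i; simp only [hqd] at this; linarith, fun i j => ?_⟩
  have := hq j
  simp only [hqd] at this
  rw [F3, F2]
  linear_combination n i * this

/-- The counterpart of `integrability_of_vacuum` for the potential `ℓ` itself, where all terms in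
`γ` cancel. Contraction with `N` gives the antisymmetric part of `a`; the remainder makes `a` a
multiple `n ⊗ b`, and comparing the two gives `b = -w`. -/
theorem integrability_of_criterion (hμ : μ ≠ 0) (hNn : ∑ k, n k * N k = 1)
    (ha : ∀ i, ∑ k, a i k * N k = 0) (hw : ∑ k, w k * N k = 0)
    (E : ∀ i j k, μ * ((w i * n j - w j * n i) * n k
      - ((a i j - a j i) * n k + n j * a i k - n i * a j k)) = 0) (i j : Fin 3) :
    a i j = -(n i * w j) := by
  simp only [Fin.sum_univ_three] at hNn ha hw
  have E' : ∀ i j k, (w i * n j - w j * n i) * n k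
      - ((a i j - a j i) * n k + n j * a i k - n i * a j k) = 0 := fun i j k =>
    (mul_eq_zero.1 (E i j k)).resolve_left hμ
  have F1 : ∀ i j, a i j - a j i = w i * n j - w j * n i := by
    intro i j
    linear_combination -(N 0 * E' i j 0 + N 1 * E' i j 1 + N 2 * E' i j 2)
      + ((w i * n j - w j * n i) - (a i j - a j i)) * hNn - n j * ha i + n i * ha j
  set b : Fin 3 → ℝ := fun i => N 0 * a 0 i + N 1 * a 1 i + N 2 * a 2 i with hb
  have F2 : ∀ i k, a i k = n i * b k := by
    intro i k
    have h : ∀ j, n j * a i k - n i * a j k = 0 := fun j => by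
      linear_combination -E' i j k - n k * F1 i j
    simp only [hb]
    linear_combination N 0 * h 0 + N 1 * h 1 + N 2 * h 2 - a i k * hNn
  have F3 : ∀ j, b j = -w j := by
    intro j
    have h0 := F1 j 0
    have h1 := F1 j 1
    have h2 := F1 j 2
    simp only [hb]
    linear_combination -(N 0 * h0 + N 1 * h1 + N 2 * h2) + ha j - w j * hNn + n j * hw
  rw [F2, F3]
  ring

end Algebra

/-! ### Necessity: consequences of the vacuum equation for the potential and the eigendirection. -/

namespace IsUniaxialOn

variable {γ : TensorField 3} {D : Set (Fin 3 → ℝ)} {x : Fin 3 → ℝ}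
  {ρ ℓ f U : (Fin 3 → ℝ) → ℝ} {n : Fin 3 → (Fin 3 → ℝ) → ℝ}

/-- The vector field metrically equivalent to `n`. -/
noncomputable def _root_.StaticVacuum.raise (γ : TensorField 3) (n : Fin 3 → (Fin 3 → ℝ) → ℝ)
    (x : Fin 3 → ℝ) (i : Fin 3) : ℝ := ∑ j, (γ x)⁻¹ i j * n j x

theorem _root_.StaticVacuum.IsMetricOn.metric_raise (hγ : IsMetricOn γ D) (hx : x ∈ D)
    (n : Fin 3 → (Fin 3 → ℝ) → ℝ) (j : Fin 3) : ∑ k, γ x j k * raise γ n x k = n j x := by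
  have : (γ x).mulVec ((γ x)⁻¹.mulVec fun j => n j x) j = n j x := by
    rw [Matrix.mulVec_mulVec, Matrix.mul_nonsing_inv _ (hγ.det x hx), Matrix.one_mulVec]
  exact this

theorem _root_.StaticVacuum.IsMetricOn.pd_inner' (hγ : IsMetricOn γ D) (hx : x ∈ D) (i : Fin 3)
    {α β : Fin 3 → (Fin 3 → ℝ) → ℝ} (hα : ∀ j, ContDiffOn ℝ ∞ (α j) D)
    (hβ : ∀ j, ContDiffOn ℝ ∞ (β j) D) :
    pd i (fun y => ∑ j, ∑ k, (γ y)⁻¹ j k * α j y * β k y) x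
      = ∑ j, covDeriv γ α i j x * raise γ β x j + ∑ k, covDeriv γ β i k x * raise γ α x k := by
  rw [hγ.pd_inner hx i (fun j => (hα j).diffAt hγ.isOpen hx)
    fun j => (hβ j).diffAt hγ.isOpen hx]
  simp only [mul_add, Finset.sum_add_distrib]
  congr 1
  · simp only [raise, Finset.mul_sum]
    exact Finset.sum_congr rfl fun j _ => Finset.sum_congr rfl fun k _ => by
      simp only [covDeriv]; ring
  · rw [Finset.sum_comm]
    simp only [raise, Finset.mul_sum]
    exact Finset.sum_congr rfl fun j _ => Finset.sum_congr rfl fun k _ => by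
      rw [hγ.inv_symm hx]; simp only [covDeriv]; ring

theorem _root_.StaticVacuum.IsMetricOn.smooth_inner (hγ : IsMetricOn γ D)
    {α β : Fin 3 → (Fin 3 → ℝ) → ℝ} (hα : ∀ j, ContDiffOn ℝ ∞ (α j) D)
    (hβ : ∀ j, ContDiffOn ℝ ∞ (β j) D) :
    ContDiffOn ℝ ∞ (fun y => ∑ j, ∑ k, (γ y)⁻¹ j k * α j y * β k y) D :=
  ContDiffOn.sum fun j _ => ContDiffOn.sum fun k _ =>
    ((hγ.smooth_inv j k).mul (hα j)).mul (hβ k)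

theorem _root_.StaticVacuum.IsMetricOn.inner_eq (hγ : IsMetricOn γ D) (hx : x ∈ D)
    (α β : Fin 3 → (Fin 3 → ℝ) → ℝ) :
    ∑ j, ∑ k, (γ x)⁻¹ j k * α j x * β k x = ∑ k, β k x * raise γ α x k := by
  rw [Finset.sum_comm]
  simp only [raise, Finset.mul_sum]
  exact Finset.sum_congr rfl fun j _ => Finset.sum_congr rfl fun k _ => by
    rw [hγ.inv_symm hx]; ring

variable (hγ : IsMetricOn γ D) (h : IsUniaxialOn γ D ρ n)
include hγ h

theorem unit (hx : x ∈ D) : ∑ k, n k x * raise γ n x k = 1 := by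
  rw [← hγ.inner_eq hx]
  exact (h.uniaxial x hx).unit

theorem covDeriv_raise (hx : x ∈ D) (i : Fin 3) :
    ∑ k, covDeriv γ n i k x * raise γ n x k = 0 := by
  have h1 := hγ.pd_inner' hx i h.smooth_dir h.smooth_dir
  rw [pd_congr (h := fun _ => 1) hγ.isOpen hx i fun y hy => (h.uniaxial y hy).unit, pd_const] at h1
  linarith

theorem metricTrace_eq (hx : x ∈ D) : metricTrace γ (ricci γ) x = 0 :=
  (h.uniaxial x hx).metricTrace_eq (hγ.det x hx)

theorem grad_raise (hℓ : ∀ x ∈ D, ∀ i, pd i ρ x = -3 * ρ x * pd i ℓ x) (hx : x ∈ D) :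
    ∑ k, pd k ℓ x * raise γ n x k = 0 := by
  have h1 := h.grad x hx
  have h2 := hγ.inner_eq hx n fun k => pd k ρ
  rw [h1] at h2
  have h3 : ∑ k, pd k ρ x * raise γ n x k
      = -3 * ρ x * ∑ k, pd k ℓ x * raise γ n x k := by
    rw [Finset.mul_sum]
    exact Finset.sum_congr rfl fun k _ => by rw [hℓ x hx]; ring
  rw [h3] at h2
  refine (mul_eq_zero.1 h2.symm).resolve_left ?_
  exact mul_ne_zero (by norm_num) (h.ne_zero x hx)

theorem ricci_raise (hx : x ∈ D) (i : Fin 3) (f : (Fin 3 → ℝ) → ℝ) :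
    ∑ a, ricci γ x i a * raise γ (fun k => pd k f) x a
      = ρ x * (pd i f x - 3 * (∑ k, pd k f x * raise γ n x k) * n i x) := by
  have h1 := hγ.metric_raise hx (fun k => pd k f) i
  have h2 := hγ.inner_eq hx n fun k => pd k f
  have h3 : ∑ a, n a x * raise γ (fun k => pd k f) x a = ∑ k, pd k f x * raise γ n x k := by
    rw [← h2]
    simp only [raise, Finset.mul_sum]
    exact Finset.sum_congr rfl fun j _ => Finset.sum_congr rfl fun k _ => by ring
  rw [← h1, ← h3]
  simp only [(h.uniaxial x hx).eq, Fin.sum_univ_three]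
  ring

/-- The normal form of the gradient of the potential, and of the derivative of the simple
eigendirection, for a static vacuum metric. -/
theorem grad_eq_of_vacuum (hℓ : ∀ x ∈ D, ∀ i, pd i ρ x = -3 * ρ x * pd i ℓ x)
    (hU : ContDiffOn ℝ ∞ U D) (hR : ∀ x ∈ D, riccatiTensor γ U x = ricci γ x) (hx : x ∈ D) :
    (∀ i, pd i U x = pd i ℓ x + (∑ k, pd k U x * raise γ n x k) * n i x) ∧
      ∀ i j, covDeriv γ n i j x = -(n i x * pd j ℓ x) := by
  have hE := hγ.extCovDeriv_riccatiTensor_of_three hx (h.metricTrace_eq hγ hx) hU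
    (v := raise γ (fun k => pd k U) x) fun a => rfl
  have hC := hγ.extCovDeriv_smul_sub hx (μ := fun y => 3 * ρ y) h.smooth_eig
    (contDiffOn_const.mul h.smooth_eig) h.smooth_dir (h := riccatiTensor γ U) fun y hy i j => by
      rw [hR y hy, (h.uniaxial y hy).eq]; ring
  have hp : ∀ i, pd i (fun y => 3 * ρ y) x = 3 * pd i ρ x := fun i =>
    pd_const_mul i 3 (h.smooth_eig.diffAt hγ.isOpen hx)
  refine integrability_of_vacuum (γ := γ x) (G := (γ x)⁻¹) (N := raise γ n x)
    (n := fun i => n i x) (u := fun i => pd i U x) (w := fun i => pd i ℓ x)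
    (a := Matrix.of fun i j => covDeriv γ n i j x)
    (hγ.symm x hx) (Matrix.mul_nonsing_inv _ (hγ.det x hx)) (hγ.metric_raise hx n)
    (fun j => Finset.sum_congr rfl fun k _ => by rw [hγ.inv_symm hx]) (h.unit hγ hx)
    (h.covDeriv_raise hγ hx) (h.grad_raise hγ hℓ hx) rfl fun i j k => ?_
  have := hE i j k
  rw [hC i j k, h.ricci_raise hγ hx, h.ricci_raise hγ hx, hR x hx] at this
  simp only [hp, hℓ x hx, (h.uniaxial x hx).eq] at this
  have hρ := h.ne_zero x hx
  refine (mul_eq_zero.1 (?_ : ρ x * _ = 0)).resolve_left hρ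
  rw [← this]
  simp only [Matrix.of_apply]
  ring

/-- Insert `dU = dℓ + ν n` and `∇n = -n ⊗ dℓ` into the vacuum equation. The terms `ν n ⊗ dℓ` cancel,
and `R` exceeds the tensor of `ℓ` by `c ⊗ n`; it remains to find `c`. -/
theorem hessian_of_vacuum (hℓs : ContDiffOn ℝ ∞ ℓ D)
    (hℓ : ∀ x ∈ D, ∀ i, pd i ρ x = -3 * ρ x * pd i ℓ x)
    (hU : ContDiffOn ℝ ∞ U D) (hR : ∀ x ∈ D, riccatiTensor γ U x = ricci γ x) (hx : x ∈ D)
    (i j : Fin 3) :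
    riccatiTensor γ ℓ x i j = ricci γ x i j + (2 * ρ x + gradSq γ ℓ x) * (n i x * n j x) := by
  set ν : (Fin 3 → ℝ) → ℝ := fun y => ∑ k, pd k U y * raise γ n y k with hν
  have hνs : ContDiffOn ℝ ∞ ν D :=
    ContDiffOn.sum fun k _ => (hU.pd hγ.isOpen k).mul
      (ContDiffOn.sum fun l _ => (hγ.smooth_inv k l).mul (h.smooth_dir l))
  have key := fun y hy => h.grad_eq_of_vacuum hγ hℓ hU hR (x := y) hy
  have a_eq := (key x hx).2
  have u_eq := (key x hx).1
  have dν := hνs.diffAt hγ.isOpen hx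
  have dn := fun j => (h.smooth_dir j).diffAt hγ.isOpen hx
  set c : Fin 3 → ℝ := fun i => pd i ν x + ν x * pd i ℓ x + ν x ^ 2 * n i x with hc
  have hTc : ∀ i j, riccatiTensor γ ℓ x i j = ricci γ x i j - c i * n j x := by
    intro i j
    have hpp : pd i (pd j U) x = pd i (pd j ℓ) x + (pd i ν x * n j x + ν x * pd i (n j) x) := by
      rw [pd_congr hγ.isOpen hx i fun y hy => (key y hy).1 j,
        pd_add i ((hℓs.pd hγ.isOpen j).diffAt hγ.isOpen hx) (dν.fun_mul (dn j)),
        pd_mul i dν (dn j)]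
    have haij : pd i (n j) x = -(n i x * pd j ℓ x) + ∑ k, christoffel γ k i j x * n k x := by
      rw [← a_eq i j]; simp [covDeriv]
    have hΓ : ∑ k, christoffel γ k i j x * pd k U x = ∑ k, christoffel γ k i j x * pd k ℓ x
        + ν x * ∑ k, christoffel γ k i j x * n k x := by
      rw [Finset.mul_sum, ← Finset.sum_add_distrib]
      exact Finset.sum_congr rfl fun k _ => by rw [u_eq k]; ring
    rw [← hR x hx]
    simp only [riccatiTensor, hessian, Matrix.of_apply, hΓ, hpp, haij]
    rw [u_eq i, u_eq j]
    simp only [hc]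
    ring
  have hcs : ∀ i j, c i * n j x = c j * n i x := by
    intro i j
    have h1 := hTc i j
    have h2 := hTc j i
    have h3 : riccatiTensor γ ℓ x i j = riccatiTensor γ ℓ x j i := by
      simp only [riccatiTensor, Matrix.of_apply]
      rw [hγ.hessian_symm hx hℓs]; ring
    rw [hγ.ricci_symm hx j i] at h2
    linarith
  have hunit := h.unit hγ hx
  have hgrad := h.grad_raise hγ hℓ hx
  have hNR : ∀ i, ∑ k, γ x i k * raise γ n x k = n i x := hγ.metric_raise hx n
  have hQ : gradSq γ ℓ x = ∑ k, pd k ℓ x * raise γ (fun k => pd k ℓ) x k :=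
    hγ.inner_eq hx (fun k => pd k ℓ) fun k => pd k ℓ
  -- Differentiating `⟨n, dℓ⟩ = 0` determines the contraction of the Hessian of `ℓ` with `n`, and
  -- thereby `c`, without computing `dν`.
  have hder : ∀ i, ∑ j, covDeriv γ n i j x * raise γ (fun k => pd k ℓ) x j
      + ∑ k, hessian γ ℓ x i k * raise γ n x k = 0 := by
    intro i
    have h1 := hγ.pd_inner' hx i h.smooth_dir fun k => hℓs.pd hγ.isOpen k
    rw [pd_congr (h := fun _ => 0) hγ.isOpen hx i
      fun y hy => (hγ.inner_eq hy n fun k => pd k ℓ).trans (h.grad_raise hγ hℓ hy), pd_const] at h1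
    exact h1.symm
  have hcn : ∀ i, c i = -(2 * ρ x + gradSq γ ℓ x) * n i x := by
    intro i
    have h1 := hder i
    have hh : ∀ k, hessian γ ℓ x i k = ρ x * (γ x i k - 3 * (n i x * n k x)) - c i * n k x
        - pd i ℓ x * pd k ℓ x := fun k => by
      have := hTc i k
      rw [(h.uniaxial x hx).eq] at this
      simp only [riccatiTensor, Matrix.of_apply] at this
      linarith
    simp only [a_eq, hh, Fin.sum_univ_three] at h1 hQ hunit hgrad
    have hN' := hNR i
    simp only [Fin.sum_univ_three] at hN'
    rw [hQ]
    linear_combination -h1 - (3 * ρ x * n i x + c i) * hunit - pd i ℓ x * hgrad + ρ x * hN'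
  rw [hTc, hcn]
  ring

end IsUniaxialOn

/-! Construction of the potential. -/

/-- The solution is `cosh` or `cos` according to the sign of `k`; the value 1 at the origin keeps
its logarithm defined nearby. -/
theorem exists_solution_linear (k : ℝ) : ∃ f f₁ : ℝ → ℝ, ContDiff ℝ ∞ f ∧ f 0 = 1 ∧
    (∀ t, HasDerivAt f (f₁ t) t) ∧ ∀ t, HasDerivAt f₁ (k * f t) t := by
  rcases le_or_gt 0 k with hk | hk
  · have hs : Real.sqrt k * Real.sqrt k = k := Real.mul_self_sqrt hk
    have hl : ∀ t, HasDerivAt (fun t => Real.sqrt k * t) (Real.sqrt k) t := fun t => by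
      simpa using (hasDerivAt_id t).const_mul (Real.sqrt k)
    refine ⟨fun t => Real.cosh (Real.sqrt k * t),
      fun t => Real.sqrt k * Real.sinh (Real.sqrt k * t),
      Real.contDiff_cosh.comp (contDiff_const.mul contDiff_id), by simp, fun t => ?_, fun t => ?_⟩
    · convert! (hl t).cosh using 1
      ring
    · convert! (hl t).sinh.const_mul (Real.sqrt k) using 1
      linear_combination -Real.cosh (Real.sqrt k * t) * hs
  · have hs : Real.sqrt (-k) * Real.sqrt (-k) = -k := Real.mul_self_sqrt (by linarith)
    have hl : ∀ t, HasDerivAt (fun t => Real.sqrt (-k) * t) (Real.sqrt (-k)) t := fun t => by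
      simpa using (hasDerivAt_id t).const_mul (Real.sqrt (-k))
    refine ⟨fun t => Real.cos (Real.sqrt (-k) * t),
      fun t => -Real.sqrt (-k) * Real.sin (Real.sqrt (-k) * t),
      Real.contDiff_cos.comp (contDiff_const.mul contDiff_id), by simp, fun t => ?_, fun t => ?_⟩
    · convert! (hl t).cos using 1
      ring
    · convert! (hl t).sin.const_mul (-Real.sqrt (-k)) using 1
      linear_combination Real.cos (Real.sqrt (-k) * t) * hs

/-- Local solutions of the Riccati equation `F'' + F'² = k`. -/
theorem exists_solution_riccati (k : ℝ) : ∃ F F₁ : ℝ → ℝ, ∃ V : Set ℝ, IsOpen V ∧ 0 ∈ V ∧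
    ContDiffOn ℝ ∞ F V ∧ (∀ t ∈ V, HasDerivAt F (F₁ t) t) ∧
      ∀ t ∈ V, HasDerivAt F₁ (k - F₁ t ^ 2) t := by
  obtain ⟨f, f₁, hf, hf0, h1, h2⟩ := exists_solution_linear k
  -- The substitution `F = log f` turns the Riccati equation into `f'' = k f`.
  refine ⟨fun t => Real.log (f t), fun t => f₁ t / f t, {t | f t ≠ 0},
    isOpen_ne_fun hf.continuous continuous_const, by simp [hf0], ?_, fun t ht => ?_, fun t ht => ?_⟩
  · exact hf.contDiffOn.log fun t ht => ht
  · exact (h1 t).log ht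
  · have ht' : f t ≠ 0 := ht
    convert! (h2 t).div (h1 t) ht using 1
    field_simp

/-- The Poincaré lemma for closed 1-forms, on a ball because that is convex. Normalising the
potential to vanish at the centre lets it be composed with a function known only near 0. -/
theorem exists_potential {m : ℕ} {θ : Fin m → (Fin m → ℝ) → ℝ} {x₀ : Fin m → ℝ} {r : ℝ}
    (hθ : ∀ i, ContDiffOn ℝ ∞ (θ i) (Metric.ball x₀ r))
    (hc : ∀ x ∈ Metric.ball x₀ r, ∀ i j, pd i (θ j) x = pd j (θ i) x) :
    ∃ σ : (Fin m → ℝ) → ℝ, ContDiffOn ℝ ∞ σ (Metric.ball x₀ r) ∧ σ x₀ = 0 ∧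
      ∀ x ∈ Metric.ball x₀ r, ∀ i, pd i σ x = θ i x := by
  set B := Metric.ball x₀ r
  set α : (Fin m → ℝ) → ((Fin m → ℝ) →L[ℝ] ℝ) := fun x =>
    ∑ i, θ i x • ContinuousLinearMap.proj (R := ℝ) (φ := fun _ : Fin m => ℝ) i with hα
  have hαs : ContDiffOn ℝ ∞ α B :=
    ContDiffOn.sum fun i _ => (hθ i).smul contDiffOn_const
  have hd : ∀ x ∈ B, ∀ v w, fderiv ℝ α x v w = ∑ i, ∑ j, v j * pd j (θ i) x * w i := by
    intro x hx v w
    have hdx : DifferentiableAt ℝ α x :=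
      (hαs.contDiffAt (Metric.isOpen_ball.mem_nhds hx)).differentiableAt (by simp)
    have h1 : fderiv ℝ (fun y => α y w) x v = fderiv ℝ α x v w := by
      rw [(hdx.hasFDerivAt.clm_apply (hasFDerivAt_const w x)).fderiv]
      simp
    have hdi := fun i => (hθ i).diffAt Metric.isOpen_ball hx
    have h2 : (fun y => α y w) = fun y => ∑ i, θ i y * w i := by
      funext y; simp [hα]
    rw [← h1, h2, fderiv_fun_sum fun i _ => (hdi i).mul_const (w i)]
    simp only [sum_apply]
    refine Finset.sum_congr rfl fun i _ => ?_
    rw [fderiv_mul_const (hdi i), ← Finset.sum_mul, ← fderiv_eq_sum_pd]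
    simp [mul_comm]
  obtain ⟨σ, hσ⟩ := (convex_ball x₀ r).exists_forall_hasFDerivAt_of_fderiv_symmetric
    Metric.isOpen_ball (hαs.differentiableOn (by simp)) fun x hx v w => by
      rw [hd x hx, hd x hx, Finset.sum_comm]
      refine Finset.sum_congr rfl fun i _ => Finset.sum_congr rfl fun j _ => ?_
      rw [hc x hx i j]
      ring
  refine ⟨fun x => σ x - σ x₀, ContDiffOn.sub ?_ contDiffOn_const, sub_self _, fun x hx i => ?_⟩
  · rw [contDiffOn_infty_iff_fderiv_of_isOpen Metric.isOpen_ball]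
    exact ⟨fun x hx => (hσ x hx).differentiableAt.differentiableWithinAt,
      hαs.congr fun x hx => (hσ x hx).fderiv⟩
  · rw [pd, ((hσ x hx).sub_const _).fderiv]
    simp [hα, Pi.single_apply]

theorem eq_of_pd_eq_zero {m : ℕ} {f : (Fin m → ℝ) → ℝ} {x₀ : Fin m → ℝ} {r : ℝ}
    (hf : ContDiffOn ℝ ∞ f (Metric.ball x₀ r))
    (h : ∀ x ∈ Metric.ball x₀ r, ∀ i, pd i f x = 0) {x : Fin m → ℝ}
    (hx : x ∈ Metric.ball x₀ r) : f x = f x₀ := by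
  have hx₀ : x₀ ∈ Metric.ball x₀ r := Metric.mem_ball_self (Metric.pos_of_mem_ball hx)
  refine Metric.isOpen_ball.is_const_of_fderiv_eq_zero (𝕜 := ℝ) (convex_ball x₀ r).isPreconnected
    (hf.differentiableOn (by simp)) (fun y hy => ?_) hx hx₀
  ext v
  rw [fderiv_eq_sum_pd]
  simp [h y hy]

theorem IsMetricOn.smooth_gradSq {γ : TensorField 3} {D : Set (Fin 3 → ℝ)} {f : (Fin 3 → ℝ) → ℝ}
    (hγ : IsMetricOn γ D) (hf : ContDiffOn ℝ ∞ f D) : ContDiffOn ℝ ∞ (gradSq γ f) D :=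
  hγ.smooth_inner (fun k => hf.pd hγ.isOpen k) fun k => hf.pd hγ.isOpen k

/-! ### Sufficiency: from the criterion to a vacuum potential. -/

namespace IsUniaxialOn

variable {γ : TensorField 3} {D : Set (Fin 3 → ℝ)} {x : Fin 3 → ℝ}
  {ρ ℓ : (Fin 3 → ℝ) → ℝ} {n : Fin 3 → (Fin 3 → ℝ) → ℝ}

variable (hγ : IsMetricOn γ D) (h : IsUniaxialOn γ D ρ n) (hℓs : ContDiffOn ℝ ∞ ℓ D)
  (hℓ : ∀ x ∈ D, ∀ i, pd i ρ x = -3 * ρ x * pd i ℓ x)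
  (hT : ∀ x ∈ D, ∀ i j, riccatiTensor γ ℓ x i j
    = ricci γ x i j + (2 * ρ x + gradSq γ ℓ x) * (n i x * n j x))
include hγ h hℓs hℓ hT

/-- By the criterion `∇dℓ = ρ γ - (ρ - Q) n ⊗ n - dℓ ⊗ dℓ`. Contract with the gradient of `ℓ`, to
which `n` is orthogonal. -/
theorem pd_gradSq (hx : x ∈ D) (i : Fin 3) :
    pd i (gradSq γ ℓ) x = 2 * (ρ x - gradSq γ ℓ x) * pd i ℓ x := by
  have h1 := hγ.pd_inner' hx i (fun k => hℓs.pd hγ.isOpen k) fun k => hℓs.pd hγ.isOpen k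
  have hQ : gradSq γ ℓ x = ∑ k, pd k ℓ x * raise γ (fun k => pd k ℓ) x k :=
    hγ.inner_eq hx (fun k => pd k ℓ) fun k => pd k ℓ
  have hg := h.grad_raise hγ hℓ hx
  have hn : ∑ k, n k x * raise γ (fun k => pd k ℓ) x k = 0 := by
    rw [← hg, ← hγ.inner_eq hx n fun k => pd k ℓ, ← hγ.inner_eq hx (fun k => pd k ℓ) n,
      Finset.sum_comm]
    exact Finset.sum_congr rfl fun j _ => Finset.sum_congr rfl fun k _ => by
      rw [hγ.inv_symm hx]; ring
  have hw := hγ.metric_raise hx (fun k => pd k ℓ) i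
  have hh : ∀ k, covDeriv γ (fun k => pd k ℓ) i k x
      = ρ x * γ x i k - (ρ x - gradSq γ ℓ x) * (n i x * n k x) - pd i ℓ x * pd k ℓ x := fun k => by
    have := hT x hx i k
    rw [(h.uniaxial x hx).eq] at this
    have e : riccatiTensor γ ℓ x i k = covDeriv γ (fun k => pd k ℓ) i k x + pd i ℓ x * pd k ℓ x :=
      rfl
    rw [e] at this
    linarith
  have h2 : pd i (gradSq γ ℓ) x = 2 * ∑ k, covDeriv γ (fun k => pd k ℓ) i k x *
      raise γ (fun k => pd k ℓ) x k := by rw [two_mul]; exact h1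
  rw [h2]
  simp only [hh, Fin.sum_univ_three] at hQ hn hw ⊢
  linear_combination 2 * ρ x * hw - 2 * (ρ x - gradSq γ ℓ x) * n i x * hn + 2 * pd i ℓ x * hQ

/-- In the Ricci identity for `ℓ` everything carries the factor `ρ - Q`, the coefficient of `n ⊗ n`,
so it says something about `∇n` only where that factor is non-zero. -/
theorem covDeriv_eq_of_ne (hx : x ∈ D) (hμ : ρ x - gradSq γ ℓ x ≠ 0) (i j : Fin 3) :
    covDeriv γ n i j x = -(n i x * pd j ℓ x) := by
  have hQs := hγ.smooth_gradSq hℓs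
  have hE := hγ.extCovDeriv_riccatiTensor_of_three hx (h.metricTrace_eq hγ hx) hℓs
    (v := raise γ (fun k => pd k ℓ) x) fun a => rfl
  have hC := hγ.extCovDeriv_smul_sub hx (μ := fun y => ρ y - gradSq γ ℓ y) h.smooth_eig
    (h.smooth_eig.sub hQs) h.smooth_dir (h := riccatiTensor γ ℓ) fun y hy i j => by
      rw [hT y hy, (h.uniaxial y hy).eq]; ring
  have hp : ∀ i, pd i (fun y => ρ y - gradSq γ ℓ y) x
      = (-3 * ρ x - 2 * (ρ x - gradSq γ ℓ x)) * pd i ℓ x := fun i => by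
    rw [pd_sub i (h.smooth_eig.diffAt hγ.isOpen hx) (hQs.diffAt hγ.isOpen hx), hℓ x hx,
      h.pd_gradSq hγ hℓs hℓ hT hx]
    ring
  refine integrability_of_criterion (a := Matrix.of fun i j => covDeriv γ n i j x)
    (n := fun i => n i x) (N := raise γ n x) (w := fun i => pd i ℓ x) hμ (h.unit hγ hx)
    (h.covDeriv_raise hγ hx) (h.grad_raise hγ hℓ hx) (fun i j k => ?_) i j
  have := hE i j k
  rw [hC i j k, h.ricci_raise hγ hx, h.ricci_raise hγ hx, h.grad_raise hγ hℓ hx] at this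
  simp only [hp, hℓ x hx, hT x hx, (h.uniaxial x hx).eq] at this
  simp only [Matrix.of_apply]
  rw [← this]
  ring

/-- The formula fails on an open set, on which `ρ = Q` identically. Differentiating this equality
there gives `ρ dℓ = 0`, hence `Q = 0` and `ρ = 0`, a contradiction. -/
theorem covDeriv_eq (hx : x ∈ D) (i j : Fin 3) :
    covDeriv γ n i j x = -(n i x * pd j ℓ x) := by
  have hQs := hγ.smooth_gradSq hℓs
  by_contra hne
  have hcont : ContDiffOn ℝ ∞ (fun y => covDeriv γ n i j y + n i y * pd j ℓ y) D :=
    (((h.smooth_dir j).pd hγ.isOpen i).sub (ContDiffOn.sum fun k _ =>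
      (hγ.smooth_christoffel k i j).mul (h.smooth_dir k))).add
      ((h.smooth_dir i).mul (hℓs.pd hγ.isOpen j))
  set V := D ∩ {y | covDeriv γ n i j y + n i y * pd j ℓ y ≠ 0} with hV
  have hVo : IsOpen V := hcont.continuousOn.isOpen_inter_preimage hγ.isOpen isOpen_ne
  have hxV : x ∈ V := ⟨hx, fun h0 => hne (by linarith)⟩
  have hzero : ∀ y ∈ V, ρ y - gradSq γ ℓ y = 0 := by
    intro y hy
    by_contra hμ
    refine hy.2 ?_
    rw [h.covDeriv_eq_of_ne hγ hℓs hℓ hT hy.1 hμ]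
    ring
  have hw : ∀ i, pd i ℓ x = 0 := by
    intro i
    have h1 : pd i (fun y => ρ y - gradSq γ ℓ y) x = 0 := by
      rw [pd_congr (h := fun _ => 0) hVo hxV i hzero, pd_const]
    rw [pd_sub i (h.smooth_eig.diffAt hγ.isOpen hx) (hQs.diffAt hγ.isOpen hx), hℓ x hx,
      h.pd_gradSq hγ hℓs hℓ hT hx, hzero x hxV] at h1
    have h2 : ρ x * pd i ℓ x = 0 := by linarith
    exact (mul_eq_zero.1 h2).resolve_left (h.ne_zero x hx)
  have hQ0 : gradSq γ ℓ x = 0 := by simp [gradSq, hw]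
  have := hzero x hxV
  rw [hQ0, sub_zero] at this
  exact h.ne_zero x hx this

/-- The vacuum equations can be solved locally. -/
theorem exists_vacuum_potential {x₀ : Fin 3 → ℝ} (hx₀ : x₀ ∈ D) :
    ∃ (N : Set (Fin 3 → ℝ)) (U : (Fin 3 → ℝ) → ℝ), IsOpen N ∧ x₀ ∈ N ∧ N ⊆ D ∧
      ContDiffOn ℝ ∞ U N ∧ ∀ x ∈ N, riccatiTensor γ U x = ricci γ x := by
  obtain ⟨r, hr, hB⟩ := Metric.isOpen_iff.1 hγ.isOpen x₀ hx₀
  set B := Metric.ball x₀ r with hBd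
  have hBo : IsOpen B := Metric.isOpen_ball
  have hQs := hγ.smooth_gradSq hℓs
  have dℓ := fun y (hy : y ∈ B) => hℓs.diffAt hγ.isOpen (hB hy)
  have dn := fun y (hy : y ∈ B) j => (h.smooth_dir j).diffAt hγ.isOpen (hB hy)
  have hexp : ∀ c : ℝ, ∀ y ∈ B, ∀ i, pd i (fun z => Real.exp (c * ℓ z)) y
      = c * Real.exp (c * ℓ y) * pd i ℓ y := by
    intro c y hy i
    have hd : HasDerivAt (fun t => Real.exp (c * t)) (c * Real.exp (c * ℓ y)) (ℓ y) := by
      convert! ((hasDerivAt_id (ℓ y)).const_mul c).exp using 1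
      simp only [id, mul_one]
      ring
    exact pd_comp i hd (dℓ y hy)
  have sexp : ∀ c : ℝ, ContDiffOn ℝ ∞ (fun z => Real.exp (c * ℓ z)) D := fun c =>
    Real.contDiff_exp.comp_contDiffOn (contDiffOn_const.mul hℓs)
  -- The factor `e^{-ℓ}` makes `∇θ = -(θ ⊗ dℓ + dℓ ⊗ θ)` symmetric, so `θ` is closed.
  set θ : Fin 3 → (Fin 3 → ℝ) → ℝ := fun i y => Real.exp (-1 * ℓ y) * n i y with hθ
  have hθs : ∀ i, ContDiffOn ℝ ∞ (θ i) D := fun i => (sexp (-1)).mul (h.smooth_dir i)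
  have hpθ : ∀ y ∈ B, ∀ i j, pd i (θ j) y = -(θ i y * pd j ℓ y + θ j y * pd i ℓ y)
      + ∑ k, christoffel γ k i j y * θ k y := by
    intro y hy i j
    have h1 : pd i (θ j) y = -1 * Real.exp (-1 * ℓ y) * pd i ℓ y * n j y
        + Real.exp (-1 * ℓ y) * pd i (n j) y := by
      rw [← hexp (-1) y hy i]
      exact pd_mul i ((sexp (-1)).diffAt hγ.isOpen (hB hy)) (dn y hy j)
    have h2 : pd i (n j) y = -(n i y * pd j ℓ y) + ∑ k, christoffel γ k i j y * n k y := by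
      rw [← h.covDeriv_eq hγ hℓs hℓ hT (hB hy) i j]; simp [covDeriv]
    have h3 : ∑ k, christoffel γ k i j y * θ k y
        = Real.exp (-1 * ℓ y) * ∑ k, christoffel γ k i j y * n k y := by
      rw [Finset.mul_sum]
      exact Finset.sum_congr rfl fun k _ => by simp only [hθ]; ring
    rw [h1, h2, h3]
    simp only [hθ]
    ring
  obtain ⟨σ, hσs, hσ0, hσ⟩ := exists_potential (fun i => (hθs i).mono hB) fun y hy i j => by
    rw [hpθ y hy, hpθ y hy]
    simp only [hγ.christoffel_symm (hB hy) _ i j]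
    ring
  -- For `U = ℓ + F(σ)` the mixed terms in `θ` and `dℓ` cancel against `F' ∇θ`, and the vacuum
  -- equation becomes `F'' + F'² = K`. It is solvable as an ordinary equation because `K` is
  -- constant: `d(2ρ + Q) = -2(2ρ + Q) dℓ`.
  set K : (Fin 3 → ℝ) → ℝ := fun y => (-2 * ρ y - gradSq γ ℓ y) * Real.exp (2 * ℓ y) with hK
  have hKs : ContDiffOn ℝ ∞ K D := ((contDiffOn_const.mul h.smooth_eig).sub hQs).mul (sexp 2)
  have hK0 : ∀ y ∈ B, ∀ i, pd i K y = 0 := by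
    intro y hy i
    have dρ := h.smooth_eig.diffAt hγ.isOpen (hB hy)
    have dQ := hQs.diffAt hγ.isOpen (hB hy)
    rw [hK, pd_mul i ((dρ.const_mul (-2)).fun_sub dQ) ((sexp 2).diffAt hγ.isOpen (hB hy)),
      pd_sub i (dρ.const_mul (-2)) dQ, pd_const_mul i (-2) dρ, hexp 2 y hy, hℓ y (hB hy),
      h.pd_gradSq hγ hℓs hℓ hT (hB hy)]
    ring
  obtain ⟨F, F₁, V, hVo, hV0, hFs, hF, hF₁⟩ := exists_solution_riccati (K x₀)
  have hNo : IsOpen (B ∩ σ ⁻¹' V) := hσs.continuousOn.isOpen_inter_preimage hBo hVo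
  refine ⟨B ∩ σ ⁻¹' V, fun y => ℓ y + F (σ y), hNo,
    ⟨Metric.mem_ball_self hr, by simpa [hσ0] using hV0⟩, fun y hy => hB hy.1, ?_, fun x hx => ?_⟩
  · exact (hℓs.mono fun y hy => hB hy.1).add
      (hFs.comp (hσs.mono Set.inter_subset_left) fun y hy => hy.2)
  have hpU : ∀ y ∈ B ∩ σ ⁻¹' V, ∀ i, pd i (fun y => ℓ y + F (σ y)) y
      = pd i ℓ y + F₁ (σ y) * θ i y := by
    intro y hy i
    have dσ := hσs.diffAt hBo hy.1
    have hdF := hF (σ y) hy.2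
    have dF : DifferentiableAt ℝ (fun y => F (σ y)) y := hdF.differentiableAt.comp y dσ
    rw [pd_add i (dℓ y hy.1) dF, pd_comp i hdF dσ, hσ y hy.1]
  have hppU : ∀ i j, pd i (pd j fun y => ℓ y + F (σ y)) x = pd i (pd j ℓ) x
      + ((K x₀ - F₁ (σ x) ^ 2) * θ i x * θ j x + F₁ (σ x) * pd i (θ j) x) := by
    intro i j
    have dσ := hσs.diffAt hBo hx.1
    have hdF := hF₁ (σ x) hx.2
    have dF : DifferentiableAt ℝ (fun y => F₁ (σ y)) x := hdF.differentiableAt.comp x dσ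
    have dθ := (hθs j).diffAt hγ.isOpen (hB hx.1)
    rw [pd_congr hNo hx i fun y hy => hpU y hy j,
      pd_add i ((hℓs.pd hγ.isOpen j).diffAt hγ.isOpen (hB hx.1)) (dF.fun_mul dθ),
      pd_mul i dF dθ, pd_comp i hdF dσ, hσ x hx.1]
  have hKx : K x₀ * Real.exp (-1 * ℓ x) * Real.exp (-1 * ℓ x) = -2 * ρ x - gradSq γ ℓ x := by
    rw [← eq_of_pd_eq_zero (hKs.mono hB) hK0 hx.1, hK]
    have : Real.exp (2 * ℓ x) * Real.exp (-1 * ℓ x) * Real.exp (-1 * ℓ x) = 1 := by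
      have e : 2 * ℓ x + -1 * ℓ x + -1 * ℓ x = 0 := by ring
      rw [← Real.exp_add, ← Real.exp_add, e, Real.exp_zero]
    linear_combination (-2 * ρ x - gradSq γ ℓ x) * this
  ext i j
  have hTx := hT x (hB hx.1) i j
  simp only [riccatiTensor, hessian, Matrix.of_apply] at hTx ⊢
  have hΓ : ∑ k, christoffel γ k i j x * pd k (fun y => ℓ y + F (σ y)) x
      = ∑ k, christoffel γ k i j x * pd k ℓ x
        + F₁ (σ x) * ∑ k, christoffel γ k i j x * θ k x := by
    rw [Finset.mul_sum, ← Finset.sum_add_distrib]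
    exact Finset.sum_congr rfl fun k _ => by rw [hpU x hx]; ring
  rw [hppU, hΓ, hpU x hx, hpU x hx, hpθ x hx.1]
  have hθθ : K x₀ * θ i x * θ j x = (-2 * ρ x - gradSq γ ℓ x) * (n i x * n j x) := by
    rw [← hKx]; simp only [hθ]; ring
  linear_combination hTx + hθθ

end IsUniaxialOn

/-! The criterion in terms of the concomitants of the metric. -/

section Concomitants

variable {γ : TensorField 3} {D : Set (Fin 3 → ℝ)} {x : Fin 3 → ℝ}

theorem hessian_const_mul_exp {ℓ : (Fin 3 → ℝ) → ℝ} (hD : IsOpen D) (hℓ : ContDiffOn ℝ ∞ ℓ D)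
    (c : ℝ) (hx : x ∈ D) (i j : Fin 3) :
    hessian γ (fun y => c * Real.exp (ℓ y)) x i j
      = c * Real.exp (ℓ x) * riccatiTensor γ ℓ x i j := by
  have hp : ∀ y ∈ D, ∀ k, pd k (fun y => c * Real.exp (ℓ y)) y
      = c * (Real.exp (ℓ y) * pd k ℓ y) := fun y hy k => by
    have dℓ := hℓ.diffAt hD hy
    rw [pd_const_mul k c dℓ.exp, pd_comp k (Real.hasDerivAt_exp _) dℓ]
  have hpp : pd i (pd j fun y => c * Real.exp (ℓ y)) x
      = c * (Real.exp (ℓ x) * pd i ℓ x * pd j ℓ x + Real.exp (ℓ x) * pd i (pd j ℓ) x) := by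
    have dℓ := hℓ.diffAt hD hx
    have dp := (hℓ.pd hD j).diffAt hD hx
    rw [pd_congr hD hx i fun y hy => hp y hy j, pd_const_mul i c (dℓ.exp.fun_mul dp),
      pd_mul i dℓ.exp dp, pd_comp i (Real.hasDerivAt_exp _) dℓ]
  simp only [riccatiTensor, hessian, Matrix.of_apply, hpp, hp x hx, Fin.sum_univ_three]
  ring

theorem hessian_congr {f f' : (Fin 3 → ℝ) → ℝ} (hD : IsOpen D) (hx : x ∈ D)
    (h : ∀ y ∈ D, f y = f' y) : hessian γ f x = hessian γ f' x := by
  ext i j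
  simp only [hessian, Matrix.of_apply, fun k => pd_congr hD hx k h]
  rw [pd_congr hD hx i fun y hy => pd_congr hD hy j h]

theorem cbrt_eq {y : ℝ} (hy : y ≠ 0) :
    cbrt y = (SignType.sign y : ℝ) * Real.exp (1 / 3 * Real.log y) := by
  rw [cbrt, Real.rpow_def_of_pos (abs_pos.2 hy), Real.log_abs, mul_comm (Real.log y)]

/-- `log |Ω| / 3`. -/
noncomputable def logOmega (γ : TensorField 3) (x : Fin 3 → ℝ) : ℝ := 1 / 3 * Real.log (Omega γ x)

section

variable (hD : IsOpen D) (hs : ContDiffOn ℝ ∞ (Omega γ) D) (h0 : ∀ y ∈ D, Omega γ y ≠ 0)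
include hs h0

theorem smooth_logOmega : ContDiffOn ℝ ∞ (logOmega γ) D := contDiffOn_const.mul (hs.log h0)

include hD

theorem pd_omega_eq (hx : x ∈ D) (i : Fin 3) :
    pd i (Omega γ) x = 3 * Omega γ x * pd i (logOmega γ) x := by
  have dΩ := hs.diffAt hD hx
  have h := h0 x hx
  change _ = _ * pd i (fun y => 1 / 3 * Real.log (Omega γ y)) x
  rw [pd_const_mul i _ (dΩ.log h), pd_comp i (Real.hasDerivAt_log h) dΩ]
  field_simp

/-- Near a point `Ω` keeps its sign `c`, so its cube root is `c e^ℓ` there; the Hessian of an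
exponential produces `∇dℓ + dℓ ⊗ dℓ`, and the sign drops out of the quotient. -/
theorem hessian_cbrt_omega (hx : x ∈ D) (i j : Fin 3) :
    (cbrt (Omega γ x))⁻¹ * hessian γ (fun y => cbrt (Omega γ y)) x i j
      = riccatiTensor γ (logOmega γ) x i j := by
  obtain ⟨c, hc, hcx, hcV⟩ : ∃ c : ℝ, c ≠ 0 ∧ 0 < c * Omega γ x ∧
      ∀ y, 0 < c * y → (SignType.sign y : ℝ) = c := by
    rcases lt_or_gt_of_ne (h0 x hx) with h | h
    · refine ⟨-1, by norm_num, by linarith, fun y hy => ?_⟩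
      rw [sign_neg (by linarith)]; simp
    · refine ⟨1, by norm_num, by linarith, fun y hy => ?_⟩
      rw [sign_pos (by linarith)]; simp
  set V := D ∩ (fun y => c * Omega γ y) ⁻¹' Set.Ioi 0
  have hV : IsOpen V :=
    (contDiffOn_const.mul hs).continuousOn.isOpen_inter_preimage hD isOpen_Ioi
  have hxV : x ∈ V := ⟨hx, hcx⟩
  have he : ∀ y ∈ V, cbrt (Omega γ y) = c * Real.exp (logOmega γ y) := fun y hy => by
    rw [cbrt_eq (h0 y hy.1), hcV _ hy.2, logOmega]
  rw [hessian_congr hV hxV he, he x hxV, hessian_const_mul_exp hV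
    ((smooth_logOmega hs h0).mono Set.inter_subset_left) c hxV,
    inv_mul_cancel_left₀ (mul_ne_zero hc (Real.exp_ne_zero _))]

theorem gradSq_omega (hx : x ∈ D) :
    gradSq γ (Omega γ) x = 9 * Omega γ x ^ 2 * gradSq γ (logOmega γ) x := by
  simp only [gradSq, pd_omega_eq hD hs h0 hx, Finset.mul_sum]
  exact Finset.sum_congr rfl fun i _ => Finset.sum_congr rfl fun j _ => by ring

end

namespace IsUniaxialOn

variable {n : Fin 3 → (Fin 3 → ℝ) → ℝ} (hγ : IsMetricOn γ D)
  (h : IsUniaxialOn γ D (doubleEig γ) n)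
include hγ h

theorem omega_eq (hx : x ∈ D) : Omega γ x = (18 * doubleEig γ x)⁻¹ :=
  (h.uniaxial x hx).omega_eq (hγ.det x hx) (h.ne_zero x hx)

theorem omega_ne_zero (hx : x ∈ D) : Omega γ x ≠ 0 := by
  rw [h.omega_eq hγ hx]
  exact inv_ne_zero (mul_ne_zero (by norm_num) (h.ne_zero x hx))

theorem smooth_omega : ContDiffOn ℝ ∞ (Omega γ) D :=
  ((contDiffOn_const.mul h.smooth_eig).inv fun x hx =>
    mul_ne_zero (by norm_num : (18 : ℝ) ≠ 0) (h.ne_zero x hx)).congr fun x hx => h.omega_eq hγ hx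

theorem pd_eig_eq (hx : x ∈ D) (i : Fin 3) :
    pd i (doubleEig γ) x = -3 * doubleEig γ x * pd i (logOmega γ) x := by
  have hΩ := h.omega_ne_zero hγ hx
  have dΩ := (h.smooth_omega hγ).diffAt hγ.isOpen hx
  have hρ : ∀ y ∈ D, doubleEig γ y = 1 / 18 * (Omega γ y)⁻¹ := fun y hy => by
    rw [h.omega_eq hγ hy, inv_inv]; ring
  rw [pd_congr hγ.isOpen hx i hρ, pd_const_mul i _ (dΩ.fun_inv hΩ),
    pd_comp i (hasDerivAt_inv hΩ) dΩ,
    pd_omega_eq hγ.isOpen (h.smooth_omega hγ) (fun y => h.omega_ne_zero hγ) hx, hρ x hx]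
  field_simp

/-- With `Ω = 1/(18ρ)`, `dΩ = 3Ω dℓ` and `P = 18ρ² n ⊗ n`, the coefficient of `n ⊗ n` in `2[Ω +
(dΩ)²] P` is `2ρ + (dℓ)²`. -/
theorem criterion_iff (hx : x ∈ D) :
    ricci γ x = (cbrt (Omega γ x))⁻¹ • hessian γ (fun y => cbrt (Omega γ y)) x
        - (2 * (Omega γ x + gradSq γ (Omega γ) x)) • PTensor γ x ↔
      ∀ i j, riccatiTensor γ (logOmega γ) x i j = ricci γ x i j
        + (2 * doubleEig γ x + gradSq γ (logOmega γ) x) * (n i x * n j x) := by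
  have hs := h.smooth_omega hγ
  have h0 := fun y (hy : y ∈ D) => h.omega_ne_zero hγ hy
  have hP : ∀ i j, 2 * (Omega γ x + gradSq γ (Omega γ) x) * PTensor γ x i j
      = (2 * doubleEig γ x + gradSq γ (logOmega γ) x) * (n i x * n j x) := fun i j => by
    have := h.ne_zero x hx
    rw [gradSq_omega hγ.isOpen hs h0 hx, (h.uniaxial x hx).PTensor_eq (hγ.det x hx),
      h.omega_eq hγ hx]
    field_simp
    ring
  rw [← Matrix.ext_iff]
  refine forall_congr' fun i => forall_congr' fun j => ?_
  simp only [Matrix.sub_apply, Matrix.smul_apply, smul_eq_mul, hP,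
    hessian_cbrt_omega hγ.isOpen hs h0 hx]
  exact ⟨fun e => by linarith, fun e => by linarith⟩

end IsUniaxialOn

/-- The condition `P(ds) = 0` says that the double eigenvalue has zero derivative in the simple
eigendirection. -/
theorem contractGrad_eq_zero_iff (hγ : IsMetricOn γ D)
    (h : ∀ y ∈ D, doubleEig γ y ≠ 0 ∧ ∃ n, IsUniaxial (γ y) (ricci γ y) (doubleEig γ y) n)
    (hx : x ∈ D) {n : Fin 3 → ℝ} (hn : IsUniaxial (γ x) (ricci γ x) (doubleEig γ x) n) :
    contractGrad γ (PTensor γ) (sInv γ) x = 0 ↔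
      ∑ j, ∑ k, (γ x)⁻¹ j k * n j * pd k (doubleEig γ) x = 0 := by
  have hs : ∀ y ∈ D, sInv γ y = 6 * (doubleEig γ y ^ 2) := fun y hy => by
    obtain ⟨-, n, hn⟩ := h y hy
    exact hn.sInv_eq (hγ.det y hy)
  have hs0 : ∀ y ∈ D, sInv γ y ≠ 0 := fun y hy => by
    rw [hs y hy]
    exact mul_ne_zero (by norm_num) (pow_ne_zero 2 (h y hy).1)
  have dρ : DifferentiableAt ℝ (doubleEig γ) x :=
    (show ContDiffOn ℝ ∞ (doubleEig γ) D from
      hγ.smooth_tInv.neg.div hγ.smooth_sInv hs0).diffAt hγ.isOpen hx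
  have hρ := (h x hx).1
  have hp : ∀ k, pd k (sInv γ) x = 12 * doubleEig γ x * pd k (doubleEig γ) x := fun k => by
    rw [pd_congr hγ.isOpen hx k hs, pd_const_mul k _ (dρ.fun_pow 2),
      pd_comp k (hasDerivAt_pow 2 _) dρ]
    norm_num
    ring
  -- From `P = 18ρ² n ⊗ n` and `ds = 12ρ dρ`.
  have hc : ∀ i, contractGrad γ (PTensor γ) (sInv γ) x i = 216 * doubleEig γ x ^ 3 * n i *
      ∑ j, ∑ k, (γ x)⁻¹ j k * n j * pd k (doubleEig γ) x := fun i => by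
    simp only [contractGrad, hp, hn.PTensor_eq (hγ.det x hx), Finset.mul_sum]
    exact Finset.sum_congr rfl fun j _ => Finset.sum_congr rfl fun k _ => by ring
  refine ⟨fun h0 => ?_, fun h0 => ?_⟩
  · obtain ⟨i, hi⟩ : ∃ i, n i ≠ 0 := by
      by_contra! hc
      have := hn.unit
      simp [hc] at this
    have := (hc i).symm.trans (congrFun h0 i)
    exact (mul_eq_zero.1 this).resolve_left
      (mul_ne_zero (mul_ne_zero (by norm_num) (pow_ne_zero 3 hρ)) hi)
  · ext i
    rw [hc, h0, mul_zero, Pi.zero_apply]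

end Concomitants

/-! ### Passage between space-time and space, and the two implications. -/

section Main

variable {γ : TensorField 3} {D N : Set (Fin 3 → ℝ)} {x : Fin 3 → ℝ}

theorem fderiv_ofReal_tail {f : (Fin 3 → ℝ) → ℝ} {y : Fin 4 → ℝ}
    (hf : DifferentiableAt ℝ f (Fin.tail y)) (v : Fin 4 → ℝ) :
    fderiv ℝ (fun z : Fin 4 → ℝ => (f (Fin.tail z) : ℂ)) y v
      = (fderiv ℝ f (Fin.tail y) (Fin.tail v) : ℂ) := by
  have ht : DifferentiableAt ℝ (fun z : Fin 4 → ℝ => f (Fin.tail z)) y :=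
    hf.comp y (contDiff_tail.differentiable (by simp) y)
  have := (Complex.ofRealCLM.hasFDerivAt.comp y ht.hasFDerivAt).fderiv
  rw [← fderiv_tail f hf, show (fun z : Fin 4 → ℝ => (f (Fin.tail z) : ℂ))
    = Complex.ofRealCLM ∘ fun z : Fin 4 → ℝ => f (Fin.tail z) from rfl, this]
  rfl

theorem IsMetricOn.sum_inv_mul_pd (hγ : IsMetricOn γ D) (hx : x ∈ D) {n v : Fin 3 → ℝ}
    (hn : ((γ x)⁻¹).mulVec n = v) (f : (Fin 3 → ℝ) → ℝ) :
    ∑ j, ∑ k, (γ x)⁻¹ j k * n j * pd k f x = fderiv ℝ f x v := by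
  rw [fderiv_eq_sum_pd, ← hn, Finset.sum_comm]
  refine Finset.sum_congr rfl fun k _ => ?_
  rw [Matrix.mulVec, dotProduct, Finset.sum_mul]
  exact Finset.sum_congr rfl fun j _ => by rw [hγ.inv_symm hx j k]

/-- On the cylinder the Weyl eigenvalue coincides with the pullback of `-t/s`, so it is independent
of `T`. Its derivative along the simple Ricci eigenvector vanishes because that vector lies in the
time-like principal plane. -/
theorem uniaxial_of_typeB {U : (Fin 3 → ℝ) → ℝ} (hγ : IsMetricOn γ N)
    (hpos : ∀ x ∈ N, (γ x).PosDef) (hU : ContDiffOn ℝ ∞ U N)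
    (hric : ∀ y ∈ cylinder N, ricci (staticMetric γ U) y = 0)
    (hB : IsTypeBOn (staticMetric γ U) (cylinder N)) :
    ∀ x ∈ N, ∃ (ρ : ℝ) (n : Fin 3 → ℝ), ρ ≠ 0 ∧ IsUniaxial (γ x) (ricci γ x) ρ n ∧
      ∑ j, ∑ k, (γ x)⁻¹ j k * n j * pd k (doubleEig γ) x = 0 := by
  obtain ⟨ρ, hρs, hB⟩ := hB
  have key : ∀ y ∈ cylinder N, ∃ v : Fin 3 → ℝ, doubleEig γ (Fin.tail y) ≠ 0 ∧
      ρ y = doubleEig γ (Fin.tail y) ∧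
      IsUniaxial (γ (Fin.tail y)) (ricci γ (Fin.tail y)) (doubleEig γ (Fin.tail y))
        ((γ (Fin.tail y)).mulVec v) ∧
      ((γ (Fin.tail y))⁻¹).mulVec ((γ (Fin.tail y)).mulVec v) = v ∧
      fderiv ℝ ρ y (Fin.cons 0 v) = 0 := by
    intro y hy
    obtain ⟨u, hu, h0, h1⟩ := hB y hy
    obtain ⟨e, he⟩ := exists_orthonormal (hpos _ hy)
    obtain ⟨r, v, hr, hv, hR, a, b, hab⟩ := ricci_of_isTypeDFrame hγ hU hy (hric y hy) he hu
    obtain ⟨hun, hinv⟩ :=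
      IsUniaxial.of_vector (hγ.det _ hy) (hγ.transpose hy) hv hR
    have hr0 : r ≠ 0 := fun h => hu.2.1 (by rw [hr, h, Complex.ofReal_zero])
    have hd := hun.doubleEig_eq (hγ.det _ hy) hr0
    refine ⟨v, by rwa [hd], by rw [hd, hr], by rwa [hd], hinv, ?_⟩
    rw [hab, map_add, map_smul, map_smul, h0, h1, smul_zero, smul_zero, add_zero]
  intro x hx
  have hy : (Fin.cons 0 x : Fin 4 → ℝ) ∈ cylinder N := by simpa [cylinder] using hx
  obtain ⟨v, hne, -, hun, hinv, hdv⟩ := key _ hy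
  rw [Fin.tail_cons] at hne hun hinv
  refine ⟨_, _, hne, hun, ?_⟩
  have hs0 : ∀ z ∈ N, sInv γ z ≠ 0 := fun z hz h => by
    obtain ⟨-, hz0, -⟩ := key (Fin.cons 0 z) (by simpa [cylinder] using hz)
    exact hz0 (by rw [Fin.tail_cons, doubleEig, h, div_zero])
  have dρ : DifferentiableAt ℝ (doubleEig γ) x :=
    (show ContDiffOn ℝ ∞ (doubleEig γ) N from
      hγ.smooth_tInv.neg.div hγ.smooth_sInv hs0).diffAt hγ.isOpen hx
  rw [hγ.sum_inv_mul_pd hx hinv]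
  have hev : ρ =ᶠ[nhds (Fin.cons 0 x)] fun z => (doubleEig γ (Fin.tail z) : ℂ) :=
    Filter.eventuallyEq_of_mem ((isOpen_cylinder hγ.isOpen).mem_nhds hy) fun z hz =>
      (key z hz).choose_spec.2.1
  rw [hev.fderiv_eq, fderiv_ofReal_tail (by rwa [Fin.tail_cons]), Fin.tail_cons,
    Fin.tail_cons] at hdv
  exact_mod_cast hdv

theorem criterion_of_bMetric (hγ : IsMetricOn γ N) (hpos : ∀ x ∈ N, (γ x).PosDef)
    {U : (Fin 3 → ℝ) → ℝ} (hU : ContDiffOn ℝ ∞ U N)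
    (hric : ∀ y ∈ cylinder N, ricci (staticMetric γ U) y = 0)
    (hB : IsTypeBOn (staticMetric γ U) (cylinder N)) (hx : x ∈ N) :
    metricTrace γ (ricci γ) x = 0 ∧ 6 * tInv γ x ^ 2 = sInv γ x ^ 3 ∧
      contractGrad γ (PTensor γ) (sInv γ) x = 0 ∧ tInv γ x ≠ 0 ∧
      ricci γ x = (cbrt (Omega γ x))⁻¹ • hessian γ (fun y => cbrt (Omega γ y)) x
        - (2 * (Omega γ x + gradSq γ (Omega γ) x)) • PTensor γ x := by
  obtain ⟨M, n, hMo, hxM, hMN, h⟩ :=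
    exists_isUniaxialOn hγ (uniaxial_of_typeB hγ hpos hU hric hB) hx
  have hγ' := hγ.mono hMo hMN
  have hs := h.smooth_omega hγ'
  have h0 := fun y (hy : y ∈ M) => h.omega_ne_zero hγ' hy
  have hux := h.uniaxial x hxM
  have hdx := hγ.det x hx
  refine ⟨hux.metricTrace_eq hdx, ?_, ?_, ?_, ?_⟩
  · rw [hux.sInv_eq hdx, hux.tInv_eq hdx]; ring
  · exact (contractGrad_eq_zero_iff hγ' (fun y hy => ⟨h.ne_zero y hy, _, h.uniaxial y hy⟩)
      hxM hux).2 (h.grad x hxM)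
  · rw [hux.tInv_eq hdx]
    exact mul_ne_zero (by norm_num) (pow_ne_zero 3 (h.ne_zero x hxM))
  · refine (h.criterion_iff hγ' hxM).2 fun i j => ?_
    refine h.hessian_of_vacuum hγ' (smooth_logOmega hs h0) (fun y hy i => h.pd_eig_eq hγ' hy i)
      (hU.mono hMN) (fun y hy => ?_) hxM i j
    have hy' : (Fin.cons 0 y : Fin 4 → ℝ) ∈ cylinder N := by simpa [cylinder] using hMN hy
    simpa using ((static_ricci_eq_zero_iff hγ hU hy').1 (hric _ hy')).1

theorem bMetric_of_criterion (hγ : IsMetricOn γ D) (hpos : ∀ x ∈ D, (γ x).PosDef)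
    (hc : ∀ x ∈ D, metricTrace γ (ricci γ) x = 0 ∧ 6 * tInv γ x ^ 2 = sInv γ x ^ 3 ∧
      contractGrad γ (PTensor γ) (sInv γ) x = 0 ∧ tInv γ x ≠ 0 ∧
      ricci γ x = (cbrt (Omega γ x))⁻¹ • hessian γ (fun y => cbrt (Omega γ y)) x
        - (2 * (Omega γ x + gradSq γ (Omega γ) x)) • PTensor γ x) :
    IsSpatialMetricOfBMetric γ D := by
  have hframe : ∀ x ∈ D, ∃ e : Matrix (Fin 3) (Fin 3) ℝ, doubleEig γ x ≠ 0 ∧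
      e * γ x * e.transpose = 1 ∧
      e * ricci γ x * e.transpose
        = Matrix.diagonal ![-2 * doubleEig γ x, doubleEig γ x, doubleEig γ x] ∧
      IsUniaxial (γ x) (ricci γ x) (doubleEig γ x) ((γ x).mulVec (e 0)) ∧
      ((γ x)⁻¹).mulVec ((γ x).mulVec (e 0)) = e 0 := by
    intro x hx
    obtain ⟨h1, h2, -, h3, -⟩ := hc x hx
    have hRs : (ricci γ x).transpose = ricci γ x := by
      ext i j; exact hγ.ricci_symm hx j i
    obtain ⟨ρ, e, hρ, he, hr⟩ := exists_frame_of_double_eigenvalue (hpos x hx) hRs h1 h2 h3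
    obtain ⟨he0, hR⟩ := uniaxial_of_frame (hγ.transpose hx) he hr
    obtain ⟨hun, hinv⟩ := IsUniaxial.of_vector (hγ.det x hx) (hγ.transpose hx) he0 hR
    have hd := hun.doubleEig_eq (hγ.det x hx) hρ
    exact ⟨e, by rwa [hd], he, by rwa [hd], by rwa [hd], hinv⟩
  have huni : ∀ y ∈ D, doubleEig γ y ≠ 0 ∧
      ∃ n, IsUniaxial (γ y) (ricci γ y) (doubleEig γ y) n := fun y hy => by
    obtain ⟨e, h0, -, -, h, -⟩ := hframe y hy
    exact ⟨h0, _, h⟩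
  have hgrad : ∀ y ∈ D, ∀ n, IsUniaxial (γ y) (ricci γ y) (doubleEig γ y) n →
      ∑ j, ∑ k, (γ y)⁻¹ j k * n j * pd k (doubleEig γ) y = 0 := fun y hy n hn =>
    (contractGrad_eq_zero_iff hγ huni hy hn).1 (hc y hy).2.2.1
  intro x hx
  obtain ⟨M, n, hMo, hxM, hMD, h⟩ := exists_isUniaxialOn hγ (fun y hy => by
    obtain ⟨h0, n, hn⟩ := huni y hy
    exact ⟨_, n, h0, hn, hgrad y hy n hn⟩) hx
  have hγ' := hγ.mono hMo hMD
  obtain ⟨N, U, hNo, hxN, hNM, hU, hR⟩ := h.exists_vacuum_potential hγ'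
    (smooth_logOmega (h.smooth_omega hγ') fun y hy => h.omega_ne_zero hγ' hy)
    (fun y hy i => h.pd_eig_eq hγ' hy i)
    (fun y hy => (h.criterion_iff hγ' hy).1 (hc y (hMD hy)).2.2.2.2) hxM
  have hγN := hγ'.mono hNo hNM
  have hND := hNM.trans hMD
  have hflat : ∀ y ∈ cylinder N, ricci (staticMetric γ U) y = 0 := fun y hy =>
    (static_ricci_eq_zero_iff hγN hU hy).2 ⟨hR _ hy, (hc _ (hND hy)).1⟩
  refine ⟨N, hNo, hxN, hND, U, hU, hflat, fun y => (doubleEig γ (Fin.tail y) : ℂ),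
    Complex.ofRealCLM.contDiff.comp_contDiffOn
      (contDiffOn_tail (h.smooth_eig.mono hNM)), fun y hy => ?_⟩
  obtain ⟨e, h0, he, hr, hun, hinv⟩ := hframe _ (hND hy)
  have dρ := h.smooth_eig.diffAt hMo (hNM hy)
  refine ⟨_, isTypeDFrame_frameMat hγN hU hy (hflat y hy) he h0 hr, ?_, ?_⟩
  -- The frame vector `u₀` is along `∂_T`, on which the eigenvalue does not depend; `u₁` is the
  -- simple eigenvector, for which `P(ds) = 0` gives the vanishing.
  · rw [fderiv_ofReal_tail dρ]
    have : Fin.tail (frameMat (Real.exp (-U (Fin.tail y))) e 0) = 0 := rfl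
    rw [this, map_zero, Complex.ofReal_zero]
  · rw [fderiv_ofReal_tail dρ]
    have : Fin.tail (frameMat (Real.exp (-U (Fin.tail y))) e 1) = e 0 := rfl
    rw [this, ← hγN.sum_inv_mul_pd hy hinv, hgrad _ (hND hy) _ hun, Complex.ofReal_zero]

end Main

end StaticVacuum

theorem mainTheorem2 (D : Set (Fin 3 → ℝ)) (hD : IsOpen D)
    (γ : StaticVacuum.TensorField 3) (hγ : StaticVacuum.IsRiemannianMetricOn γ D) :
    StaticVacuum.IsSpatialMetricOfBMetric γ D ↔
      ∀ x ∈ D,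
        StaticVacuum.metricTrace γ (StaticVacuum.ricci γ) x = 0 ∧
        6 * StaticVacuum.tInv γ x ^ 2 = StaticVacuum.sInv γ x ^ 3 ∧
        StaticVacuum.contractGrad γ (StaticVacuum.PTensor γ) (StaticVacuum.sInv γ) x = 0 ∧
        StaticVacuum.tInv γ x ≠ 0 ∧
        StaticVacuum.ricci γ x =
          (StaticVacuum.cbrt (StaticVacuum.Omega γ x))⁻¹ •
              StaticVacuum.hessian γ (fun y => StaticVacuum.cbrt (StaticVacuum.Omega γ y)) x
            - (2 * (StaticVacuum.Omega γ x
                + StaticVacuum.gradSq γ (StaticVacuum.Omega γ) x)) •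
              StaticVacuum.PTensor γ x := by
  have hm := StaticVacuum.IsRiemannianMetricOn.isMetricOn hD hγ
  refine ⟨fun h x hx => ?_, StaticVacuum.bMetric_of_criterion hm hγ.2⟩
  obtain ⟨N, hNo, hxN, hND, U, hU, hric, hB⟩ := h x hx
  exact StaticVacuum.criterion_of_bMetric (hm.mono hNo hND) (fun y hy => hγ.2 y (hND hy)) hU
    hric hB hxN
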